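/- Consider an oriented graph with finitely many vertices, $K>0$ infinite leads $e_1,\dots,e_K$ and $M$ finite edges $e_{K+1},\dots,e_{K+M}$, where each lead has one vertex and each finite edge has two distinct vertices. Given lengths $\ell_m\in(0,\infty)$ of the finite edges, and $\ell_k=\infty$ for the leads, let $P$ be the operator $(Pu)_m=-\partial_x^2u_m$ on $L^2=\bigoplus_{m=1}^{K+M}L^2([0,\ell_m])$ with domain $$\mathcal D(P)=\Big\{u:\ u_m\in H^2([0,\ell_m]),\ u_m(v)=u_{\ell}(v)\text{ for } v\in e_m\cap e_\ell,\ \sum_{e_m\ni v}\partial_\nu u_m(v)=0\text{ for every vertex }v\Big\},$$ where $\partial_\nu$ is the outward derivative at the end points. Let $R(\lambda)=(P-\lambda^2)^{-1}$ for $\operatorname{Im}\lambda>0$, and let $\mathbf 1_{r\le R}$ be the orthogonal projection of $L^2$ onto $\bigoplus_{k\le K}L^2([0,R])\oplus\bigoplus_{m>K}L^2([0,\ell_m])$. Fix the graph, a compact set $\mathcal L\subset(0,\infty)$, and an open set $\Omega_2\Subset\mathbb C$. Then, for all lengths $\ell_m\in\mathcal L$, the resolvent $R(\lambda)$ continues meromorphically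 to $\lambda\in\mathbb C$ as an operator $L^2_{\rm comp}\to L^2_{\rm loc}$ (that is, $\mathbf 1_{r\le R}R(\lambda)\mathbf 1_{r\le R}$ continues meromorphically as a bounded operator on $L^2$, for every $R>0$). Its poles form the set $\operatorname{Res}(P)$ of resonances; the multiplicity $m(\zeta)$ of a resonance $\zeta$ is the dimension of the span of the ranges of the operators $A_j:L^2_{\rm comp}\to L^2_{\rm loc}$ in the principal part $\sum_{j\ge1}(\lambda-\zeta)^{-j}A_j$ of $R(\lambda)$ at $\zeta$. Moreover: 1. There is a constant $C_1$, depending only on (the graph and) $\Omega_2$ and $\mathcal L$, such that, for all lengths $\ell_m\in\mathcal L$, the number of resonances in $\Omega_2$, counted with multiplicity, is at most $C_1$. 2. For every open set $\Omega_1\Subset\Omega_2$ and every $R>0$ there is a constant $C_2$, depending only on (the graph and) $\Omega_1$, $\Omega_2$, $R$ and $\mathcal L$, such that, for all lengths $\ell_m\in\mathcal L$, $$\big\|\mathbf 1_{r\le R}R(\lambda)\mathbf 1_{r\le R}\big\|_{L^2\to L^2}\le C_2\prod_{\zeta\in\operatorname{Res}(P)\cap\Omega_2}|\lambda-\zeta|^{-m(\zeta)},\qquad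 \lambda\in\Omega_1\setminus\operatorname{Res}(P).$$ -/

import Mathlib

open MeasureTheory Set Filter Topology

noncomputable section

/-- The combinatorial data of an oriented graph with vertices `Fin J`, infinite leads `Fin K` and
finite edges `Fin M`.  A lead has one vertex; a finite edge joins two distinct vertices.  Several
finite edges may join the same pair of vertices. -/
structure OpenGraph (J K M : ℕ) where
  /-- the vertex of a lead, at the coordinate `0` -/
  leadVertex : Fin K → Fin J
  /-- the vertex of a finite edge at the coordinate `0` -/
  source : Fin M → Fin J
  /-- the vertex of a finite edge at the coordinate `ℓ m` -/
  target : Fin M → Fin J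
  /-- there are no loops -/
  source_ne_target : ∀ m, source m ≠ target m

/-- The interval carried by an edge: `[0, ∞)` for a lead, `[0, ℓ m]` for the finite edge `m`. -/
def edgeInterval {K M : ℕ} (ℓ : Fin M → ℝ) : Fin K ⊕ Fin M → Set ℝ
  | Sum.inl _ => Ici 0
  | Sum.inr m => Icc 0 (ℓ m)

/-- The Hilbert space `⨁ L²([0, ℓ_m])`, the sum being over all leads and finite edges. -/
abbrev GraphL2 (K : ℕ) {M : ℕ} (ℓ : Fin M → ℝ) : Type :=
  PiLp 2 (fun e : Fin K ⊕ Fin M => Lp ℂ 2 (volume.restrict (edgeInterval ℓ e)))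

/-- `w` is the continuously differentiable representative of an element of the Sobolev space
`H²(s)`, where `s` is an interval with left end point `0`; its first derivative is `w₁`, which is
absolutely continuous, and its second (weak) derivative is `w₂`. -/
structure IsSobolevTwo (s : Set ℝ) (w w₁ w₂ : ℝ → ℂ) : Prop where
  memLp : MemLp w 2 (volume.restrict s)
  memLp_fst : MemLp w₁ 2 (volume.restrict s)
  memLp_snd : MemLp w₂ 2 (volume.restrict s)
  eq_integral : ∀ x ∈ s, w x = w 0 + ∫ t in (0 : ℝ)..x, w₁ t
  fst_eq_integral : ∀ x ∈ s, w₁ x = w₁ 0 + ∫ t in (0 : ℝ)..x, w₂ t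

/-- The product of an element of `L²` and the indicator function of a measurable set. -/
def indicatorLp (μ : Measure ℝ) (s : Set ℝ) (hs : MeasurableSet s) (f : Lp ℂ 2 μ) : Lp ℂ 2 μ :=
  MemLp.toLp (s.indicator (f : ℝ → ℂ)) ((Lp.memLp f).indicator hs)

theorem coeFn_indicatorLp (μ : Measure ℝ) (s : Set ℝ) (hs : MeasurableSet s) (f : Lp ℂ 2 μ) :
    (indicatorLp μ s hs f : ℝ → ℂ) =ᵐ[μ] s.indicator (f : ℝ → ℂ) :=
  MemLp.coeFn_toLp _

/-- Multiplication by the indicator function of a measurable set, as an operator on `L²`. -/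
def indicatorOp (μ : Measure ℝ) (s : Set ℝ) (hs : MeasurableSet s) :
    Lp ℂ 2 μ →L[ℂ] Lp ℂ 2 μ :=
  LinearMap.mkContinuous
    { toFun := indicatorLp μ s hs
      map_add' := by
        intro f g
        apply Lp.ext
        filter_upwards [Lp.coeFn_add f g, coeFn_indicatorLp μ s hs f, coeFn_indicatorLp μ s hs g,
          coeFn_indicatorLp μ s hs (f + g),
          Lp.coeFn_add (indicatorLp μ s hs f) (indicatorLp μ s hs g)] with x h1 h2 h3 h4 h5
        rw [h4, h5, Pi.add_apply, h2, h3]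
        by_cases h : x ∈ s
        · simp only [indicator_of_mem h, h1, Pi.add_apply]
        · simp only [indicator_of_notMem h, add_zero]
      map_smul' := by
        intro c f
        apply Lp.ext
        filter_upwards [Lp.coeFn_smul c f, coeFn_indicatorLp μ s hs f,
          coeFn_indicatorLp μ s hs (c • f), Lp.coeFn_smul c (indicatorLp μ s hs f)]
          with x h1 h2 h3 h4
        rw [h3, RingHom.id_apply, h4, Pi.smul_apply, h2]
        by_cases h : x ∈ s
        · simp only [indicator_of_mem h, h1, Pi.smul_apply]
        · simp only [indicator_of_notMem h, smul_zero] }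
    1 (by
      intro f
      rw [one_mul]
      refine Lp.norm_le_norm_of_ae_le ?_
      filter_upwards [coeFn_indicatorLp μ s hs f] with x hx
      exact (congrArg norm hx).trans_le (norm_indicator_le_norm_self _ _))

/-- The part `{r ≤ R}` of an edge: `{x ≤ R}` on a lead, everything on a finite edge. -/
def cutoffSet {K M : ℕ} (R : ℝ) : Fin K ⊕ Fin M → Set ℝ
  | Sum.inl _ => Iic R
  | Sum.inr _ => univ

theorem measurableSet_cutoffSet {K M : ℕ} (R : ℝ) (e : Fin K ⊕ Fin M) :
    MeasurableSet (cutoffSet R e) := by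
  cases e
  · exact measurableSet_Iic
  · exact MeasurableSet.univ

/-- The orthogonal projection `1_{r ≤ R}` of the Hilbert space of the graph onto
`⨁_{leads} L²([0, R]) ⊕ ⨁_{finite edges} L²([0, ℓ_m])`. -/
def cutoffOp (K : ℕ) {M : ℕ} (ℓ : Fin M → ℝ) (R : ℝ) : GraphL2 K ℓ →L[ℂ] GraphL2 K ℓ :=
  (PiLp.continuousLinearEquiv 2 ℂ
      (fun e : Fin K ⊕ Fin M => Lp ℂ 2 (volume.restrict (edgeInterval ℓ e)))).symm.toContinuousLinearMap
    ∘L ContinuousLinearMap.pi (fun e =>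
      indicatorOp _ (cutoffSet R e) (measurableSet_cutoffSet R e) ∘L
        PiLp.proj 2 (fun e : Fin K ⊕ Fin M => Lp ℂ 2 (volume.restrict (edgeInterval ℓ e))) e)

/-- `A` is the family of coefficients of the principal part at `ζ` of the operator valued function
`F`: near `ζ`, off `ζ`, `F z = g z + ∑ j, (z - ζ) ^ (-(j + 1)) • A j` with `g` analytic at `ζ`. -/
def IsPrincipalPart {V : Type*} [NormedAddCommGroup V] [NormedSpace ℂ V]
    (F : ℂ → V) (ζ : ℂ) (A : ℕ →₀ V) : Prop :=
  ∃ g : ℂ → V, AnalyticAt ℂ g ζ ∧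
    ∀ᶠ z in 𝓝[≠] ζ, F z = g z + A.sum (fun j a => ((z - ζ) ^ (j + 1))⁻¹ • a)

namespace OpenGraph

variable {J K M : ℕ}

/-- The graph of the Hamiltonian: `u` lies in the domain of `P` and `P u = f`.  Here `w`, `w₁`, `w₂`
are the continuous representatives of `u`, of `u'`, and the second derivative of `u`, on each edge;
`c v` is the common value of `u` at the vertex `v`, and the last condition says that the outward
normal derivatives at every vertex add up to zero. -/
def HamiltonianRel (G : OpenGraph J K M) (ℓ : Fin M → ℝ) (u f : GraphL2 K ℓ) : Prop :=
  ∃ w w₁ w₂ : Fin K ⊕ Fin M → ℝ → ℂ,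
    (∀ e, IsSobolevTwo (edgeInterval ℓ e) (w e) (w₁ e) (w₂ e)) ∧
    (∀ e, u e =ᵐ[volume.restrict (edgeInterval ℓ e)] w e) ∧
    (∀ e, f e =ᵐ[volume.restrict (edgeInterval ℓ e)] fun x => -w₂ e x) ∧
    (∃ c : Fin J → ℂ,
      (∀ k, w (Sum.inl k) 0 = c (G.leadVertex k)) ∧
      (∀ m, w (Sum.inr m) 0 = c (G.source m)) ∧
      (∀ m, w (Sum.inr m) (ℓ m) = c (G.target m))) ∧
    (∀ v : Fin J,
      (∑ k with G.leadVertex k = v, -w₁ (Sum.inl k) 0) +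
      (∑ m with G.source m = v, -w₁ (Sum.inr m) 0) +
      (∑ m with G.target m = v, w₁ (Sum.inr m) (ℓ m)) = 0)

/-- The bounded operator `T` is the inverse `(P - z)⁻¹`. -/
def IsResolventAt (G : OpenGraph J K M) (ℓ : Fin M → ℝ) (z : ℂ)
    (T : GraphL2 K ℓ →L[ℂ] GraphL2 K ℓ) : Prop :=
  (∀ f, G.HamiltonianRel ℓ (T f) (f + z • T f)) ∧
  (∀ u g, G.HamiltonianRel ℓ u g → T (g - z • u) = u)

/-- `F` is the meromorphic continuation to `ℂ` of the cut-off resolvent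
`1_{r ≤ R} (P - λ²)⁻¹ 1_{r ≤ R}`, which is initially defined for `Im λ > 0`.  The normal form fixes
the values of `F` at its removable singularities, and makes `F` unique. -/
def IsCutoffResolvent (G : OpenGraph J K M) (ℓ : Fin M → ℝ) (R : ℝ)
    (F : ℂ → GraphL2 K ℓ →L[ℂ] GraphL2 K ℓ) : Prop :=
  MeromorphicNFOn F univ ∧
  ∀ z : ℂ, 0 < z.im → ∃ T, G.IsResolventAt ℓ (z ^ 2) T ∧
    F z = cutoffOp K ℓ R ∘L T ∘L cutoffOp K ℓ R

open Classical in
/-- The meromorphic continuation `1_{r ≤ R} R(λ) 1_{r ≤ R}` of the cut-off resolvent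
(the zero function if there is no such continuation). -/
def cutoffResolvent (G : OpenGraph J K M) (ℓ : Fin M → ℝ) (R : ℝ) :
    ℂ → GraphL2 K ℓ →L[ℂ] GraphL2 K ℓ :=
  if h : ∃ F, G.IsCutoffResolvent ℓ R F then h.choose else 0

/-- The set of resonances: the poles of the continued resolvent as an operator from `L²_comp` to
`L²_loc`, that is, the points that are poles of some cut-off resolvent. -/
def Res (G : OpenGraph J K M) (ℓ : Fin M → ℝ) : Set ℂ :=
  {ζ | ∃ R : ℝ, 0 < R ∧ meromorphicOrderAt (G.cutoffResolvent ℓ R) ζ < 0}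

/-- The multiplicity of a resonance: if `∑ j, (λ - ζ) ^ (-j) A_j` is the principal part at `ζ` of
the resolvent, as an operator from `L²_comp` to `L²_loc`, it is the dimension of the span of the
ranges of all the `A_j`, which is the supremum over `R` of the corresponding dimension for
`1_{r ≤ R} A_j 1_{r ≤ R}`. -/
def resMultiplicity (G : OpenGraph J K M) (ℓ : Fin M → ℝ) (ζ : ℂ) : ℕ∞ :=
  ⨆ (R : ℝ) (_ : 0 < R) (A : ℕ →₀ (GraphL2 K ℓ →L[ℂ] GraphL2 K ℓ))
    (_ : IsPrincipalPart (G.cutoffResolvent ℓ R) ζ A),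
    Cardinal.toENat (Module.rank ℂ
      (⨆ j, LinearMap.range ((A j : GraphL2 K ℓ →ₗ[ℂ] GraphL2 K ℓ)) : Submodule ℂ (GraphL2 K ℓ)))

end OpenGraph

end

/-! For `Im z > 0` the resolvent is explicit. On each edge a solution of `-u'' - z² u = f` is `i /
(2z)` times the sum of the free term `∫ exp (i z |x - y|) f y dy` and of plane waves: an outgoing
one on a lead, one in each direction on a finite edge. Continuity at the vertices and Kirchhoff's
condition form a square linear system for the amplitudes and the vertex values (`boundaryMap`), and
its right-hand side (`boundaryData`) depends on `f` only through the integrals of `f` against the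
waves. The energy identity makes this system injective (`resDet_ne_zero`), and Cramer's rule writes
the cut-off resolvent as `numerator / denominator`, where the denominator is `z` times the
determinant. Both are entire in `z`, so the quotient is the continuation, and every resonance is a
zero of the denominator. The denominator is jointly continuous in `z` and the lengths, and the
numerator is bounded for bounded `z` uniformly in the lengths; since the admissible lengths form a
compact set, this makes all constants uniform.

Counting: let `n` be the order of the zero of the denominator at `ζ`. Taylor expansion of the
cut-off waves to order `n` puts the ranges of all coefficients of the principal part into a space of
dimension at most `(K + 2M) n`, for every `R` (`resMultiplicity_le`). The zeros of the denominator
in a disc are counted by dividing them out and applying the maximum principle, with centre `i`,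
where compactness gives a lower bound.

Bound: the product of the resolvent and `∏ (z - ζ) ^ m(ζ)` has no poles in `Ω₂`, provided that the
order of each pole is at most its multiplicity (`neg_resMultiplicity_le_meromorphicOrderAt`). It is
then enough to estimate this product on small circles that avoid the zeros of the denominator, to
pass to the discs by the maximum principle, and to cover a compact set.

The comparison of order and multiplicity is the heart of the matter. For `ζ ≠ 0`, the expansion `z²
- ζ² = 2ζ (z - ζ) + (z - ζ)²` turns the resolvent equation into a chain relation between the
coefficients, which makes them linearly independent when applied to a suitable vector. At `ζ = 0`
the linear term disappears, and the energy identity on the imaginary axis takes over. The pole has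
order at most two; the coefficient of `z⁻²` maps into functions that vanish on the leads; and
conservation of flux forces the coefficient of `z⁻¹` to reach the leads. Hence a double pole has
multiplicity at least two. This step is where a lead is needed. -/

noncomputable section

/-! ### Primitives of integrable functions -/

theorem IntervalIntegrable.absolutelyContinuousOnInterval_integral_complex {f : ℝ → ℂ} {a b : ℝ}
    (h : IntervalIntegrable f volume a b) :
    AbsolutelyContinuousOnInterval (fun x => ∫ t in a..x, f t) a b := by
  have hre : IntervalIntegrable (fun x => (f x).re) volume a b := ⟨h.1.re, h.2.re⟩
  have him : IntervalIntegrable (fun x => (f x).im) volume a b := ⟨h.1.im, h.2.im⟩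
  have hc : ∀ c : ℂ, AbsolutelyContinuousOnInterval (fun _ : ℝ => c) a b := fun c =>
    (LipschitzWith.const c).lipschitzOnWith.absolutelyContinuousOnInterval
  have h1 := (hre.absolutelyContinuousOnInterval_intervalIntegral left_mem_uIcc).fun_smul (hc 1)
  have h2 := (him.absolutelyContinuousOnInterval_intervalIntegral left_mem_uIcc).fun_smul
    (hc Complex.I)
  have key := h1.fun_add h2
  unfold AbsolutelyContinuousOnInterval at key ⊢
  refine key.congr' ?_
  -- Absolute continuity on `[a, b]` tests only points of `[a, b]`, and there the combination of
  -- real and imaginary parts agrees with the complex integral; elsewhere it need not.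
  have hmem : ∀ᶠ E : ℕ × (ℕ → ℝ × ℝ) in AbsolutelyContinuousOnInterval.totalLengthFilter ⊓
      𝓟 (AbsolutelyContinuousOnInterval.disjWithin a b),
      E ∈ AbsolutelyContinuousOnInterval.disjWithin a b :=
    eventually_inf_principal.2 (Eventually.of_forall fun _ h => h)
  have heq : ∀ x ∈ uIcc a b, ((∫ t in a..x, (f t).re) • (1 : ℂ) +
      (∫ t in a..x, (f t).im) • Complex.I) = ∫ t in a..x, f t := by
    intro x hx
    have hx' : IntervalIntegrable f volume a x := h.mono_set (uIcc_subset_uIcc_left hx)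
    have e1 := intervalIntegral.intervalIntegral_re (μ := volume) hx'
    have e2 := intervalIntegral.intervalIntegral_im (μ := volume) hx'
    simp only [RCLike.re_eq_complex_re, RCLike.im_eq_complex_im] at e1 e2
    rw [e1, e2, Complex.real_smul, Complex.real_smul, mul_one, Complex.re_add_im]
  filter_upwards [hmem] with E hE
  refine Finset.sum_congr rfl fun i hi => ?_
  have := hE.1 i (by simpa using hi)
  rw [heq _ this.1, heq _ this.2]

/-- On `[0, L]`, the function `p` is a primitive of the integrable function `q`. -/
structure IsPrimitive (L : ℝ) (p q : ℝ → ℂ) : Prop where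
  nonneg : 0 ≤ L
  integrable : IntervalIntegrable q volume 0 L
  eq_integral : ∀ x ∈ Icc 0 L, p x = p 0 + ∫ t in (0 : ℝ)..x, q t

namespace IsPrimitive

variable {L : ℝ} {p p' q q' : ℝ → ℂ}

theorem intervalIntegrable (h : IsPrimitive L p p') {x : ℝ} (hx : x ∈ Icc 0 L) :
    IntervalIntegrable p' volume 0 x :=
  h.integrable.mono_set (by
    rw [uIcc_of_le hx.1, uIcc_of_le (hx.1.trans hx.2)]; exact Icc_subset_Icc_right hx.2)

theorem continuousOn (h : IsPrimitive L p p') : ContinuousOn p (Icc 0 L) := by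
  have hL := h.nonneg
  have := (h.integrable.absolutelyContinuousOnInterval_integral_complex).continuousOn
  rw [uIcc_of_le hL] at this
  exact (continuousOn_const (c := p 0).add this).congr fun x hx => h.eq_integral x hx

theorem sub_eq_integral (h : IsPrimitive L p p') {x y : ℝ} (hx : x ∈ Icc 0 L)
    (hy : y ∈ Icc 0 L) : p y - p x = ∫ t in x..y, p' t := by
  rw [h.eq_integral x hx, h.eq_integral y hy, add_sub_add_left_eq_sub,
    intervalIntegral.integral_interval_sub_left (h.intervalIntegrable hy) (h.intervalIntegrable hx)]

theorem of_hasDerivAt (hL : 0 ≤ L) (h : ∀ x, HasDerivAt p (q x) x) (hq : Continuous q) :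
    IsPrimitive L p q where
  nonneg := hL
  integrable := hq.intervalIntegrable _ _
  eq_integral x _ := by
    rw [intervalIntegral.integral_eq_sub_of_hasDerivAt (fun y _ => h y)
      (hq.intervalIntegrable _ _)]
    ring

theorem of_integral (hL : 0 ≤ L) (hq : IntervalIntegrable q volume 0 L) (c : ℂ) :
    IsPrimitive L (fun x => c + ∫ t in (0 : ℝ)..x, q t) q :=
  ⟨hL, hq, fun x _ => by simp⟩

theorem congr_ae (h : IsPrimitive L p p') (hq : ∀ᵐ x ∂volume.restrict (Icc 0 L), p' x = q' x) :
    IsPrimitive L p q' := by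
  have hL := h.nonneg
  have hq2 : ∀ x ∈ Icc 0 L, ∀ᵐ t ∂volume.restrict (uIoc 0 x), p' t = q' t := by
    intro x hx
    rw [uIoc_of_le hx.1]
    exact ae_restrict_of_ae_restrict_of_subset
      (Ioc_subset_Icc_self.trans (Icc_subset_Icc_right hx.2)) hq
  refine ⟨hL, (intervalIntegrable_congr_ae (hq2 L ⟨hL, le_rfl⟩)).1 h.integrable, fun x hx => ?_⟩
  rw [h.eq_integral x hx]
  congr 1
  exact intervalIntegral.integral_congr_ae_restrict (hq2 x hx)

theorem add (hp : IsPrimitive L p p') (hq : IsPrimitive L q q') :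
    IsPrimitive L (fun x => p x + q x) (fun x => p' x + q' x) where
  nonneg := hp.nonneg
  integrable := hp.integrable.add hq.integrable
  eq_integral x hx := by
    rw [intervalIntegral.integral_add (hp.intervalIntegrable hx) (hq.intervalIntegrable hx),
      hp.eq_integral x hx, hq.eq_integral x hx]
    ring

theorem const_mul (hp : IsPrimitive L p p') (c : ℂ) :
    IsPrimitive L (fun x => c * p x) (fun x => c * p' x) where
  nonneg := hp.nonneg
  integrable := hp.integrable.const_mul c
  eq_integral x hx := by
    rw [intervalIntegral.integral_const_mul, hp.eq_integral x hx]
    ring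

theorem conj (hp : IsPrimitive L p p') :
    IsPrimitive L (fun x => starRingEnd ℂ (p x)) (fun x => starRingEnd ℂ (p' x)) where
  nonneg := hp.nonneg
  integrable := by
    have h := hp.integrable
    exact ⟨(Complex.conjLIE.toContinuousLinearEquiv.toContinuousLinearMap.integrable_comp h.1),
      (Complex.conjLIE.toContinuousLinearEquiv.toContinuousLinearMap.integrable_comp h.2)⟩
  eq_integral x hx := by
    rw [hp.eq_integral x hx, map_add]
    congr 1
    exact (Complex.conjLIE.toContinuousLinearEquiv.toContinuousLinearMap.intervalIntegral_comp_comm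
      (hp.intervalIntegrable hx)).symm

/-- This is integration by parts for absolutely continuous functions: `P Q - ∫ (p' Q + P q')` is
absolutely continuous with derivative zero almost everywhere, hence constant. The functions `P`, `Q`
stand in for `p`, `q`, about which nothing is known off `[0, L]`. -/
theorem mul (hp : IsPrimitive L p p') (hq : IsPrimitive L q q') :
    IsPrimitive L (fun x => p x * q x) (fun x => p' x * q x + p x * q' x) := by
  have hL := hp.nonneg
  set P : ℝ → ℂ := fun x => p 0 + ∫ t in (0 : ℝ)..x, p' t with hP
  set Q : ℝ → ℂ := fun x => q 0 + ∫ t in (0 : ℝ)..x, q' t with hQ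
  have hc : ∀ c : ℂ, AbsolutelyContinuousOnInterval (fun _ : ℝ => c) 0 L := fun c =>
    (LipschitzWith.const c).lipschitzOnWith.absolutelyContinuousOnInterval
  have aP : AbsolutelyContinuousOnInterval P 0 L :=
    (hc (p 0)).fun_add hp.integrable.absolutelyContinuousOnInterval_integral_complex
  have aQ : AbsolutelyContinuousOnInterval Q 0 L :=
    (hc (q 0)).fun_add hq.integrable.absolutelyContinuousOnInterval_integral_complex
  have hint : IntervalIntegrable (fun x => p' x * Q x + P x * q' x) volume 0 L :=
    (hp.integrable.mul_continuousOn aQ.continuousOn).add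
      (hq.integrable.continuousOn_mul aP.continuousOn)
  have hcongr : ∀ x ∈ Icc 0 L, p' x * Q x + P x * q' x = p' x * q x + p x * q' x := by
    intro x hx
    simp only [hP, hQ, ← hp.eq_integral x hx, ← hq.eq_integral x hx]
  have aH := (aP.fun_smul aQ).fun_sub hint.absolutelyContinuousOnInterval_integral_complex
  obtain ⟨C, hC⟩ := aH.const_of_ae_hasDerivAt_zero (by
    filter_upwards [hp.integrable.ae_hasDerivAt_integral, hq.integrable.ae_hasDerivAt_integral,
      hint.ae_hasDerivAt_integral] with x h1 h2 h3 hx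
    have d1 : HasDerivAt P (p' x) x := by simpa [hP] using (h1 hx 0 left_mem_uIcc).const_add (p 0)
    have d2 : HasDerivAt Q (q' x) x := by simpa [hQ] using (h2 hx 0 left_mem_uIcc).const_add (q 0)
    have d3 := (d1.mul d2).sub (h3 hx 0 left_mem_uIcc)
    rw [sub_self] at d3
    exact d3)
  rw [uIcc_of_le hL] at hC
  have h0 := hC 0 ⟨le_rfl, hL⟩
  refine IsPrimitive.mk hL ?_ ?_
  · refine hint.congr ?_
    intro x hx
    rw [uIoc_of_le hL] at hx
    exact hcongr x (Ioc_subset_Icc_self hx)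
  · intro x hx
    have h1 := hC x hx
    have e : (∫ t in (0 : ℝ)..x, (p' t * q t + p t * q' t)) =
        ∫ t in (0 : ℝ)..x, (p' t * Q t + P t * q' t) := by
      refine intervalIntegral.integral_congr fun t ht => ?_
      rw [uIcc_of_le hx.1] at ht
      exact (hcongr t ⟨ht.1, ht.2.trans hx.2⟩).symm
    simp only [smul_eq_mul] at h0 h1
    rw [e, hp.eq_integral x hx, hq.eq_integral x hx]
    simp only [hP, hQ, intervalIntegral.integral_same, add_zero, sub_zero] at h0 h1 ⊢
    linear_combination h1 - h0

end IsPrimitive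

end

noncomputable section

/-! ### Functions on the graph -/

namespace IsSobolevTwo

variable {s : Set ℝ} {w w₁ w₂ : ℝ → ℂ} {L : ℝ}

theorem _root_.MeasureTheory.MemLp.intervalIntegrable_of_subset {f : ℝ → ℂ}
    (hf : MemLp f 2 (volume.restrict s)) (hL : 0 ≤ L) (hs : Icc 0 L ⊆ s) :
    IntervalIntegrable f volume 0 L := by
  have h : MemLp f 2 (volume.restrict (Icc 0 L)) := hf.mono_measure (Measure.restrict_mono hs le_rfl)
  have h2 : IntegrableOn f (Icc 0 L) := h.integrable (by norm_num)
  rw [intervalIntegrable_iff_integrableOn_Icc_of_le hL]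
  exact h2

theorem isPrimitive (h : IsSobolevTwo s w w₁ w₂) (hL : 0 ≤ L) (hs : Icc 0 L ⊆ s) :
    IsPrimitive L w w₁ :=
  ⟨hL, h.memLp_fst.intervalIntegrable_of_subset hL hs, fun x hx => h.eq_integral x (hs hx)⟩

theorem isPrimitive_fst (h : IsSobolevTwo s w w₁ w₂) (hL : 0 ≤ L) (hs : Icc 0 L ⊆ s) :
    IsPrimitive L w₁ w₂ :=
  ⟨hL, h.memLp_snd.intervalIntegrable_of_subset hL hs, fun x hx => h.fst_eq_integral x (hs hx)⟩

theorem sub {v v₁ v₂ : ℝ → ℂ} (hs : ∀ x ∈ s, 0 ≤ x ∧ Icc 0 x ⊆ s) (h : IsSobolevTwo s w w₁ w₂)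
    (h' : IsSobolevTwo s v v₁ v₂) :
    IsSobolevTwo s (fun x => w x - v x) (fun x => w₁ x - v₁ x) (fun x => w₂ x - v₂ x) where
  memLp := h.memLp.sub h'.memLp
  memLp_fst := h.memLp_fst.sub h'.memLp_fst
  memLp_snd := h.memLp_snd.sub h'.memLp_snd
  eq_integral x hx := by
    obtain ⟨h0, h1⟩ := hs x hx
    rw [intervalIntegral.integral_sub (h.isPrimitive h0 h1).integrable
      (h'.isPrimitive h0 h1).integrable, h.eq_integral x hx, h'.eq_integral x hx]
    ring
  fst_eq_integral x hx := by
    obtain ⟨h0, h1⟩ := hs x hx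
    rw [intervalIntegral.integral_sub (h.isPrimitive_fst h0 h1).integrable
      (h'.isPrimitive_fst h0 h1).integrable, h.fst_eq_integral x hx, h'.fst_eq_integral x hx]
    ring

/-- A square integrable solution of `-w'' = z² w` on `[R, ∞)`, with `0 < Im z`, is outgoing. -/
theorem fst_eq_of_outgoing (h : IsSobolevTwo (Ici 0) w w₁ w₂) {z : ℂ} (hz : 0 < z.im) {R : ℝ}
    (hR : 0 ≤ R)
    (hw : ∀ᵐ x ∂volume.restrict (Ici (0 : ℝ)), R < x → w₂ x = -(z ^ 2 * w x)) :
    w₁ R = Complex.I * z * w R := by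
  -- The derivative of `p` is `(w₂ + z² w) exp (i z x)`, which vanishes beyond `R`; so `p` measures
  -- the incoming wave and is constant there.
  set p : ℝ → ℂ := fun x => (w₁ x + -(Complex.I * z) * w x) * Complex.exp (Complex.I * z * x)
    with hp
  have hexp : ∀ x : ℝ, HasDerivAt (fun x : ℝ => Complex.exp (Complex.I * z * x))
      (Complex.I * z * Complex.exp (Complex.I * z * x)) x := by
    intro x
    have h1 : HasDerivAt (fun x : ℝ => Complex.I * z * (x : ℂ)) (Complex.I * z) x := by
      simpa using (Complex.ofRealCLM.hasDerivAt (x := x)).const_mul (Complex.I * z)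
    convert h1.cexp using 1
    ring
  have hprim : ∀ L, 0 ≤ L → IsPrimitive L p (fun x =>
      (w₂ x + -(Complex.I * z) * w₁ x) * Complex.exp (Complex.I * z * x) +
      (w₁ x + -(Complex.I * z) * w x) * (Complex.I * z * Complex.exp (Complex.I * z * x))) := by
    intro L hL
    have hs : Icc 0 L ⊆ Ici (0 : ℝ) := Icc_subset_Ici_self
    exact ((h.isPrimitive_fst hL hs).add ((h.isPrimitive hL hs).const_mul _)).mul
      (IsPrimitive.of_hasDerivAt hL hexp (by fun_prop))
  have hconst : ∀ x, R ≤ x → p x = p R := by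
    intro x hx
    have hx0 := hR.trans hx
    have := (hprim x hx0).sub_eq_integral ⟨hR, hx⟩ ⟨hx0, le_rfl⟩
    rw [← sub_eq_zero, this]
    refine (intervalIntegral.integral_congr_ae_restrict (g := fun _ => 0) ?_).trans (by simp)
    rw [uIoc_of_le hx]
    have h2 : ∀ᵐ t ∂volume.restrict (Ioc R x), R < t → w₂ t = -(z ^ 2 * w t) :=
      ae_restrict_of_ae_restrict_of_subset (fun t ht => hR.trans ht.1.le) hw
    filter_upwards [h2, ae_restrict_mem measurableSet_Ioc] with t ht ht'
    rw [ht ht'.1]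
    linear_combination -(z ^ 2 * w t * Complex.exp (Complex.I * z * t)) * Complex.I_sq
  -- As `|exp (i z x)| ≤ 1`, the constant `p R` is dominated by a square integrable function on a
  -- half-line of infinite measure.
  have hzero : p R = 0 := by
    have hm : MemLp (fun x => w₁ x + -(Complex.I * z) * w x) 2 (volume.restrict (Ici R)) :=
      (h.memLp_fst.add (h.memLp.const_mul _)).mono_measure
        (Measure.restrict_mono (Ici_subset_Ici.2 hR) le_rfl)
    have hm2 : MemLp (fun _ : ℝ => p R) 2 (volume.restrict (Ici R)) := by
      refine hm.of_le aestronglyMeasurable_const ?_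
      filter_upwards [ae_restrict_mem measurableSet_Ici] with x hx
      rw [← hconst x hx, hp]
      simp only [norm_mul]
      refine mul_le_of_le_one_right (norm_nonneg _) ?_
      rw [Complex.norm_exp, Real.exp_le_one_iff]
      have : (Complex.I * z * (x : ℂ)).re = -(z.im * x) := by simp
      rw [this]
      have := mul_nonneg hz.le (hR.trans hx)
      linarith
    rw [memLp_const_iff (by norm_num) (by norm_num)] at hm2
    simpa using hm2
  have := (mul_eq_zero.1 hzero).resolve_right (Complex.exp_ne_zero _)
  linear_combination this

end IsSobolevTwo

theorem edgeInterval_subset {K M : ℕ} (ℓ : Fin M → ℝ) (e : Fin K ⊕ Fin M) {x : ℝ}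
    (hx : x ∈ edgeInterval ℓ e) : 0 ≤ x ∧ Icc 0 x ⊆ edgeInterval ℓ e := by
  cases e with
  | inl k => exact ⟨hx, Icc_subset_Ici_self⟩
  | inr m => exact ⟨hx.1, Icc_subset_Icc_right hx.2⟩

/-- The length of the part `{r ≤ R}` of an edge. -/
def cutoffLength {K M : ℕ} (R : ℝ) (ℓ : Fin M → ℝ) : Fin K ⊕ Fin M → ℝ :=
  Sum.elim (fun _ => R) ℓ

theorem cutoffLength_pos {K M : ℕ} {R : ℝ} (hR : 0 < R) {ℓ : Fin M → ℝ} (hℓ : ∀ m, 0 < ℓ m)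
    (e : Fin K ⊕ Fin M) : 0 < cutoffLength R ℓ e := by
  cases e <;> simp [cutoffLength, hR, hℓ]

theorem cutoffLength_nonneg {K M : ℕ} {R : ℝ} (hR : 0 ≤ R) {ℓ : Fin M → ℝ} (hℓ : ∀ m, 0 < ℓ m)
    (e : Fin K ⊕ Fin M) : 0 ≤ cutoffLength R ℓ e := by
  cases e <;> simp [cutoffLength, hR, (hℓ _).le]

theorem Icc_cutoffLength_subset {K M : ℕ} (R : ℝ) (ℓ : Fin M → ℝ) (e : Fin K ⊕ Fin M) :
    Icc 0 (cutoffLength R ℓ e) ⊆ edgeInterval ℓ e := by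
  cases e
  · exact Icc_subset_Ici_self
  · exact subset_rfl

theorem edgeInterval_inter_cutoffSet {K M : ℕ} (R : ℝ) (ℓ : Fin M → ℝ) (e : Fin K ⊕ Fin M) :
    edgeInterval ℓ e ∩ cutoffSet R e = Icc 0 (cutoffLength R ℓ e) := by
  cases e
  · exact Ici_inter_Iic
  · exact inter_univ _

theorem measurableSet_edgeInterval {K M : ℕ} (ℓ : Fin M → ℝ) (e : Fin K ⊕ Fin M) :
    MeasurableSet (edgeInterval ℓ e) := by
  cases e
  · exact measurableSet_Ici
  · exact measurableSet_Icc

/-! ### Green's formula, the energy identity and uniqueness -/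

namespace OpenGraph

variable {J K M : ℕ}

/-- A function on the graph with `H²` regularity on the edges, which is continuous at the vertices
and satisfies the Kirchhoff condition. -/
structure IsDomainFunction (G : OpenGraph J K M) (ℓ : Fin M → ℝ)
    (w w₁ w₂ : Fin K ⊕ Fin M → ℝ → ℂ) : Prop where
  sobolev : ∀ e, IsSobolevTwo (edgeInterval ℓ e) (w e) (w₁ e) (w₂ e)
  vertex : ∃ c : Fin J → ℂ,
      (∀ k, w (Sum.inl k) 0 = c (G.leadVertex k)) ∧
      (∀ m, w (Sum.inr m) 0 = c (G.source m)) ∧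
      (∀ m, w (Sum.inr m) (ℓ m) = c (G.target m))
  kirchhoff : ∀ v : Fin J,
      (∑ k with G.leadVertex k = v, -w₁ (Sum.inl k) 0) +
      (∑ m with G.source m = v, -w₁ (Sum.inr m) 0) +
      (∑ m with G.target m = v, w₁ (Sum.inr m) (ℓ m)) = 0

variable {G : OpenGraph J K M} {ℓ : Fin M → ℝ} {w w₁ w₂ : Fin K ⊕ Fin M → ℝ → ℂ}

theorem hamiltonianRel_iff {u f : GraphL2 K ℓ} : G.HamiltonianRel ℓ u f ↔
    ∃ w w₁ w₂ : Fin K ⊕ Fin M → ℝ → ℂ, G.IsDomainFunction ℓ w w₁ w₂ ∧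
      (∀ e, u e =ᵐ[volume.restrict (edgeInterval ℓ e)] w e) ∧
      (∀ e, f e =ᵐ[volume.restrict (edgeInterval ℓ e)] fun x => -w₂ e x) :=
  ⟨fun ⟨w, w₁, w₂, h1, h2, h3, h4, h5⟩ => ⟨w, w₁, w₂, ⟨h1, h4, h5⟩, h2, h3⟩,
    fun ⟨w, w₁, w₂, h, h2, h3⟩ => ⟨w, w₁, w₂, h.1, h2, h3, h.2, h.3⟩⟩

namespace IsDomainFunction

theorem sub {v v₁ v₂ : Fin K ⊕ Fin M → ℝ → ℂ} (h : G.IsDomainFunction ℓ w w₁ w₂)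
    (h' : G.IsDomainFunction ℓ v v₁ v₂) :
    G.IsDomainFunction ℓ (fun e x => w e x - v e x) (fun e x => w₁ e x - v₁ e x)
      (fun e x => w₂ e x - v₂ e x) where
  sobolev e := (h.sobolev e).sub (fun _ hx => edgeInterval_subset ℓ e hx) (h'.sobolev e)
  vertex := by
    obtain ⟨c, h1, h2, h3⟩ := h.vertex
    obtain ⟨c', h1', h2', h3'⟩ := h'.vertex
    exact ⟨fun v => c v - c' v, fun k => by rw [h1, h1'], fun k => by rw [h2, h2'],
      fun k => by rw [h3, h3']⟩
  kirchhoff v := by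
    have e1 := h.kirchhoff v
    have e2 := h'.kirchhoff v
    simp only [Finset.sum_neg_distrib, Finset.sum_sub_distrib] at e1 e2 ⊢
    linear_combination e1 - e2

theorem isPrimitive (h : G.IsDomainFunction ℓ w w₁ w₂) (hℓ : ∀ m, 0 < ℓ m) {R : ℝ} (hR : 0 ≤ R)
    (e : Fin K ⊕ Fin M) : IsPrimitive (cutoffLength R ℓ e) (w e) (w₁ e) :=
  (h.sobolev e).isPrimitive (cutoffLength_nonneg hR hℓ e) (Icc_cutoffLength_subset R ℓ e)

theorem isPrimitive_fst (h : G.IsDomainFunction ℓ w w₁ w₂) (hℓ : ∀ m, 0 < ℓ m) {R : ℝ}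
    (hR : 0 ≤ R) (e : Fin K ⊕ Fin M) : IsPrimitive (cutoffLength R ℓ e) (w₁ e) (w₂ e) :=
  (h.sobolev e).isPrimitive_fst (cutoffLength_nonneg hR hℓ e) (Icc_cutoffLength_subset R ℓ e)

/-- Kirchhoff's condition at `v` is multiplied by `d v` and summed; the sum over vertices is then
regrouped as a sum over the ends of the edges. In this form it cancels the vertex terms in Green's
formula. -/
theorem sum_vertex_eq_zero (h : G.IsDomainFunction ℓ w w₁ w₂) (d : Fin J → ℂ) :
    (∑ k, d (G.leadVertex k) * -w₁ (Sum.inl k) 0) + ∑ m, d (G.source m) * -w₁ (Sum.inr m) 0 +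
      ∑ m, d (G.target m) * w₁ (Sum.inr m) (ℓ m) = 0 := by
  have key : ∑ v, d v * ((∑ k with G.leadVertex k = v, -w₁ (Sum.inl k) 0) +
      (∑ m with G.source m = v, -w₁ (Sum.inr m) 0) +
      (∑ m with G.target m = v, w₁ (Sum.inr m) (ℓ m))) = 0 :=
    Finset.sum_eq_zero fun v _ => by rw [h.kirchhoff v, mul_zero]
  have aux : ∀ {n : ℕ} (g : Fin n → Fin J) (y : Fin n → ℂ),
      ∑ v, d v * ∑ k with g k = v, y k = ∑ k, d (g k) * y k := by
    intro n g y
    rw [← Finset.sum_fiberwise Finset.univ g]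
    refine Finset.sum_congr rfl fun v _ => ?_
    rw [Finset.mul_sum]
    refine Finset.sum_congr rfl fun k hk => ?_
    rw [(Finset.mem_filter.1 hk).2]
  simp only [mul_add, Finset.sum_add_distrib, aux] at key
  exact key

/-- Green's formula on the part `{r ≤ R}` of the graph, for a function `q` that is continuous at the
vertices. -/
theorem sum_integral_eq (h : G.IsDomainFunction ℓ w w₁ w₂) (hℓ : ∀ m, 0 < ℓ m) {R : ℝ}
    (hR : 0 ≤ R) {q q' : Fin K ⊕ Fin M → ℝ → ℂ}
    (hq : ∀ e, IsPrimitive (cutoffLength R ℓ e) (q e) (q' e)) {d : Fin J → ℂ}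
    (hd1 : ∀ k, q (Sum.inl k) 0 = d (G.leadVertex k))
    (hd2 : ∀ m, q (Sum.inr m) 0 = d (G.source m))
    (hd3 : ∀ m, q (Sum.inr m) (ℓ m) = d (G.target m)) :
    ∑ e, ∫ x in (0 : ℝ)..cutoffLength R ℓ e, (q' e x * w₁ e x + q e x * w₂ e x) =
      ∑ k, q (Sum.inl k) R * w₁ (Sum.inl k) R := by
  have h1 : ∀ e, ∫ x in (0 : ℝ)..cutoffLength R ℓ e, (q' e x * w₁ e x + q e x * w₂ e x) =
      q e (cutoffLength R ℓ e) * w₁ e (cutoffLength R ℓ e) - q e 0 * w₁ e 0 := by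
    intro e
    have hL := cutoffLength_nonneg hR hℓ e
    exact (((hq e).mul (h.isPrimitive_fst hℓ hR e)).sub_eq_integral ⟨le_rfl, hL⟩
      ⟨hL, le_rfl⟩).symm
  have h2 := h.sum_vertex_eq_zero d
  rw [Finset.sum_congr rfl fun e _ => h1 e]
  simp only [Fintype.sum_sum_type, cutoffLength, Sum.elim_inl, Sum.elim_inr, hd1, hd2, hd3,
    Finset.sum_sub_distrib]
  simp only [mul_neg, Finset.sum_neg_distrib] at h2
  linear_combination h2

/-- Green's formula with the constant function `1`. This conservation of flux is what detects the
pole at `0`. -/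
theorem sum_integral_snd (h : G.IsDomainFunction ℓ w w₁ w₂) (hℓ : ∀ m, 0 < ℓ m) {R : ℝ}
    (hR : 0 ≤ R) :
    ∑ e, ∫ x in (0 : ℝ)..cutoffLength R ℓ e, w₂ e x = ∑ k, w₁ (Sum.inl k) R := by
  have := h.sum_integral_eq hℓ hR (q := fun _ _ => 1) (q' := fun _ _ => 0) (d := fun _ => 1)
    (fun e => ⟨cutoffLength_nonneg hR hℓ e, by simp, by simp⟩) (by simp) (by simp) (by simp)
  simpa using this

variable {z : ℂ} {R : ℝ} {f : Fin K ⊕ Fin M → ℝ → ℂ}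

theorem fst_eq_of_outgoing (h : G.IsDomainFunction ℓ w w₁ w₂) (hz : 0 < z.im) (hR : 0 ≤ R)
    (hw : ∀ e, ∀ᵐ x ∂volume.restrict (edgeInterval ℓ e), -w₂ e x = f e x + z ^ 2 * w e x)
    (hf : ∀ k, ∀ᵐ x ∂volume.restrict (Ici (0 : ℝ)), R < x → f (Sum.inl k) x = 0) (k : Fin K) :
    w₁ (Sum.inl k) R = Complex.I * z * w (Sum.inl k) R := by
  refine (h.sobolev (Sum.inl k)).fst_eq_of_outgoing hz hR ?_
  filter_upwards [hw (Sum.inl k), hf k] with x h1 h2 hx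
  rw [h2 hx, zero_add] at h1
  linear_combination -h1

/-- The energy identity for `(P - z²) w = f`, where `f` vanishes on the leads beyond `R`. -/
theorem energy (h : G.IsDomainFunction ℓ w w₁ w₂) (hℓ : ∀ m, 0 < ℓ m) (hz : 0 < z.im) (hR : 0 ≤ R)
    (hw : ∀ e, ∀ᵐ x ∂volume.restrict (edgeInterval ℓ e), -w₂ e x = f e x + z ^ 2 * w e x)
    (hf : ∀ k, ∀ᵐ x ∂volume.restrict (Ici (0 : ℝ)), R < x → f (Sum.inl k) x = 0) :
    ((∑ e, ∫ x in (0 : ℝ)..cutoffLength R ℓ e, ‖w₁ e x‖ ^ 2 : ℝ) : ℂ) -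
      z ^ 2 * ((∑ e, ∫ x in (0 : ℝ)..cutoffLength R ℓ e, ‖w e x‖ ^ 2 : ℝ) : ℂ) -
      Complex.I * z * ((∑ k, ‖w (Sum.inl k) R‖ ^ 2 : ℝ) : ℂ) =
    ∑ e, ∫ x in (0 : ℝ)..cutoffLength R ℓ e, starRingEnd ℂ (w e x) * f e x := by
  obtain ⟨c, hc1, hc2, hc3⟩ := h.vertex
  -- Green's formula is applied to the conjugate of `w`; the outgoing condition turns the terms at
  -- `r = R` into `i z |w R|²`.
  have key := h.sum_integral_eq hℓ hR (q := fun e x => starRingEnd ℂ (w e x))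
    (q' := fun e x => starRingEnd ℂ (w₁ e x)) (d := fun v => starRingEnd ℂ (c v))
    (fun e => (h.isPrimitive hℓ hR e).conj) (fun k => by rw [hc1]) (fun k => by rw [hc2])
    (fun k => by rw [hc3])
  have hout := h.fst_eq_of_outgoing hz hR hw hf
  have hint : ∀ e, ∫ x in (0 : ℝ)..cutoffLength R ℓ e,
      (starRingEnd ℂ (w₁ e x) * w₁ e x + starRingEnd ℂ (w e x) * w₂ e x) =
      ((∫ x in (0 : ℝ)..cutoffLength R ℓ e, ‖w₁ e x‖ ^ 2 : ℝ) : ℂ) -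
      z ^ 2 * ((∫ x in (0 : ℝ)..cutoffLength R ℓ e, ‖w e x‖ ^ 2 : ℝ) : ℂ) -
      ∫ x in (0 : ℝ)..cutoffLength R ℓ e, starRingEnd ℂ (w e x) * f e x := by
    intro e
    have hL := cutoffLength_nonneg hR hℓ e
    have hcw : ContinuousOn (w e) (uIcc 0 (cutoffLength R ℓ e)) := by
      rw [uIcc_of_le hL]; exact (h.isPrimitive hℓ hR e).continuousOn
    have hcw1 : ContinuousOn (w₁ e) (uIcc 0 (cutoffLength R ℓ e)) := by
      rw [uIcc_of_le hL]; exact (h.isPrimitive_fst hℓ hR e).continuousOn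
    have hsub : uIoc 0 (cutoffLength R ℓ e) ⊆ edgeInterval ℓ e := by
      rw [uIoc_of_le hL]; exact Ioc_subset_Icc_self.trans (Icc_cutoffLength_subset R ℓ e)
    have hw' := ae_restrict_of_ae_restrict_of_subset hsub (hw e)
    have hfi : IntervalIntegrable (fun x => starRingEnd ℂ (w e x) * f e x) volume 0
        (cutoffLength R ℓ e) := by
      have i1 : IntervalIntegrable (fun x => starRingEnd ℂ (w e x) *
          (-w₂ e x - z ^ 2 * w e x)) volume 0 (cutoffLength R ℓ e) :=
        ((h.isPrimitive_fst hℓ hR e).integrable.neg.sub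
          (hcw.intervalIntegrable.const_mul _)).continuousOn_mul
          (Complex.continuous_conj.comp_continuousOn hcw)
      refine (intervalIntegrable_congr_ae ?_).1 i1
      filter_upwards [hw'] with x hx
      rw [hx, add_sub_cancel_right]
    have i1 : IntervalIntegrable (fun x => ((‖w₁ e x‖ ^ 2 : ℝ) : ℂ)) volume 0
        (cutoffLength R ℓ e) :=
      (Complex.continuous_ofReal.comp_continuousOn (hcw1.norm.pow 2)).intervalIntegrable
    have i2 : IntervalIntegrable (fun x => z ^ 2 * ((‖w e x‖ ^ 2 : ℝ) : ℂ)) volume 0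
        (cutoffLength R ℓ e) :=
      ((Complex.continuous_ofReal.comp_continuousOn (hcw.norm.pow 2)).intervalIntegrable).const_mul _
    rw [← intervalIntegral.integral_ofReal, ← intervalIntegral.integral_ofReal,
      ← intervalIntegral.integral_const_mul, ← intervalIntegral.integral_sub i1 i2,
      ← intervalIntegral.integral_sub (i1.sub i2) hfi]
    refine intervalIntegral.integral_congr_ae_restrict ?_
    filter_upwards [hw'] with x hx
    have e1 : starRingEnd ℂ (w₁ e x) * w₁ e x = ((‖w₁ e x‖ ^ 2 : ℝ) : ℂ) := by
      rw [Complex.conj_mul']; push_cast; rfl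
    have e2 : starRingEnd ℂ (w e x) * w e x = ((‖w e x‖ ^ 2 : ℝ) : ℂ) := by
      rw [Complex.conj_mul']; push_cast; rfl
    rw [e1, ← e2]
    linear_combination (-starRingEnd ℂ (w e x)) * hx
  simp only [hint, hout, Finset.sum_sub_distrib, ← Finset.mul_sum, ← Complex.ofReal_sum] at key
  have e3 : ∑ k, starRingEnd ℂ (w (Sum.inl k) R) * (Complex.I * z * w (Sum.inl k) R) =
      Complex.I * z * ((∑ k, ‖w (Sum.inl k) R‖ ^ 2 : ℝ) : ℂ) := by
    push_cast
    rw [Finset.mul_sum]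
    refine Finset.sum_congr rfl fun k _ => ?_
    rw [← Complex.conj_mul']
    ring
  rw [e3] at key
  linear_combination key

end IsDomainFunction

/-- Multiplication by the conjugate of `-i z` gives all three terms a nonnegative real part: `Im z ·
X`, `Im z |z|² Y` and `|z|² Z`. This also covers purely imaginary `z`, for which `z²` is real and an
imaginary part would carry no information. -/
theorem _root_.eq_zero_of_energy_eq_zero {z : ℂ} (hz : 0 < z.im) {X Y Z : ℝ} (hX : 0 ≤ X)
    (hY : 0 ≤ Y) (hZ : 0 ≤ Z) (h : (X : ℂ) - z ^ 2 * Y - Complex.I * z * Z = 0) :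
    X = 0 ∧ Y = 0 := by
  have h2 : (starRingEnd ℂ (-(Complex.I * z)) * ((X : ℂ) - z ^ 2 * Y - Complex.I * z * Z)).re = 0 := by
    rw [h, mul_zero]; rfl
  have h3 : (starRingEnd ℂ (-(Complex.I * z)) * ((X : ℂ) - z ^ 2 * Y - Complex.I * z * Z)).re =
      z.im * X + z.im * (z.re ^ 2 + z.im ^ 2) * Y + (z.re ^ 2 + z.im ^ 2) * Z := by
    simp [pow_two]
    ring
  rw [h3] at h2
  have p1 : 0 < z.re ^ 2 + z.im ^ 2 := add_pos_of_nonneg_of_pos (sq_nonneg _) (pow_pos hz 2)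
  have q1 : 0 ≤ z.im * X := mul_nonneg hz.le hX
  have q2 : 0 ≤ z.im * (z.re ^ 2 + z.im ^ 2) * Y := mul_nonneg (mul_nonneg hz.le p1.le) hY
  have q3 : 0 ≤ (z.re ^ 2 + z.im ^ 2) * Z := mul_nonneg p1.le hZ
  have r1 : z.im * X = 0 := by linarith
  have r2 : z.im * (z.re ^ 2 + z.im ^ 2) * Y = 0 := by linarith
  exact ⟨(mul_eq_zero.1 r1).resolve_left hz.ne',
    (mul_eq_zero.1 r2).resolve_left (mul_pos hz p1).ne'⟩

theorem _root_.eqOn_zero_of_integral_norm_sq {p : ℝ → ℂ} {L : ℝ} (hL : 0 < L)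
    (hp : ContinuousOn p (Icc 0 L)) (h : ∫ x in (0 : ℝ)..L, ‖p x‖ ^ 2 = 0) :
    ∀ x ∈ Icc 0 L, p x = 0 := by
  by_contra! hne
  obtain ⟨x, hx, hpx⟩ := hne
  have := intervalIntegral.integral_pos hL (hp.norm.pow 2) (fun y _ => sq_nonneg _)
    ⟨x, hx, pow_pos (norm_pos_iff.2 hpx) 2⟩
  exact this.ne' h

/-- `z²` is not an eigenvalue if `0 < Im z`. -/
theorem IsDomainFunction.eq_zero (h : G.IsDomainFunction ℓ w w₁ w₂) (hℓ : ∀ m, 0 < ℓ m) {z : ℂ}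
    (hz : 0 < z.im)
    (hw : ∀ e, ∀ᵐ x ∂volume.restrict (edgeInterval ℓ e), -w₂ e x = z ^ 2 * w e x)
    (e : Fin K ⊕ Fin M) {x : ℝ} (hx : x ∈ edgeInterval ℓ e) : w e x = 0 ∧ w₁ e x = 0 := by
  obtain ⟨R, hR, hxR⟩ : ∃ R, 0 < R ∧ x ∈ Icc 0 (cutoffLength R ℓ e) := by
    cases e with
    | inl k => exact ⟨x + 1, by have : 0 ≤ x := hx; linarith, hx, by simp [cutoffLength]⟩
    | inr m => exact ⟨1, one_pos, hx⟩
  have key := h.energy (f := fun _ _ => 0) hℓ hz hR.le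
    (fun e => (hw e).mono fun x hx => by rw [hx, zero_add]) (fun k => by simp)
  simp only [mul_zero, intervalIntegral.integral_zero, Finset.sum_const_zero] at key
  have hn : ∀ (p : Fin K ⊕ Fin M → ℝ → ℂ) (e : Fin K ⊕ Fin M),
      0 ≤ ∫ x in (0 : ℝ)..cutoffLength R ℓ e, ‖p e x‖ ^ 2 := fun p e =>
    intervalIntegral.integral_nonneg (cutoffLength_nonneg hR.le hℓ e) fun _ _ => by positivity
  obtain ⟨k1, k2⟩ := eq_zero_of_energy_eq_zero hz (Finset.sum_nonneg fun e _ => hn w₁ e)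
    (Finset.sum_nonneg fun e _ => hn w e) (Finset.sum_nonneg fun k _ => by positivity) key
  rw [Finset.sum_eq_zero_iff_of_nonneg fun e _ => hn _ e] at k1 k2
  exact ⟨eqOn_zero_of_integral_norm_sq (cutoffLength_pos hR hℓ e)
      (h.isPrimitive hℓ hR.le e).continuousOn (k2 e (Finset.mem_univ _)) x hxR,
    eqOn_zero_of_integral_norm_sq (cutoffLength_pos hR hℓ e)
      (h.isPrimitive_fst hℓ hR.le e).continuousOn (k1 e (Finset.mem_univ _)) x hxR⟩

theorem HamiltonianRel.unique {u v f : GraphL2 K ℓ} {z : ℂ} (hℓ : ∀ m, 0 < ℓ m) (hz : 0 < z.im)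
    (hu : G.HamiltonianRel ℓ u (f + z ^ 2 • u)) (hv : G.HamiltonianRel ℓ v (f + z ^ 2 • v)) :
    u = v := by
  obtain ⟨w, w₁, w₂, hw, hw1, hw2⟩ := hamiltonianRel_iff.1 hu
  obtain ⟨y, y₁, y₂, hy, hy1, hy2⟩ := hamiltonianRel_iff.1 hv
  have h0 := (hw.sub hy).eq_zero hℓ hz (by
    intro e
    have a1 := hw2 e
    have a2 := hy2 e
    simp only [PiLp.add_apply, PiLp.smul_apply] at a1 a2
    filter_upwards [hw1 e, hy1 e, a1, a2, Lp.coeFn_add (f e) (z ^ 2 • u e),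
      Lp.coeFn_add (f e) (z ^ 2 • v e), Lp.coeFn_smul (z ^ 2) (u e),
      Lp.coeFn_smul (z ^ 2) (v e)] with x b1 b2 b3 b4 b5 b6 b7 b8
    rw [b5, Pi.add_apply, b7, Pi.smul_apply, b1, smul_eq_mul] at b3
    rw [b6, Pi.add_apply, b8, Pi.smul_apply, b2, smul_eq_mul] at b4
    linear_combination b4 - b3)
  ext e : 1
  apply Lp.ext
  filter_upwards [hw1 e, hy1 e, ae_restrict_mem (measurableSet_edgeInterval ℓ e)] with x b1 b2 hx
  rw [b1, b2]
  exact sub_eq_zero.1 (h0 e hx).1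

end OpenGraph

end

noncomputable section

open scoped ENNReal BoundedContinuousFunction

/-! ### Integral operators on `L²` -/


/-- Schur's test: Cauchy–Schwarz for the splitting `k g = k^(1/2) · (k^(1/2) g)`, with `h1` bounding
the first factor, then Tonelli and `h2`. -/
theorem lintegral_sq_lintegral_mul_le {μ ν : Measure ℝ} [SFinite μ] [SFinite ν] {k : ℝ → ℝ → ℝ≥0∞}
    (hk : Measurable (Function.uncurry k)) {g : ℝ → ℝ≥0∞} (hg : AEMeasurable g ν) {C : ℝ≥0∞}
    (h1 : ∀ x, ∫⁻ y, k x y ∂ν ≤ C) (h2 : ∀ y, ∫⁻ x, k x y ∂μ ≤ C) :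
    ∫⁻ x, (∫⁻ y, k x y * g y ∂ν) ^ 2 ∂μ ≤ C ^ 2 * ∫⁻ y, g y ^ 2 ∂ν := by
  have hkx : ∀ x, Measurable (k x) := fun x => hk.comp measurable_prodMk_left
  have hp : ∀ x, (∫⁻ y, k x y * g y ∂ν) ^ 2 ≤ C * ∫⁻ y, k x y * g y ^ 2 ∂ν := by
    intro x
    have := ENNReal.lintegral_mul_norm_pow_le (μ := ν) (f := k x) (g := fun y => k x y * g y ^ 2)
      (p := 1 / 2) (q := 1 / 2) (hkx x).aemeasurable ((hkx x).aemeasurable.mul (hg.pow_const 2))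
      (by norm_num) (by norm_num) (by norm_num)
    have e1 : ∀ y, k x y ^ (1 / 2 : ℝ) * (k x y * g y ^ 2) ^ (1 / 2 : ℝ) = k x y * g y := by
      intro y
      rw [ENNReal.mul_rpow_of_nonneg _ _ (by norm_num), ← mul_assoc,
        ← ENNReal.rpow_add_of_nonneg _ _ (by norm_num) (by norm_num), ← ENNReal.rpow_natCast (g y),
        ← ENNReal.rpow_mul]
      norm_num
    simp only [e1] at this
    calc (∫⁻ y, k x y * g y ∂ν) ^ 2
        ≤ ((∫⁻ y, k x y ∂ν) ^ (1 / 2 : ℝ) * (∫⁻ y, k x y * g y ^ 2 ∂ν) ^ (1 / 2 : ℝ)) ^ 2 := by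
          gcongr
      _ = (∫⁻ y, k x y ∂ν) * ∫⁻ y, k x y * g y ^ 2 ∂ν := by
          rw [mul_pow, ← ENNReal.rpow_natCast, ← ENNReal.rpow_mul, ← ENNReal.rpow_natCast,
            ← ENNReal.rpow_mul]
          norm_num
      _ ≤ _ := by gcongr; exact h1 x
  have hm : AEMeasurable (Function.uncurry fun x y => k x y * g y ^ 2) (μ.prod ν) :=
    hk.aemeasurable.mul ((hg.pow_const 2).comp_quasiMeasurePreserving
      Measure.quasiMeasurePreserving_snd)
  have hmk : AEMeasurable (Function.uncurry fun x y => k x y * g y ^ 2) (μ.prod ν) := hm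
  calc ∫⁻ x, (∫⁻ y, k x y * g y ∂ν) ^ 2 ∂μ ≤ ∫⁻ x, C * ∫⁻ y, k x y * g y ^ 2 ∂ν ∂μ :=
        lintegral_mono hp
    _ = C * ∫⁻ x, ∫⁻ y, k x y * g y ^ 2 ∂ν ∂μ := lintegral_const_mul'' _ hmk.lintegral_prod_right'
    _ = C * ∫⁻ y, ∫⁻ x, k x y * g y ^ 2 ∂μ ∂ν := by rw [lintegral_lintegral_swap hmk]
    _ = C * ∫⁻ y, (∫⁻ x, k x y ∂μ) * g y ^ 2 ∂ν := by
        congr 1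
        refine lintegral_congr fun y => ?_
        exact lintegral_mul_const (f := fun x => k x y) (g y ^ 2) (hk.comp measurable_prodMk_right)
    _ ≤ C * ∫⁻ y, C * g y ^ 2 ∂ν := by gcongr with y; exact h2 y
    _ = C ^ 2 * ∫⁻ y, g y ^ 2 ∂ν := by
        rw [lintegral_const_mul'' _ (hg.pow_const 2), ← mul_assoc, sq]

/-- The hypotheses of the Schur test. -/
structure IsSchurKernel (μ ν : Measure ℝ) (k : ℝ → ℝ → ℂ) (C : ℝ) : Prop where
  measurable : Measurable (Function.uncurry k)
  nonneg : 0 ≤ C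
  left : ∀ x, ∫⁻ y, ‖k x y‖ₑ ∂ν ≤ ENNReal.ofReal C
  right : ∀ y, ∫⁻ x, ‖k x y‖ₑ ∂μ ≤ ENNReal.ofReal C

namespace IsSchurKernel

variable {μ ν : Measure ℝ} {k : ℝ → ℝ → ℂ} {C : ℝ}

theorem aemeasurable (h : IsSchurKernel μ ν k C) {f : ℝ → ℂ} (hf : MemLp f 2 ν) :
    AEStronglyMeasurable (Function.uncurry fun x y => k x y * f y) (μ.prod ν) :=
  h.measurable.aestronglyMeasurable.mul hf.1.comp_snd

variable [SFinite μ] [SFinite ν]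

theorem lintegral_le (h : IsSchurKernel μ ν k C) {f : ℝ → ℂ} (hf : MemLp f 2 ν) :
    ∫⁻ x, (∫⁻ y, ‖k x y * f y‖ₑ ∂ν) ^ 2 ∂μ ≤ (ENNReal.ofReal C * eLpNorm f 2 ν) ^ 2 := by
  have := lintegral_sq_lintegral_mul_le (μ := μ) (k := fun x y => ‖k x y‖ₑ) (g := fun y => ‖f y‖ₑ)
    (C := ENNReal.ofReal C) h.measurable.enorm hf.1.enorm h.left h.right
  simp only [enorm_mul]
  refine this.trans (le_of_eq ?_)
  rw [mul_pow]
  congr 1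
  rw [eLpNorm_eq_lintegral_rpow_enorm_toReal (by norm_num) (by norm_num), ← ENNReal.rpow_natCast,
    ← ENNReal.rpow_mul]
  norm_num

theorem ae_integrable (h : IsSchurKernel μ ν k C) {f : ℝ → ℂ} (hf : MemLp f 2 ν) :
    ∀ᵐ x ∂μ, Integrable (fun y => k x y * f y) ν := by
  have h1 := h.lintegral_le hf
  have hm : AEMeasurable (fun x => (∫⁻ y, ‖k x y * f y‖ₑ ∂ν) ^ 2) μ :=
    (h.aemeasurable hf).enorm.lintegral_prod_right'.pow_const 2
  have h2 := ae_lt_top' hm (h1.trans_lt (ENNReal.pow_lt_top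
    (ENNReal.mul_lt_top ENNReal.ofReal_lt_top hf.2))).ne
  filter_upwards [h2] with x hx
  refine ⟨?_, ?_⟩
  · exact (h.measurable.comp measurable_prodMk_left).aestronglyMeasurable.mul hf.1
  · by_contra hcon
    simp only [HasFiniteIntegral, not_lt, top_le_iff] at hcon
    rw [hcon] at hx
    simp at hx

theorem eLpNorm_le (h : IsSchurKernel μ ν k C) {f : ℝ → ℂ} (hf : MemLp f 2 ν) :
    eLpNorm (fun x => ∫ y, k x y * f y ∂ν) 2 μ ≤ ENNReal.ofReal C * eLpNorm f 2 ν := by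
  have h1 := h.lintegral_le hf
  rw [eLpNorm_eq_lintegral_rpow_enorm_toReal (by norm_num) (by norm_num)]
  have h2 : ∫⁻ x, ‖∫ y, k x y * f y ∂ν‖ₑ ^ (2 : ℝ) ∂μ ≤ (ENNReal.ofReal C * eLpNorm f 2 ν) ^ 2 := by
    refine le_trans (lintegral_mono fun x => ?_) h1
    rw [ENNReal.rpow_ofNat]
    gcongr
    exact enorm_integral_le_lintegral_enorm _
  calc (∫⁻ x, ‖∫ y, k x y * f y ∂ν‖ₑ ^ (2 : ℝ≥0∞).toReal ∂μ) ^ (1 / (2 : ℝ≥0∞).toReal)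
      ≤ ((ENNReal.ofReal C * eLpNorm f 2 ν) ^ 2) ^ (1 / (2 : ℝ)) := by
        simpa using ENNReal.rpow_le_rpow h2 (by norm_num : (0 : ℝ) ≤ 1 / 2)
    _ = _ := by
        rw [← ENNReal.rpow_natCast, ← ENNReal.rpow_mul]
        norm_num

theorem memLp (h : IsSchurKernel μ ν k C) {f : ℝ → ℂ} (hf : MemLp f 2 ν) :
    MemLp (fun x => ∫ y, k x y * f y ∂ν) 2 μ :=
  ⟨(h.aemeasurable hf).integral_prod_right',
    (h.eLpNorm_le hf).trans_lt (ENNReal.mul_lt_top ENNReal.ofReal_lt_top hf.2)⟩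

/-- The integral operator with kernel `k`. -/
def op (h : IsSchurKernel μ ν k C) : Lp ℂ 2 ν →L[ℂ] Lp ℂ 2 μ :=
  LinearMap.mkContinuous
    { toFun := fun f => (h.memLp (Lp.memLp f)).toLp
      map_add' := by
        intro f g
        apply Lp.ext
        filter_upwards [(h.memLp (Lp.memLp (f + g))).coeFn_toLp, (h.memLp (Lp.memLp f)).coeFn_toLp,
          (h.memLp (Lp.memLp g)).coeFn_toLp, h.ae_integrable (Lp.memLp f),
          h.ae_integrable (Lp.memLp g), Lp.coeFn_add ((h.memLp (Lp.memLp f)).toLp)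
          ((h.memLp (Lp.memLp g)).toLp)] with x h1 h2 h3 h4 h5 h6
        rw [h1, h6, Pi.add_apply, h2, h3, ← integral_add h4 h5]
        refine integral_congr_ae ?_
        filter_upwards [Lp.coeFn_add f g] with y hy
        rw [hy, Pi.add_apply, mul_add]
      map_smul' := by
        intro c f
        apply Lp.ext
        filter_upwards [(h.memLp (Lp.memLp (c • f))).coeFn_toLp, (h.memLp (Lp.memLp f)).coeFn_toLp,
          Lp.coeFn_smul c ((h.memLp (Lp.memLp f)).toLp)] with x h1 h2 h3
        rw [h1, RingHom.id_apply, h3, Pi.smul_apply, h2, smul_eq_mul, ← integral_const_mul]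
        refine integral_congr_ae ?_
        filter_upwards [Lp.coeFn_smul c f] with y hy
        rw [hy, Pi.smul_apply, smul_eq_mul]
        ring }
    C (by
      intro f
      simp only [LinearMap.coe_mk, AddHom.coe_mk]
      rw [Lp.norm_toLp, Lp.norm_def, ← ENNReal.toReal_ofReal h.nonneg, ← ENNReal.toReal_mul]
      exact ENNReal.toReal_mono (ENNReal.mul_ne_top ENNReal.ofReal_ne_top (Lp.eLpNorm_ne_top f))
        (h.eLpNorm_le (Lp.memLp f)))

theorem coeFn_op (h : IsSchurKernel μ ν k C) (f : Lp ℂ 2 ν) :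
    h.op f =ᵐ[μ] fun x => ∫ y, k x y * f y ∂ν :=
  (h.memLp (Lp.memLp f)).coeFn_toLp

theorem norm_op_le (h : IsSchurKernel μ ν k C) : ‖h.op‖ ≤ C :=
  LinearMap.mkContinuous_norm_le _ h.nonneg _

end IsSchurKernel

/-- A bounded continuous kernel, cut off to a set of finite measure, satisfies the Schur test. -/
theorem isSchurKernel_indicator {μ : Measure ℝ} {A : Set ℝ} (hA : MeasurableSet A) {c : ℝ}
    (hc : μ A ≤ ENNReal.ofReal c) (h0 : 0 ≤ c) (k : (ℝ × ℝ) →ᵇ ℂ) :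
    IsSchurKernel μ μ (fun x y => (A ×ˢ A).indicator k (x, y)) (c * ‖k‖) where
  measurable := k.continuous.measurable.indicator (hA.prod hA)
  nonneg := by positivity
  left x := by
    have : ∀ y, ‖(A ×ˢ A).indicator k (x, y)‖ₑ ≤ A.indicator (fun _ => ENNReal.ofReal ‖k‖) y := by
      intro y
      by_cases hy : y ∈ A
      · rw [indicator_of_mem hy]
        by_cases hx : (x, y) ∈ A ×ˢ A
        · rw [indicator_of_mem hx, ← ofReal_norm]
          exact ENNReal.ofReal_le_ofReal (k.norm_coe_le_norm _)
        · simp [indicator_of_notMem hx]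
      · rw [indicator_of_notMem (fun h => hy h.2)]
        simp
    refine (lintegral_mono this).trans ?_
    rw [lintegral_indicator_const hA, mul_comm, ENNReal.ofReal_mul h0]
    gcongr
  right y := by
    have : ∀ x, ‖(A ×ˢ A).indicator k (x, y)‖ₑ ≤ A.indicator (fun _ => ENNReal.ofReal ‖k‖) x := by
      intro x
      by_cases hy : x ∈ A
      · rw [indicator_of_mem hy]
        by_cases hx : (x, y) ∈ A ×ˢ A
        · rw [indicator_of_mem hx, ← ofReal_norm]
          exact ENNReal.ofReal_le_ofReal (k.norm_coe_le_norm _)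
        · simp [indicator_of_notMem hx]
      · rw [indicator_of_notMem (fun h => hy h.1)]
        simp
    refine (lintegral_mono this).trans ?_
    rw [lintegral_indicator_const hA, mul_comm, ENNReal.ofReal_mul h0]
    gcongr

/-- The map that takes a bounded continuous kernel to the integral operator that it defines on a set
of finite measure. -/
def truncatedOp (μ : Measure ℝ) [SFinite μ] {A : Set ℝ} (hA : MeasurableSet A) {c : ℝ}
    (hc : μ A ≤ ENNReal.ofReal c) (h0 : 0 ≤ c) :
    ((ℝ × ℝ) →ᵇ ℂ) →L[ℂ] (Lp ℂ 2 μ →L[ℂ] Lp ℂ 2 μ) :=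
  LinearMap.mkContinuous
    { toFun := fun k => (isSchurKernel_indicator hA hc h0 k).op
      map_add' := by
        intro k k'
        ext1 f
        apply Lp.ext
        rw [_root_.add_apply]
        filter_upwards [(isSchurKernel_indicator hA hc h0 k).coeFn_op f,
          (isSchurKernel_indicator hA hc h0 k').coeFn_op f,
          (isSchurKernel_indicator hA hc h0 (k + k')).coeFn_op f,
          (isSchurKernel_indicator hA hc h0 k).ae_integrable (Lp.memLp f),
          (isSchurKernel_indicator hA hc h0 k').ae_integrable (Lp.memLp f),
          Lp.coeFn_add ((isSchurKernel_indicator hA hc h0 k).op f)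
            ((isSchurKernel_indicator hA hc h0 k').op f)] with x h1 h2 h3 h4 h5 h6
        rw [h3, h6, Pi.add_apply, h1, h2, ← integral_add h4 h5]
        refine integral_congr_ae (Eventually.of_forall fun y => ?_)
        simp only [BoundedContinuousFunction.coe_add, indicator_add', Pi.add_apply, add_mul]
      map_smul' := by
        intro a k
        ext1 f
        apply Lp.ext
        rw [RingHom.id_apply, _root_.smul_apply]
        filter_upwards [(isSchurKernel_indicator hA hc h0 k).coeFn_op f,
          (isSchurKernel_indicator hA hc h0 (a • k)).coeFn_op f,
          Lp.coeFn_smul a ((isSchurKernel_indicator hA hc h0 k).op f)] with x h1 h2 h3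
        rw [h2, h3, Pi.smul_apply, h1, smul_eq_mul, ← integral_const_mul]
        refine integral_congr_ae (Eventually.of_forall fun y => ?_)
        simp only [BoundedContinuousFunction.coe_smul, smul_eq_mul,
          indicator]
        split_ifs <;> simp [mul_assoc] }
    c fun k => (isSchurKernel_indicator hA hc h0 k).norm_op_le

section truncatedOp

variable {μ : Measure ℝ} [SFinite μ] {A : Set ℝ} {hA : MeasurableSet A} {c : ℝ}
  {hc : μ A ≤ ENNReal.ofReal c} {h0 : 0 ≤ c}

theorem coeFn_truncatedOp (k : (ℝ × ℝ) →ᵇ ℂ) (f : Lp ℂ 2 μ) :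
    truncatedOp μ hA hc h0 k f =ᵐ[μ] fun x => ∫ y, (A ×ˢ A).indicator k (x, y) * f y ∂μ :=
  (isSchurKernel_indicator hA hc h0 k).coeFn_op f

theorem norm_truncatedOp_le : ‖truncatedOp μ hA hc h0‖ ≤ c :=
  LinearMap.mkContinuous_norm_le _ h0 _

end truncatedOp

/-! ### Bounded continuous functions cut off to a set of finite measure -/

theorem memLp_indicator_boundedContinuous {μ : Measure ℝ} {A : Set ℝ} (hA : MeasurableSet A) {c : ℝ}
    (hc : μ A ≤ ENNReal.ofReal c) (g : ℝ →ᵇ ℂ) : MemLp (A.indicator g) 2 μ := by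
  rw [memLp_indicator_iff_restrict hA]
  have : IsFiniteMeasure (μ.restrict A) :=
    ⟨by rw [Measure.restrict_apply_univ]; exact hc.trans_lt ENNReal.ofReal_lt_top⟩
  exact MemLp.of_bound g.continuous.aestronglyMeasurable ‖g‖
    (Eventually.of_forall fun x => g.norm_coe_le_norm x)

/-- The map that takes a bounded continuous function `g` to `1_A g` as an element of `L²`. -/
def truncatedLp (μ : Measure ℝ) {A : Set ℝ} (hA : MeasurableSet A) {c : ℝ}
    (hc : μ A ≤ ENNReal.ofReal c) : (ℝ →ᵇ ℂ) →L[ℂ] Lp ℂ 2 μ :=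
  LinearMap.mkContinuous
    { toFun := fun g => (memLp_indicator_boundedContinuous hA hc g).toLp
      map_add' := by
        intro g g'
        rw [← MemLp.toLp_add]
        congr 1
        ext x
        simp [indicator_add']
      map_smul' := by
        intro a g
        rw [RingHom.id_apply, ← MemLp.toLp_const_smul]
        congr 1
        ext x
        by_cases hx : x ∈ A <;> simp [hx] }
    (Real.sqrt c) (by
      intro g
      simp only [LinearMap.coe_mk, AddHom.coe_mk]
      rw [Lp.norm_toLp]
      have h1 : eLpNorm (A.indicator g) 2 μ ≤ ENNReal.ofReal (Real.sqrt c * ‖g‖) := by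
        rw [eLpNorm_indicator_eq_eLpNorm_restrict hA]
        refine (eLpNorm_le_of_ae_bound (C := ‖g‖)
          (Eventually.of_forall fun x => g.norm_coe_le_norm x)).trans ?_
        rw [Measure.restrict_apply_univ, ENNReal.ofReal_mul (Real.sqrt_nonneg _)]
        gcongr
        rw [Real.sqrt_eq_rpow]
        rcases le_or_gt 0 c with h | h
        · rw [← ENNReal.ofReal_rpow_of_nonneg h (by norm_num)]
          refine (ENNReal.rpow_le_rpow hc (by norm_num)).trans (le_of_eq ?_)
          norm_num
        · rw [ENNReal.ofReal_of_nonpos h.le] at hc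
          simp [le_antisymm hc bot_le]
      exact (ENNReal.toReal_mono ENNReal.ofReal_ne_top h1).trans
        (ENNReal.toReal_ofReal (by positivity)).le)

section truncatedLp

variable {μ : Measure ℝ} {A : Set ℝ} {hA : MeasurableSet A} {c : ℝ}
  {hc : μ A ≤ ENNReal.ofReal c}

theorem coeFn_truncatedLp (g : ℝ →ᵇ ℂ) : truncatedLp μ hA hc g =ᵐ[μ] A.indicator g :=
  (memLp_indicator_boundedContinuous hA hc g).coeFn_toLp

theorem norm_truncatedLp_le : ‖truncatedLp μ hA hc‖ ≤ Real.sqrt c :=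
  LinearMap.mkContinuous_norm_le _ (Real.sqrt_nonneg _) _

end truncatedLp

/-! ### Exponentials of bounded continuous functions -/

section exponentials

variable {X : Type*} [TopologicalSpace X]

/-- The entire function `z ↦ exp (z g)` with values in the bounded continuous functions. -/
def expFamily (g : X →ᵇ ℂ) (z : ℂ) : X →ᵇ ℂ := NormedSpace.exp (z • g)

theorem expFamily_apply (g : X →ᵇ ℂ) (z : ℂ) (x : X) : expFamily g z x = Complex.exp (z * g x) := by
  let φ : (X →ᵇ ℂ) →+* ℂ :=
    { toFun := fun g => g x
      map_one' := rfl
      map_mul' := fun _ _ => rfl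
      map_zero' := rfl
      map_add' := fun _ _ => rfl }
  have := NormedSpace.map_exp φ (BoundedContinuousFunction.evalCLM ℂ x).continuous (z • g)
  rw [Complex.exp_eq_exp_ℂ]
  exact this

/-- The exponential is analytic in the Banach algebra of bounded continuous functions. Composition
with the bounded linear maps `truncatedOp` and `truncatedLp` then yields entire families of
operators and vectors, with no differentiation under an integral sign. -/
theorem analyticAt_expFamily (g : X →ᵇ ℂ) (z : ℂ) : AnalyticAt ℂ (expFamily g) z :=
  (NormedSpace.exp_analytic (𝕂 := ℂ) (z • g)).comp (f := fun z : ℂ => z • g) (by fun_prop)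

theorem norm_expFamily_le (g : X →ᵇ ℂ) (z : ℂ) : ‖expFamily g z‖ ≤ Real.exp (‖z‖ * ‖g‖) := by
  rw [BoundedContinuousFunction.norm_le (by positivity)]
  intro x
  rw [expFamily_apply]
  refine (Complex.norm_exp_le_exp_norm _).trans ?_
  rw [norm_mul]
  gcongr
  exact g.norm_coe_le_norm x

end exponentials

end

noncomputable section

/-! ### Explicit solutions on an edge -/

section edge

variable (z : ℂ) (g : ℝ → ℂ) (Φ α β : ℂ)

/-- The part `∫_0^x exp (i z (x - t)) g t dt` of the free resolvent. -/
def rightPart (x : ℝ) : ℂ :=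
  Complex.exp (Complex.I * z * x) * ∫ t in (0 : ℝ)..x, Complex.exp (-(Complex.I * z) * t) * g t

/-- The part `∫_x exp (i z (t - x)) g t dt` of the free resolvent, where `Φ = ∫ exp (i z t) g t dt`
is the integral over the whole edge. -/
def leftPart (x : ℝ) : ℂ :=
  Complex.exp (-(Complex.I * z) * x) *
    (Φ + ∫ t in (0 : ℝ)..x, -(Complex.exp (Complex.I * z * t) * g t))

/-- A solution of `-u'' - z² u = -2 i z g`. -/
def edgeSolution (x : ℝ) : ℂ :=
  rightPart z g x + leftPart z g Φ x +
    (α * Complex.exp (Complex.I * z * x) + β * Complex.exp (-(Complex.I * z) * x))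

/-- The derivative of `edgeSolution`, divided by `i z`. -/
def edgeSolutionDeriv (x : ℝ) : ℂ :=
  rightPart z g x - leftPart z g Φ x +
    (α * Complex.exp (Complex.I * z * x) - β * Complex.exp (-(Complex.I * z) * x))

variable {z g Φ α β}

theorem hasDerivAt_exp_mul_ofReal (a : ℂ) (x : ℝ) :
    HasDerivAt (fun x : ℝ => Complex.exp (a * x)) (a * Complex.exp (a * x)) x := by
  have h1 : HasDerivAt (fun x : ℝ => a * (x : ℂ)) a x := by
    simpa using (Complex.ofRealCLM.hasDerivAt (x := x)).const_mul a
  convert h1.cexp using 1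
  ring

theorem isPrimitive_exp {L : ℝ} (hL : 0 ≤ L) (a : ℂ) :
    IsPrimitive L (fun x : ℝ => Complex.exp (a * x)) (fun x => a * Complex.exp (a * x)) :=
  IsPrimitive.of_hasDerivAt hL (hasDerivAt_exp_mul_ofReal a) (by fun_prop)

theorem isPrimitive_rightPart {L : ℝ} (hL : 0 ≤ L) (hg : IntervalIntegrable g volume 0 L) :
    IsPrimitive L (rightPart z g) (fun x => Complex.I * z * rightPart z g x + g x) := by
  have hi : IntervalIntegrable (fun t : ℝ => Complex.exp (-(Complex.I * z) * t) * g t) volume 0 L :=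
    hg.continuousOn_mul (Continuous.continuousOn (by fun_prop))
  have h := (isPrimitive_exp hL (Complex.I * z)).mul (IsPrimitive.of_integral hL hi 0)
  simp only [zero_add] at h
  refine h.congr_ae (Eventually.of_forall fun x => ?_)
  have : Complex.exp (Complex.I * z * x) * Complex.exp (-(Complex.I * z) * x) = 1 := by
    rw [← Complex.exp_add]; simp
  simp only [rightPart]
  linear_combination (g x) * this

theorem isPrimitive_leftPart {L : ℝ} (hL : 0 ≤ L) (hg : IntervalIntegrable g volume 0 L) :
    IsPrimitive L (leftPart z g Φ) (fun x => -(Complex.I * z) * leftPart z g Φ x - g x) := by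
  have hi : IntervalIntegrable (fun t : ℝ => -(Complex.exp (Complex.I * z * t) * g t)) volume 0 L :=
    (hg.continuousOn_mul (Continuous.continuousOn (by fun_prop))).neg
  have h := (isPrimitive_exp hL (-(Complex.I * z))).mul (IsPrimitive.of_integral hL hi Φ)
  refine h.congr_ae (Eventually.of_forall fun x => ?_)
  have : Complex.exp (-(Complex.I * z) * x) * Complex.exp (Complex.I * z * x) = 1 := by
    rw [← Complex.exp_add]; simp
  simp only [leftPart]
  linear_combination (-g x) * this

/-- The inhomogeneous terms `g` and `-g` in the derivatives of the right and left parts cancel in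
the first derivative; in the second one they add up to `2 i z g`. -/
theorem isPrimitive_edgeSolution {L : ℝ} (hL : 0 ≤ L) (hg : IntervalIntegrable g volume 0 L) :
    IsPrimitive L (edgeSolution z g Φ α β)
      (fun x => Complex.I * z * edgeSolutionDeriv z g Φ α β x) := by
  have h := ((isPrimitive_rightPart (z := z) hL hg).add (isPrimitive_leftPart (z := z) (Φ := Φ) hL
    hg)).add (((isPrimitive_exp hL (Complex.I * z)).const_mul α).add
      ((isPrimitive_exp hL (-(Complex.I * z))).const_mul β))
  refine h.congr_ae (Eventually.of_forall fun x => ?_)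
  simp only [edgeSolutionDeriv]
  ring

theorem isPrimitive_edgeSolutionDeriv {L : ℝ} (hL : 0 ≤ L) (hg : IntervalIntegrable g volume 0 L) :
    IsPrimitive L (edgeSolutionDeriv z g Φ α β)
      (fun x => Complex.I * z * edgeSolution z g Φ α β x + 2 * g x) := by
  have h := ((isPrimitive_rightPart (z := z) hL hg).add ((isPrimitive_leftPart (z := z) (Φ := Φ) hL
    hg).const_mul (-1))).add (((isPrimitive_exp hL (Complex.I * z)).const_mul α).add
      ((isPrimitive_exp hL (-(Complex.I * z))).const_mul (-β)))
  have e : edgeSolutionDeriv z g Φ α β = fun x => rightPart z g x + -1 * leftPart z g Φ x +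
      (α * Complex.exp (Complex.I * z * x) + -β * Complex.exp (-(Complex.I * z) * x)) := by
    ext x
    simp only [edgeSolutionDeriv]
    ring
  rw [e]
  refine h.congr_ae (Eventually.of_forall fun x => ?_)
  simp only [edgeSolution]
  ring

/-- The kernel of the operator `g ↦ rightPart z g`. -/
def rightKernel (z : ℂ) (x y : ℝ) : ℂ := if y ≤ x then Complex.exp (Complex.I * z * (x - y)) else 0

/-- The kernel of the operator `g ↦ leftPart z g Φ`. -/
def leftKernel (z : ℂ) (x y : ℝ) : ℂ := if y ≤ x then 0 else Complex.exp (Complex.I * z * (y - x))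

theorem integrable_exp_neg_mul_abs {b : ℝ} (hb : 0 < b) :
    Integrable fun t : ℝ => Real.exp (-(b * |t|)) := by
  rw [← integrableOn_univ, ← Iic_union_Ioi (a := (0 : ℝ))]
  refine IntegrableOn.union ?_ ?_
  · refine (integrableOn_exp_mul_Iic hb 0).congr_fun (fun t ht => ?_) measurableSet_Iic
    rw [abs_of_nonpos ht]
    ring_nf
  · refine (integrableOn_exp_mul_Ioi (neg_lt_zero.2 hb) 0).congr_fun (fun t ht => ?_)
      measurableSet_Ioi
    rw [abs_of_pos ht]
    ring_nf

/-- The bound depends on `x - y` only, so by translation invariance its rows and columns all have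
the same integral over the line, and restriction to `s` can only decrease it. -/
theorem isSchurKernel_of_exp_decay {b : ℝ} (hb : 0 < b) {k : ℝ → ℝ → ℂ}
    (hk : Measurable (Function.uncurry k)) (h : ∀ x y, ‖k x y‖ ≤ Real.exp (-(b * |x - y|)))
    (s : Set ℝ) :
    IsSchurKernel (volume.restrict s) (volume.restrict s) k
      (∫ t : ℝ, Real.exp (-(b * |t|))) := by
  have hint := ofReal_integral_eq_lintegral_ofReal (integrable_exp_neg_mul_abs hb)
    (Eventually.of_forall fun t => (Real.exp_pos _).le)
  have hle : ∀ x y, ‖k x y‖ₑ ≤ ENNReal.ofReal (Real.exp (-(b * |x - y|))) := fun x y => by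
    rw [← ofReal_norm]; exact ENNReal.ofReal_le_ofReal (h x y)
  refine ⟨hk, integral_nonneg fun t => (Real.exp_pos _).le, fun x => ?_, fun y => ?_⟩
  · refine (lintegral_mono (hle x)).trans ((lintegral_mono' Measure.restrict_le_self le_rfl).trans ?_)
    rw [hint]
    exact (lintegral_sub_left_eq_self (fun t => ENNReal.ofReal (Real.exp (-(b * |t|)))) x).le
  · refine (lintegral_mono fun x => hle x y).trans
      ((lintegral_mono' Measure.restrict_le_self le_rfl).trans ?_)
    rw [hint]
    exact (lintegral_sub_right_eq_self (fun t => ENNReal.ofReal (Real.exp (-(b * |t|)))) y).le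

theorem isSchurKernel_right (hz : 0 < z.im) (s : Set ℝ) :
    IsSchurKernel (volume.restrict s) (volume.restrict s) (rightKernel z)
      (∫ t : ℝ, Real.exp (-(z.im * |t|))) := by
  refine isSchurKernel_of_exp_decay hz ?_ ?_ s
  · refine Measurable.ite (measurableSet_le measurable_snd measurable_fst) ?_ measurable_const
    fun_prop
  · intro x y
    unfold rightKernel
    split_ifs with hxy
    · rw [Complex.norm_exp, abs_of_nonneg (sub_nonneg.2 hxy)]
      simp
    · rw [norm_zero]; positivity

theorem isSchurKernel_left (hz : 0 < z.im) (s : Set ℝ) :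
    IsSchurKernel (volume.restrict s) (volume.restrict s) (leftKernel z)
      (∫ t : ℝ, Real.exp (-(z.im * |t|))) := by
  refine isSchurKernel_of_exp_decay hz ?_ ?_ s
  · refine Measurable.ite (measurableSet_le measurable_snd measurable_fst) measurable_const ?_
    fun_prop
  · intro x y
    unfold leftKernel
    split_ifs with hxy
    · rw [norm_zero]; positivity
    · rw [Complex.norm_exp, abs_of_neg (sub_neg.2 (not_le.1 hxy))]
      simp

theorem setIntegral_inter_Iic {s : Set ℝ} {x : ℝ} (hx : 0 ≤ x) (hs : s ∩ Iic x = Icc 0 x)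
    (h : ℝ → ℂ) : ∫ y in s ∩ Iic x, h y = ∫ y in (0 : ℝ)..x, h y := by
  rw [hs, intervalIntegral.integral_of_le hx, integral_Icc_eq_integral_Ioc]

theorem integral_rightKernel {s : Set ℝ} {x : ℝ} (hx : 0 ≤ x) (hs : s ∩ Iic x = Icc 0 x) :
    ∫ y in s, rightKernel z x y * g y = rightPart z g x := by
  have h1 : (fun y => rightKernel z x y * g y) =
      (Iic x).indicator fun y => Complex.exp (Complex.I * z * x) *
        (Complex.exp (-(Complex.I * z) * y) * g y) := by
    ext y
    by_cases hy : y ≤ x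
    · rw [indicator_of_mem (mem_Iic.2 hy), rightKernel, if_pos hy, ← mul_assoc, ← Complex.exp_add]
      congr 2
      ring
    · rw [indicator_of_notMem (by simpa using hy), rightKernel, if_neg hy, zero_mul]
  rw [h1, setIntegral_indicator measurableSet_Iic, setIntegral_inter_Iic hx hs,
    intervalIntegral.integral_const_mul, rightPart]

/-- The integral over `y > x` is the integral over the whole edge minus that over `[0, x]`. In this
way the far end of the edge enters `leftPart` only through the number `Φ`, on leads and finite edges
alike. -/
theorem integral_leftKernel {s : Set ℝ} {x : ℝ} (hx : 0 ≤ x) (hs : s ∩ Iic x = Icc 0 x)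
    (hi : IntegrableOn (fun y : ℝ => Complex.exp (Complex.I * z * y) * g y) s) :
    ∫ y in s, leftKernel z x y * g y =
      leftPart z g (∫ y in s, Complex.exp (Complex.I * z * y) * g y) x := by
  have h1 : (fun y => leftKernel z x y * g y) = fun y : ℝ =>
      Complex.exp (-(Complex.I * z) * x) * ((Complex.exp (Complex.I * z * y) * g y) -
      (Iic x).indicator (fun y : ℝ => Complex.exp (Complex.I * z * y) * g y) y) := by
    ext y
    by_cases hy : y ≤ x
    · rw [indicator_of_mem (mem_Iic.2 hy), leftKernel, if_pos hy]
      ring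
    · rw [indicator_of_notMem (by simpa using hy), leftKernel, if_neg hy, sub_zero, ← mul_assoc,
        ← Complex.exp_add]
      congr 2
      ring
  rw [h1, integral_const_mul, integral_sub hi (hi.indicator measurableSet_Iic),
    setIntegral_indicator measurableSet_Iic, setIntegral_inter_Iic hx hs, leftPart,
    intervalIntegral.integral_neg, sub_eq_add_neg]

end edge

theorem edgeInterval_inter_Iic {K M : ℕ} (ℓ : Fin M → ℝ) (e : Fin K ⊕ Fin M) {x : ℝ}
    (hx : x ∈ edgeInterval ℓ e) : edgeInterval ℓ e ∩ Iic x = Icc 0 x := by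
  cases e with
  | inl k => exact Ici_inter_Iic
  | inr m =>
    ext y
    exact ⟨fun h => ⟨h.1.1, h.2⟩, fun h => ⟨⟨h.1, h.2.trans hx.2⟩, h.2⟩⟩

theorem memLp_exp_edgeInterval_lead {z : ℂ} (hz : 0 < z.im) :
    MemLp (fun x : ℝ => Complex.exp (Complex.I * z * x)) 2 (volume.restrict (Ici (0 : ℝ))) := by
  rw [memLp_two_iff_integrable_sq_norm (by fun_prop)]
  have h := (integrableOn_Ici_iff_integrableOn_Ioi (μ := volume)).2
    (integrableOn_exp_mul_Ioi (a := -(2 * z.im)) (by linarith) 0)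
  refine h.congr (Eventually.of_forall fun x => ?_)
  simp only [Complex.norm_exp, ← Real.exp_nat_mul]
  congr 1
  simp
  ring

theorem memLp_exp_edgeInterval_finite (a : ℂ) (L : ℝ) :
    MemLp (fun x : ℝ => Complex.exp (a * x)) 2 (volume.restrict (Icc (0 : ℝ) L)) := by
  have hc : Continuous fun x : ℝ => Complex.exp (a * x) := by fun_prop
  obtain ⟨C, hC⟩ := isCompact_Icc.exists_bound_of_continuousOn (hc.continuousOn (s := Icc 0 L))
  exact MemLp.of_bound hc.aestronglyMeasurable C
    ((ae_restrict_mem measurableSet_Icc).mono fun x hx => hC x hx)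

end

noncomputable section

/-! ### The boundary matrix -/

/-- The indices of the amplitudes: one outgoing wave on each lead, and a right moving and a left
moving wave on each finite edge. -/
abbrev WaveIndex (K M : ℕ) : Type := Fin K ⊕ (Fin M ⊕ Fin M)

namespace WaveIndex

variable {K M : ℕ}

/-- The edge that carries a wave. -/
def edge : WaveIndex K M → Fin K ⊕ Fin M
  | Sum.inl k => Sum.inl k
  | Sum.inr (Sum.inl m) => Sum.inr m
  | Sum.inr (Sum.inr m) => Sum.inr m

/-- The direction of a wave. -/
def sign : WaveIndex K M → ℂ
  | Sum.inl _ => 1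
  | Sum.inr (Sum.inl _) => 1
  | Sum.inr (Sum.inr _) => -1

/-- The plane wave `exp (± i z x)`. -/
def wave (z : ℂ) (i : WaveIndex K M) (x : ℝ) : ℂ := Complex.exp (Complex.I * z * (i.sign * x))

theorem memLp_wave {z : ℂ} (hz : 0 < z.im) (ℓ : Fin M → ℝ) (i : WaveIndex K M) :
    MemLp (wave z i) 2 (volume.restrict (edgeInterval ℓ i.edge)) := by
  have e : wave z i = fun x : ℝ => Complex.exp (Complex.I * z * i.sign * x) := by
    ext x
    rw [wave, mul_assoc (Complex.I * z)]
  rw [e]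
  rcases i with k | m | m
  · simp only [sign, mul_one]
    exact memLp_exp_edgeInterval_lead hz
  · exact memLp_exp_edgeInterval_finite _ _
  · exact memLp_exp_edgeInterval_finite _ _

end WaveIndex

namespace OpenGraph

variable {J K M : ℕ}

/-- A vertex that belongs to no edge. -/
def IsIsolated (G : OpenGraph J K M) (v : Fin J) : Prop :=
  (∀ k, G.leadVertex k ≠ v) ∧ (∀ m, G.source m ≠ v) ∧ ∀ m, G.target m ≠ v

open Classical in
/-- The linear map whose kernel consists of the amplitudes of outgoing waves, and their values at the
vertices, that satisfy the vertex conditions. -/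
def boundaryMap (G : OpenGraph J K M) (ℓ : Fin M → ℝ) (z : ℂ) :
    (WaveIndex K M ⊕ Fin J → ℂ) →ₗ[ℂ] (WaveIndex K M ⊕ Fin J → ℂ) where
  toFun x
    | Sum.inl (Sum.inl k) => x (Sum.inl (Sum.inl k)) - x (Sum.inr (G.leadVertex k))
    | Sum.inl (Sum.inr (Sum.inl m)) =>
        x (Sum.inl (Sum.inr (Sum.inl m))) + x (Sum.inl (Sum.inr (Sum.inr m))) -
          x (Sum.inr (G.source m))
    | Sum.inl (Sum.inr (Sum.inr m)) =>
        Complex.exp (Complex.I * z * ℓ m) * x (Sum.inl (Sum.inr (Sum.inl m))) +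
          Complex.exp (-(Complex.I * z) * ℓ m) * x (Sum.inl (Sum.inr (Sum.inr m))) -
          x (Sum.inr (G.target m))
    | Sum.inr v =>
        (∑ k with G.leadVertex k = v, -x (Sum.inl (Sum.inl k))) +
        (∑ m with G.source m = v,
          (x (Sum.inl (Sum.inr (Sum.inr m))) - x (Sum.inl (Sum.inr (Sum.inl m))))) +
        (∑ m with G.target m = v,
          (Complex.exp (Complex.I * z * ℓ m) * x (Sum.inl (Sum.inr (Sum.inl m))) -
          Complex.exp (-(Complex.I * z) * ℓ m) * x (Sum.inl (Sum.inr (Sum.inr m))))) +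
        -- At an isolated vertex Kirchhoff's row is empty and the vertex value occurs in no
        -- continuity row. Without this term the matrix would have a zero row and a zero column, and
        -- its determinant would vanish identically.
        if G.IsIsolated v then x (Sum.inr v) else 0
  map_add' x y := by
    ext i
    rcases i with (k | m | m) | v
    · simp only [Pi.add_apply]; ring
    · simp only [Pi.add_apply]; ring
    · simp only [Pi.add_apply]; ring
    · simp only [Pi.add_apply, mul_add, Finset.sum_add_distrib, Finset.sum_sub_distrib,
        Finset.sum_neg_distrib]
      split_ifs <;> ring
  map_smul' a x := by
    ext i
    rcases i with (k | m | m) | v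
    · simp only [Pi.smul_apply, smul_eq_mul, RingHom.id_apply]; ring
    · simp only [Pi.smul_apply, smul_eq_mul, RingHom.id_apply]; ring
    · simp only [Pi.smul_apply, smul_eq_mul, RingHom.id_apply]; ring
    · simp only [Pi.smul_apply, smul_eq_mul, RingHom.id_apply, mul_add, Finset.mul_sum]
      congr 1
      · congr 1
        · congr 1
          · exact Finset.sum_congr rfl fun _ _ => by ring
          · exact Finset.sum_congr rfl fun _ _ => by ring
        · exact Finset.sum_congr rfl fun _ _ => by ring
      · split_ifs <;> ring

/-- The boundary values of the free resolvent, as a function of the integrals of the right hand side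
against the waves. -/
def boundaryData (G : OpenGraph J K M) (ℓ : Fin M → ℝ) (z : ℂ) :
    (WaveIndex K M → ℂ) →ₗ[ℂ] (WaveIndex K M ⊕ Fin J → ℂ) where
  toFun φ
    | Sum.inl (Sum.inl k) => -φ (Sum.inl k)
    | Sum.inl (Sum.inr (Sum.inl m)) => -φ (Sum.inr (Sum.inl m))
    | Sum.inl (Sum.inr (Sum.inr m)) => -(Complex.exp (Complex.I * z * ℓ m) * φ (Sum.inr (Sum.inr m)))
    | Sum.inr v =>
        (∑ k with G.leadVertex k = v, -φ (Sum.inl k)) +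
        (∑ m with G.source m = v, -φ (Sum.inr (Sum.inl m))) +
        ∑ m with G.target m = v, -(Complex.exp (Complex.I * z * ℓ m) * φ (Sum.inr (Sum.inr m)))
  map_add' x y := by
    ext i
    rcases i with (k | m | m) | v
    · simp only [Pi.add_apply]; ring
    · simp only [Pi.add_apply]; ring
    · simp only [Pi.add_apply]; ring
    · simp only [Pi.add_apply, mul_add, Finset.sum_add_distrib, neg_add]
      ring
  map_smul' a x := by
    ext i
    rcases i with (k | m | m) | v
    · simp only [Pi.smul_apply, smul_eq_mul, RingHom.id_apply]; ring
    · simp only [Pi.smul_apply, smul_eq_mul, RingHom.id_apply]; ring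
    · simp only [Pi.smul_apply, smul_eq_mul, RingHom.id_apply]; ring
    · simp only [Pi.smul_apply, smul_eq_mul, RingHom.id_apply, mul_add, Finset.mul_sum]
      congr 1
      · congr 1
        · exact Finset.sum_congr rfl fun _ _ => by ring
        · exact Finset.sum_congr rfl fun _ _ => by ring
      · exact Finset.sum_congr rfl fun _ _ => by ring

theorem continuous_boundaryMap (G : OpenGraph J K M) (x : WaveIndex K M ⊕ Fin J → ℂ)
    (i : WaveIndex K M ⊕ Fin J) :
    Continuous fun p : ℂ × (Fin M → ℝ) => G.boundaryMap p.2 p.1 x i := by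
  rcases i with (k | m | m) | v <;> simp only [boundaryMap, LinearMap.coe_mk, AddHom.coe_mk] <;>
    fun_prop

theorem differentiable_boundaryMap (G : OpenGraph J K M) (ℓ : Fin M → ℝ)
    (x : WaveIndex K M ⊕ Fin J → ℂ) (i : WaveIndex K M ⊕ Fin J) :
    Differentiable ℂ fun z => G.boundaryMap ℓ z x i := by
  rcases i with (k | m | m) | v <;> simp only [boundaryMap, LinearMap.coe_mk, AddHom.coe_mk] <;>
    fun_prop

theorem continuous_boundaryData (G : OpenGraph J K M) (φ : WaveIndex K M → ℂ)
    (i : WaveIndex K M ⊕ Fin J) :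
    Continuous fun p : ℂ × (Fin M → ℝ) => G.boundaryData p.2 p.1 φ i := by
  rcases i with (k | m | m) | v <;> simp only [boundaryData, LinearMap.coe_mk, AddHom.coe_mk] <;>
    fun_prop

theorem differentiable_boundaryData (G : OpenGraph J K M) (ℓ : Fin M → ℝ)
    (φ : WaveIndex K M → ℂ) (i : WaveIndex K M ⊕ Fin J) :
    Differentiable ℂ fun z => G.boundaryData ℓ z φ i := by
  rcases i with (k | m | m) | v <;> simp only [boundaryData, LinearMap.coe_mk, AddHom.coe_mk] <;>
    fun_prop

/-- The determinant whose zeros contain the resonances other than `0`. -/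
def resDet (G : OpenGraph J K M) (ℓ : Fin M → ℝ) (z : ℂ) : ℂ :=
  (LinearMap.toMatrix' (G.boundaryMap ℓ z)).det

/-- The coefficients of the resolvent with respect to the waves, multiplied by `resDet`. -/
def resCoeff (G : OpenGraph J K M) (ℓ : Fin M → ℝ) (z : ℂ) (i j : WaveIndex K M) : ℂ :=
  ((LinearMap.toMatrix' (G.boundaryMap ℓ z)).adjugate * LinearMap.toMatrix' (G.boundaryData ℓ z))
    (Sum.inl i) j

/-- Joint continuity in `z` and in the lengths is the source of uniformity: on compact sets of pairs
it yields upper bounds, and lower bounds where the determinant does not vanish. -/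
theorem continuous_resDet (G : OpenGraph J K M) :
    Continuous fun p : ℂ × (Fin M → ℝ) => G.resDet p.2 p.1 := by
  refine Continuous.matrix_det (continuous_pi fun i => continuous_pi fun j => ?_)
  simp only [LinearMap.toMatrix'_apply]
  exact G.continuous_boundaryMap _ i

theorem continuous_resCoeff (G : OpenGraph J K M) (i j : WaveIndex K M) :
    Continuous fun p : ℂ × (Fin M → ℝ) => G.resCoeff p.2 p.1 i j := by
  have h1 : Continuous fun p : ℂ × (Fin M → ℝ) => LinearMap.toMatrix' (G.boundaryMap p.2 p.1) := by
    refine continuous_pi fun i => continuous_pi fun j => ?_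
    simp only [LinearMap.toMatrix'_apply]
    exact G.continuous_boundaryMap _ i
  have h2 : Continuous fun p : ℂ × (Fin M → ℝ) => LinearMap.toMatrix' (G.boundaryData p.2 p.1) := by
    refine continuous_pi fun i => continuous_pi fun j => ?_
    simp only [LinearMap.toMatrix'_apply]
    exact G.continuous_boundaryData _ i
  exact (continuous_apply_apply (Sum.inl i) j).comp (h1.matrix_adjugate.matrix_mul h2)

theorem differentiable_resDet (G : OpenGraph J K M) (ℓ : Fin M → ℝ) :
    Differentiable ℂ (G.resDet ℓ) := by
  have h : ∀ i j, Differentiable ℂ fun z => LinearMap.toMatrix' (G.boundaryMap ℓ z) i j := by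
    intro i j
    simp only [LinearMap.toMatrix'_apply]
    exact G.differentiable_boundaryMap ℓ _ i
  unfold resDet
  simp only [Matrix.det_apply]
  fun_prop

/-- With the adjugate in place of the inverse, the coefficients are polynomials in the entries of
the two matrices, and division by `resDet` is the only source of poles in the scattering term. -/
theorem differentiable_resCoeff (G : OpenGraph J K M) (ℓ : Fin M → ℝ) (i j : WaveIndex K M) :
    Differentiable ℂ fun z => G.resCoeff ℓ z i j := by
  have h : ∀ i j, Differentiable ℂ fun z => LinearMap.toMatrix' (G.boundaryMap ℓ z) i j := by
    intro i j
    simp only [LinearMap.toMatrix'_apply]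
    exact G.differentiable_boundaryMap ℓ _ i
  have h2 : ∀ i j, Differentiable ℂ fun z => LinearMap.toMatrix' (G.boundaryData ℓ z) i j := by
    intro i j
    simp only [LinearMap.toMatrix'_apply]
    exact G.differentiable_boundaryData ℓ _ i
  unfold resCoeff
  simp only [Matrix.mul_apply]
  refine Differentiable.fun_sum fun k _ => Differentiable.mul ?_ (h2 _ _)
  simp only [Matrix.adjugate_apply, Matrix.det_apply, Matrix.updateRow_apply]
  refine Differentiable.fun_sum fun σ _ => Differentiable.const_smul ?_ _
  refine Differentiable.fun_finsetProd fun a _ => ?_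
  split_ifs
  · fun_prop
  · exact h _ _

/-- The amplitude of the right moving wave on an edge. -/
def rightAmplitude (x : WaveIndex K M ⊕ Fin J → ℂ) : Fin K ⊕ Fin M → ℂ :=
  Sum.elim (fun k => x (Sum.inl (Sum.inl k))) fun m => x (Sum.inl (Sum.inr (Sum.inl m)))

/-- The amplitude of the left moving wave on an edge. -/
def leftAmplitude (x : WaveIndex K M ⊕ Fin J → ℂ) : Fin K ⊕ Fin M → ℂ :=
  Sum.elim (fun _ => 0) fun m => x (Sum.inl (Sum.inr (Sum.inr m)))

/-- The index of the right moving wave on an edge. -/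
def rightIndex : Fin K ⊕ Fin M → WaveIndex K M := Sum.elim Sum.inl fun m => Sum.inr (Sum.inl m)

theorem wave_rightIndex (z : ℂ) (e : Fin K ⊕ Fin M) :
    WaveIndex.wave z (rightIndex e) = fun x : ℝ => Complex.exp (Complex.I * z * x) := by
  ext x
  cases e <;> simp [rightIndex, WaveIndex.wave, WaveIndex.sign]

theorem edge_rightIndex (e : Fin K ⊕ Fin M) : (rightIndex e).edge = e := by cases e <;> rfl

variable {G : OpenGraph J K M} {ℓ : Fin M → ℝ} {z : ℂ}

section resolventFunction

variable (z) (f : Fin K ⊕ Fin M → ℝ → ℂ) (φ : WaveIndex K M → ℂ) (x : WaveIndex K M ⊕ Fin J → ℂ)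

/-- The function with amplitudes `x` that solves `(P - z²) u = f` on the edges. -/
def resolventFunction (e : Fin K ⊕ Fin M) (t : ℝ) : ℂ :=
  Complex.I / (2 * z) *
    edgeSolution z (f e) (φ (rightIndex e)) (rightAmplitude x e) (leftAmplitude x e) t

/-- The derivative of `resolventFunction`. -/
def resolventFunctionDeriv (e : Fin K ⊕ Fin M) (t : ℝ) : ℂ :=
  -(1 / 2) * edgeSolutionDeriv z (f e) (φ (rightIndex e)) (rightAmplitude x e) (leftAmplitude x e) t

end resolventFunction

theorem memLp_rightPart (hz : 0 < z.im) {g : ℝ → ℂ} {e : Fin K ⊕ Fin M}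
    (hg : MemLp g 2 (volume.restrict (edgeInterval ℓ e))) :
    MemLp (rightPart z g) 2 (volume.restrict (edgeInterval ℓ e)) := by
  refine ((isSchurKernel_right hz (edgeInterval ℓ e)).memLp hg).ae_eq ?_
  filter_upwards [ae_restrict_mem (measurableSet_edgeInterval ℓ e)] with t ht
  exact integral_rightKernel (edgeInterval_subset ℓ e ht).1 (edgeInterval_inter_Iic ℓ e ht)

theorem integrable_exp_mul (hz : 0 < z.im) {g : ℝ → ℂ} {e : Fin K ⊕ Fin M}
    (hg : MemLp g 2 (volume.restrict (edgeInterval ℓ e))) :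
    IntegrableOn (fun y : ℝ => Complex.exp (Complex.I * z * y) * g y) (edgeInterval ℓ e) := by
  have h := WaveIndex.memLp_wave hz ℓ (rightIndex e)
  rw [wave_rightIndex, edge_rightIndex] at h
  exact h.integrable_mul hg

theorem memLp_leftPart (hz : 0 < z.im) {g : ℝ → ℂ} {e : Fin K ⊕ Fin M}
    (hg : MemLp g 2 (volume.restrict (edgeInterval ℓ e))) :
    MemLp (leftPart z g (∫ y in edgeInterval ℓ e, Complex.exp (Complex.I * z * y) * g y)) 2
      (volume.restrict (edgeInterval ℓ e)) := by
  refine ((isSchurKernel_left hz (edgeInterval ℓ e)).memLp hg).ae_eq ?_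
  filter_upwards [ae_restrict_mem (measurableSet_edgeInterval ℓ e)] with t ht
  exact integral_leftKernel (edgeInterval_subset ℓ e ht).1 (edgeInterval_inter_Iic ℓ e ht)
    (integrable_exp_mul hz hg)

/-- Any amplitudes give a solution on the edges. The rows of `hx` are exactly continuity at the two
kinds of ends and Kirchhoff's condition. Square integrability on a lead comes from Schur's test for
the free part and from the absence of an incoming wave. -/
theorem isDomainFunction_resolventFunction (hz : 0 < z.im) (hℓ : ∀ m, 0 < ℓ m)
    {f : Fin K ⊕ Fin M → ℝ → ℂ}
    (hf : ∀ e, MemLp (f e) 2 (volume.restrict (edgeInterval ℓ e))) {φ : WaveIndex K M → ℂ}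
    (hφ : ∀ i, φ i = ∫ t in edgeInterval ℓ i.edge, i.wave z t * f i.edge t)
    {x : WaveIndex K M ⊕ Fin J → ℂ} (hx : G.boundaryMap ℓ z x = G.boundaryData ℓ z φ) :
    G.IsDomainFunction ℓ (resolventFunction z f φ x) (resolventFunctionDeriv z f φ x)
      fun e t => -(f e t + z ^ 2 * resolventFunction z f φ x e t) := by
  have hz0 : z ≠ 0 := by rintro rfl; simp at hz
  have hcz : Complex.I / (2 * z) * (Complex.I * z) = -(1 / 2) := by
    field_simp
    rw [Complex.I_sq]
  have hφr : ∀ e, φ (rightIndex e) =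
      ∫ t in edgeInterval ℓ e, Complex.exp (Complex.I * z * t) * f e t := by
    intro e
    rw [hφ, wave_rightIndex, edge_rightIndex]
  have hint : ∀ e L, L ∈ edgeInterval ℓ e → IntervalIntegrable (f e) volume 0 L := fun e L hL =>
    (hf e).intervalIntegrable_of_subset (edgeInterval_subset ℓ e hL).1 (edgeInterval_subset ℓ e hL).2
  have hright : ∀ e, MemLp (rightPart z (f e)) 2 (volume.restrict (edgeInterval ℓ e)) := fun e =>
    memLp_rightPart hz (hf e)
  have hleft : ∀ e, MemLp (leftPart z (f e) (φ (rightIndex e))) 2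
      (volume.restrict (edgeInterval ℓ e)) := fun e => by
    rw [hφr]; exact memLp_leftPart hz (hf e)
  have hexp : ∀ e, MemLp (fun t : ℝ => rightAmplitude x e * Complex.exp (Complex.I * z * t)) 2
      (volume.restrict (edgeInterval ℓ e)) := fun e => by
    have h := WaveIndex.memLp_wave hz ℓ (rightIndex e)
    rw [wave_rightIndex, edge_rightIndex] at h
    exact h.const_mul _
  have hexp' : ∀ e, MemLp (fun t : ℝ => leftAmplitude x e * Complex.exp (-(Complex.I * z) * t)) 2
      (volume.restrict (edgeInterval ℓ e)) := fun e => by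
    cases e with
    | inl k => simp [leftAmplitude]
    | inr m => exact (memLp_exp_edgeInterval_finite _ _).const_mul _
  have hw : ∀ e, MemLp (resolventFunction z f φ x e) 2 (volume.restrict (edgeInterval ℓ e)) :=
    fun e => (((hright e).add (hleft e)).add ((hexp e).add (hexp' e))).const_mul _
  have hprim : ∀ e L, L ∈ edgeInterval ℓ e → IsPrimitive L (resolventFunction z f φ x e)
      (resolventFunctionDeriv z f φ x e) := by
    intro e L hL
    refine ((isPrimitive_edgeSolution (z := z) (edgeInterval_subset ℓ e hL).1
      (hint e L hL)).const_mul (Complex.I / (2 * z))).congr_ae (Eventually.of_forall fun t => ?_)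
    simp only [resolventFunctionDeriv]
    linear_combination (edgeSolutionDeriv z (f e) (φ (rightIndex e)) (rightAmplitude x e)
      (leftAmplitude x e) t) * hcz
  have hprim' : ∀ e L, L ∈ edgeInterval ℓ e → IsPrimitive L (resolventFunctionDeriv z f φ x e)
      fun t => -(f e t + z ^ 2 * resolventFunction z f φ x e t) := by
    intro e L hL
    refine ((isPrimitive_edgeSolutionDeriv (z := z) (edgeInterval_subset ℓ e hL).1
      (hint e L hL)).const_mul (-(1 / 2))).congr_ae (Eventually.of_forall fun t => ?_)
    simp only [resolventFunction]
    field_simp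
    ring
  have hleft0 : ∀ e, resolventFunction z f φ x e 0 =
      Complex.I / (2 * z) * (φ (rightIndex e) + (rightAmplitude x e + leftAmplitude x e)) := by
    intro e
    simp [resolventFunction, edgeSolution, rightPart, leftPart]
  have hleft1 : ∀ e, resolventFunctionDeriv z f φ x e 0 =
      -(1 / 2) * (-φ (rightIndex e) + (rightAmplitude x e - leftAmplitude x e)) := by
    intro e
    simp [resolventFunctionDeriv, edgeSolutionDeriv, rightPart, leftPart]
  -- At the far end the right part equals `exp (i z ℓ) ∫ exp (-i z t) f`, an integral against the
  -- left moving wave, and the left part vanishes; at `0` the roles are exchanged. This explains the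
  -- indices in `boundaryData`.
  have hr : ∀ m, rightPart z (f (Sum.inr m)) (ℓ m) =
      Complex.exp (Complex.I * z * ℓ m) * φ (Sum.inr (Sum.inr m)) := by
    intro m
    rw [hφ, rightPart, intervalIntegral.integral_of_le (hℓ m).le, ← integral_Icc_eq_integral_Ioc]
    congr 1
    refine setIntegral_congr_fun measurableSet_Icc fun t _ => ?_
    simp only [WaveIndex.wave, WaveIndex.sign, WaveIndex.edge]
    ring_nf
  have hl : ∀ m, leftPart z (f (Sum.inr m)) (φ (rightIndex (Sum.inr m))) (ℓ m) = 0 := by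
    intro m
    have : φ (rightIndex (Sum.inr m)) =
        ∫ t in (0 : ℝ)..ℓ m, Complex.exp (Complex.I * z * t) * f (Sum.inr m) t := by
      rw [hφr, intervalIntegral.integral_of_le (hℓ m).le, ← integral_Icc_eq_integral_Ioc]
      rfl
    rw [leftPart, this, intervalIntegral.integral_neg, add_neg_cancel, mul_zero]
  refine ⟨fun e => ⟨hw e, ?_, ?_, ?_, ?_⟩, ⟨fun v => Complex.I / (2 * z) * x (Sum.inr v), ?_, ?_, ?_⟩,
    ?_⟩
  · exact (((hright e).sub (hleft e)).add ((hexp e).sub (hexp' e))).const_mul _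
  · exact ((hf e).add ((hw e).const_mul _)).neg
  · exact fun t ht => (hprim e t ht).eq_integral t ⟨(edgeInterval_subset ℓ e ht).1, le_rfl⟩
  · exact fun t ht => (hprim' e t ht).eq_integral t ⟨(edgeInterval_subset ℓ e ht).1, le_rfl⟩
  · intro k
    have := congrFun hx (Sum.inl (Sum.inl k))
    simp only [boundaryMap, boundaryData, LinearMap.coe_mk, AddHom.coe_mk] at this
    rw [hleft0]
    simp only [rightIndex, rightAmplitude, leftAmplitude, Sum.elim_inl]
    linear_combination (Complex.I / (2 * z)) * this
  · intro m
    have := congrFun hx (Sum.inl (Sum.inr (Sum.inl m)))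
    simp only [boundaryMap, boundaryData, LinearMap.coe_mk, AddHom.coe_mk] at this
    rw [hleft0]
    simp only [rightIndex, rightAmplitude, leftAmplitude, Sum.elim_inr]
    linear_combination (Complex.I / (2 * z)) * this
  · intro m
    have := congrFun hx (Sum.inl (Sum.inr (Sum.inr m)))
    simp only [boundaryMap, boundaryData, LinearMap.coe_mk, AddHom.coe_mk] at this
    simp only [resolventFunction, edgeSolution, hr, hl]
    simp only [rightAmplitude, leftAmplitude, Sum.elim_inr]
    linear_combination (Complex.I / (2 * z)) * this
  · intro v
    have hrow := congrFun hx (Sum.inr v)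
    simp only [boundaryMap, boundaryData, LinearMap.coe_mk, AddHom.coe_mk] at hrow
    classical
    -- The auxiliary term for isolated vertices is harmless: there all sums are empty and the row
    -- says that the vertex value is zero.
    have hiso : (if G.IsIsolated v then x (Sum.inr v) else 0) = 0 := by
      split_ifs with hv
      · have e1 : (Finset.univ.filter fun k => G.leadVertex k = v) = ∅ :=
          Finset.filter_false_of_mem fun k _ => hv.1 k
        have e2 : (Finset.univ.filter fun m => G.source m = v) = ∅ :=
          Finset.filter_false_of_mem fun k _ => hv.2.1 k
        have e3 : (Finset.univ.filter fun m => G.target m = v) = ∅ :=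
          Finset.filter_false_of_mem fun k _ => hv.2.2 k
        rw [e1, e2, e3, if_pos hv] at hrow
        simpa using hrow
      · rfl
    rw [hiso] at hrow
    simp only [hleft1]
    simp only [resolventFunctionDeriv, edgeSolutionDeriv, hr, hl]
    simp only [rightIndex, rightAmplitude, leftAmplitude, Sum.elim_inl, Sum.elim_inr]
    simp only [Finset.sum_sub_distrib, Finset.sum_neg_distrib] at hrow
    simp only [← Finset.mul_sum, ← neg_mul, Finset.sum_add_distrib, Finset.sum_sub_distrib,
      Finset.sum_neg_distrib, mul_add, mul_sub, sub_zero]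
    simp only [mul_neg, neg_mul, mul_comm (Complex.exp _)] at hrow ⊢
    linear_combination (-(1 / 2) : ℂ) * hrow

/-- A vector in the kernel gives a solution of `P w = z² w` in the domain, which vanishes by the
energy identity. Its value and its derivative at `0` recover the sum and the difference of the two
amplitudes on each edge; the vertex values then vanish by the continuity rows, or by the extra term
at isolated vertices. -/
theorem resDet_ne_zero (hz : 0 < z.im) (hℓ : ∀ m, 0 < ℓ m) : G.resDet ℓ z ≠ 0 := by
  have hz0 : z ≠ 0 := by rintro rfl; simp at hz
  intro h0
  obtain ⟨x, hx0, hx⟩ := Matrix.exists_mulVec_eq_zero_iff.2 h0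
  rw [LinearMap.toMatrix'_mulVec] at hx
  refine hx0 ?_
  have hdom := isDomainFunction_resolventFunction (G := G) (f := fun _ _ => 0) (φ := 0) (x := x) hz hℓ
    (fun e => by simp) (fun i => by simp) (by rw [hx, map_zero])
  have hzero := fun e => hdom.eq_zero hℓ hz (fun e => Eventually.of_forall fun t => by simp) e
    (x := 0) (by
      cases e with
      | inl k => exact self_mem_Ici
      | inr m => exact ⟨le_rfl, (hℓ m).le⟩)
  have hamp : ∀ e, rightAmplitude x e = 0 ∧ leftAmplitude x e = 0 := by
    intro e
    obtain ⟨h1, h2⟩ := hzero e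
    simp only [resolventFunction, edgeSolution, resolventFunctionDeriv, edgeSolutionDeriv, rightPart,
      leftPart, intervalIntegral.integral_same, Complex.ofReal_zero, mul_zero, Complex.exp_zero,
      Pi.zero_apply, add_zero, zero_add, sub_zero, mul_one, mul_eq_zero, div_eq_zero_iff,
      Complex.I_ne_zero, OfNat.ofNat_ne_zero, hz0, false_or, neg_eq_zero, one_ne_zero,
      or_self] at h1 h2
    constructor
    · linear_combination (h1 + h2) / 2
    · linear_combination (h1 - h2) / 2
  have hampl : ∀ i, x (Sum.inl i) = 0 := by
    rintro (k | m | m)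
    · exact (hamp (Sum.inl k)).1
    · exact (hamp (Sum.inr m)).1
    · exact (hamp (Sum.inr m)).2
  ext i
  rcases i with i | v
  · exact hampl i
  · by_cases hv : G.IsIsolated v
    · have := congrFun hx (Sum.inr v)
      simpa [boundaryMap, hampl, hv] using this
    · simp only [IsIsolated, not_and_or, not_forall, not_not] at hv
      rcases hv with ⟨k, rfl⟩ | ⟨m, rfl⟩ | ⟨m, rfl⟩
      · have := congrFun hx (Sum.inl (Sum.inl k))
        simpa [boundaryMap, hampl] using this
      · have := congrFun hx (Sum.inl (Sum.inr (Sum.inl m)))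
        simpa [boundaryMap, hampl] using this
      · have := congrFun hx (Sum.inl (Sum.inr (Sum.inr m)))
        simpa [boundaryMap, hampl] using this

end OpenGraph

end

noncomputable section

open scoped BoundedContinuousFunction

/-! ### Operators on the Hilbert space of the graph -/


section graphOperators

variable {K M : ℕ}

/-- The Hilbert space of one edge. -/
abbrev EdgeL2 {K M : ℕ} (ℓ : Fin M → ℝ) (e : Fin K ⊕ Fin M) : Type :=
  Lp ℂ 2 (volume.restrict (edgeInterval ℓ e))

/-- The projection of the Hilbert space of the graph onto that of an edge. -/
def edgeProj (ℓ : Fin M → ℝ) (e : Fin K ⊕ Fin M) : GraphL2 K ℓ →L[ℂ] EdgeL2 ℓ e :=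
  PiLp.proj 2 (fun e : Fin K ⊕ Fin M => EdgeL2 ℓ e) e

/-- The inclusion of the Hilbert space of an edge into that of the graph. -/
def edgeIncl (ℓ : Fin M → ℝ) (e : Fin K ⊕ Fin M) : EdgeL2 ℓ e →L[ℂ] GraphL2 K ℓ :=
  (PiLp.continuousLinearEquiv 2 ℂ (fun e : Fin K ⊕ Fin M => EdgeL2 ℓ e)).symm.toContinuousLinearMap
    ∘L ContinuousLinearMap.single ℂ (fun e : Fin K ⊕ Fin M => EdgeL2 ℓ e) e

variable (ℓ : Fin M → ℝ)

@[simp]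
theorem edgeProj_apply (e : Fin K ⊕ Fin M) (f : GraphL2 K ℓ) : edgeProj ℓ e f = f e := rfl

theorem edgeIncl_eq (e : Fin K ⊕ Fin M) (g : EdgeL2 ℓ e) :
    edgeIncl ℓ e g = PiLp.single 2 e g := rfl

@[simp]
theorem edgeIncl_same (e : Fin K ⊕ Fin M) (g : EdgeL2 ℓ e) : edgeIncl ℓ e g e = g :=
  Pi.single_eq_same _ _

theorem edgeIncl_of_ne {e e' : Fin K ⊕ Fin M} (h : e' ≠ e) (g : EdgeL2 ℓ e) :
    edgeIncl ℓ e g e' = 0 :=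
  Pi.single_eq_of_ne h _

theorem norm_edgeIncl_apply (e : Fin K ⊕ Fin M) (g : EdgeL2 ℓ e) : ‖edgeIncl ℓ e g‖ = ‖g‖ := by
  rw [edgeIncl_eq, PiLp.norm_single]

theorem norm_edgeIncl_le (e : Fin K ⊕ Fin M) : ‖edgeIncl ℓ e‖ ≤ 1 :=
  ContinuousLinearMap.opNorm_le_bound _ zero_le_one fun g => by
    rw [norm_edgeIncl_apply, one_mul]

theorem norm_edgeProj_le (e : Fin K ⊕ Fin M) : ‖edgeProj ℓ e‖ ≤ 1 :=
  ContinuousLinearMap.opNorm_le_bound _ zero_le_one fun g => by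
    rw [one_mul]; exact PiLp.norm_apply_le g e

theorem graphL2_ext {u v : GraphL2 K ℓ}
    (h : ∀ e, u e =ᵐ[volume.restrict (edgeInterval ℓ e)] v e) : u = v := by
  ext e : 1
  exact Lp.ext (h e)

/-- The bilinear pairing `∫ u v`. -/
def graphPairing : GraphL2 K ℓ →L[ℂ] GraphL2 K ℓ →L[ℂ] ℂ :=
  ∑ e, ((ContinuousLinearMap.mul ℂ ℂ).lpPairing (volume.restrict (edgeInterval ℓ e)) 2 2).bilinearComp
    (edgeProj ℓ e) (edgeProj ℓ e)

theorem graphPairing_apply (u v : GraphL2 K ℓ) :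
    graphPairing ℓ u v = ∑ e, ∫ x in edgeInterval ℓ e, u e x * v e x := by
  simp [graphPairing, ContinuousLinearMap.lpPairing_eq_integral]

theorem graphPairing_edgeIncl (e : Fin K ⊕ Fin M) (g : EdgeL2 ℓ e) (v : GraphL2 K ℓ) :
    graphPairing ℓ (edgeIncl ℓ e g) v = ∫ x in edgeInterval ℓ e, g x * v e x := by
  rw [graphPairing_apply, Finset.sum_eq_single e]
  · rw [edgeIncl_same]
  · intro e' _ he
    refine (integral_congr_ae (g := fun _ => 0) ?_).trans (by simp)
    rw [edgeIncl_of_ne ℓ he]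
    filter_upwards [Lp.coeFn_zero ℂ 2 (volume.restrict (edgeInterval ℓ e'))] with x hx
    rw [hx]
    simp
  · simp

theorem norm_graphPairing_apply_le (u v : GraphL2 K ℓ) :
    ‖graphPairing ℓ u v‖ ≤ (K + M : ℕ) * (‖u‖ * ‖v‖) := by
  have h : ∀ e, ‖(ContinuousLinearMap.mul ℂ ℂ).lpPairing (volume.restrict (edgeInterval ℓ e)) 2 2
      (u e) (v e)‖ ≤ ‖u‖ * ‖v‖ := by
    intro e
    have h2 : ‖(ContinuousLinearMap.mul ℂ ℂ).lpPairing (volume.restrict (edgeInterval ℓ e)) 2 2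
        (u e) (v e)‖ ≤ ‖(ContinuousLinearMap.mul ℂ ℂ).holder 1 (u e) (v e)‖ := by
      have := L1.norm_integral_le (((ContinuousLinearMap.mul ℂ ℂ).holder 1 (u e) (v e) :
        Lp ℂ 1 (volume.restrict (edgeInterval ℓ e))))
      rw [L1.integral_eq' ℂ] at this
      exact this
    refine h2.trans ((ContinuousLinearMap.norm_holder_apply_apply_le _ _ _).trans ?_)
    rw [ContinuousLinearMap.opNorm_mul, one_mul]
    exact mul_le_mul (PiLp.norm_apply_le u e) (PiLp.norm_apply_le v e) (norm_nonneg _) (norm_nonneg _)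
  have e1 : graphPairing ℓ u v = ∑ e, (ContinuousLinearMap.mul ℂ ℂ).lpPairing
      (volume.restrict (edgeInterval ℓ e)) 2 2 (u e) (v e) := by
    simp [graphPairing]
  rw [e1]
  refine (norm_sum_le_of_le _ fun e _ => h e).trans ?_
  simp

theorem cutoffOp_apply (R : ℝ) (f : GraphL2 K ℓ) (e : Fin K ⊕ Fin M) :
    cutoffOp K ℓ R f e = indicatorOp _ (cutoffSet R e) (measurableSet_cutoffSet R e) (f e) := rfl

theorem coeFn_indicatorOp (μ : Measure ℝ) (s : Set ℝ) (hs : MeasurableSet s) (f : Lp ℂ 2 μ) :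
    (indicatorOp μ s hs f : ℝ → ℂ) =ᵐ[μ] s.indicator (f : ℝ → ℂ) :=
  coeFn_indicatorLp μ s hs f

theorem cutoffOp_edgeIncl (R : ℝ) (e : Fin K ⊕ Fin M) (g : EdgeL2 ℓ e) :
    cutoffOp K ℓ R (edgeIncl ℓ e g) =
      edgeIncl ℓ e (indicatorOp _ (cutoffSet R e) (measurableSet_cutoffSet R e) g) := by
  ext e' : 1
  rw [cutoffOp_apply]
  by_cases h : e' = e
  · subst h
    rw [edgeIncl_same, edgeIncl_same]
  · rw [edgeIncl_of_ne ℓ h, edgeIncl_of_ne ℓ h, map_zero]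

/-! ### Truncated waves -/

theorem volume_cutoffSet_le (R : ℝ) (e : Fin K ⊕ Fin M) :
    volume.restrict (edgeInterval ℓ e) (cutoffSet R e) ≤
      ENNReal.ofReal (max (cutoffLength R ℓ e) 0) := by
  rw [Measure.restrict_apply (measurableSet_cutoffSet R e), inter_comm,
    edgeInterval_inter_cutoffSet, Real.volume_Icc, sub_zero]
  exact ENNReal.ofReal_le_ofReal (le_max_left _ _)

/-- The projection of the line onto `[0, L]`. -/
def clamp (L x : ℝ) : ℝ := max 0 (min L x)

theorem clamp_of_mem {L x : ℝ} (hx : x ∈ Icc 0 L) : clamp L x = x := by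
  rw [clamp, min_eq_right hx.2, max_eq_right hx.1]

theorem clamp_mem (L x : ℝ) : clamp L x ∈ Icc 0 (max L 0) :=
  ⟨le_max_left _ _, max_le (le_max_right _ _) ((min_le_left _ _).trans (le_max_left _ _))⟩

theorem continuous_clamp (L : ℝ) : Continuous (clamp L) := by
  unfold clamp
  fun_prop

/-- The exponent of a wave. -/
def waveExponent (L : ℝ) (i : WaveIndex K M) : ℝ →ᵇ ℂ :=
  -- Clamping makes the exponent bounded on the whole line and changes nothing on `[0, L]`, the only
  -- place where it is used.
  BoundedContinuousFunction.ofNormedAddCommGroup (fun x => Complex.I * (i.sign * clamp L x))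
    (by have := continuous_clamp L; fun_prop) (max L 0) (by
      intro x
      have h1 : ‖i.sign‖ = 1 := by rcases i with k | m | m <;> simp [WaveIndex.sign]
      have h2 := clamp_mem L x
      rw [norm_mul, norm_mul, Complex.norm_I, h1, one_mul, one_mul, Complex.norm_real,
        Real.norm_of_nonneg h2.1]
      exact h2.2)

theorem norm_waveExponent_le (L : ℝ) (i : WaveIndex K M) : ‖waveExponent L i‖ ≤ max L 0 :=
  BoundedContinuousFunction.norm_ofNormedAddCommGroup_le _ (le_max_right _ _) _

/-- The exponent of the kernel of the free resolvent. -/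
def kernelExponent (L : ℝ) : (ℝ × ℝ) →ᵇ ℂ :=
  BoundedContinuousFunction.ofNormedAddCommGroup
    (fun p => Complex.I * (|clamp L p.1 - clamp L p.2| : ℝ))
    (by have := continuous_clamp L; fun_prop) (max L 0) (by
      intro p
      have h1 := clamp_mem L p.1
      have h2 := clamp_mem L p.2
      rw [norm_mul, Complex.norm_I, one_mul, Complex.norm_real, Real.norm_eq_abs, abs_abs, abs_le]
      constructor <;> linarith [h1.1, h1.2, h2.1, h2.2])

theorem norm_kernelExponent_le (L : ℝ) : ‖kernelExponent L‖ ≤ max L 0 :=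
  BoundedContinuousFunction.norm_ofNormedAddCommGroup_le _ (le_max_right _ _) _

/-- A wave, cut off to the part `{r ≤ R}` of its edge. -/
def truncatedWave (R : ℝ) (i : WaveIndex K M) (z : ℂ) : GraphL2 K ℓ :=
  edgeIncl ℓ i.edge (truncatedLp (volume.restrict (edgeInterval ℓ i.edge))
    (measurableSet_cutoffSet R i.edge) (volume_cutoffSet_le ℓ R i.edge)
    (expFamily (waveExponent (cutoffLength R ℓ i.edge) i) z))

/-- The operator with kernel `exp (i z |x - y|)` on the edges, cut off to `{r ≤ R}`. -/
def truncatedFree (R : ℝ) (z : ℂ) : GraphL2 K ℓ →L[ℂ] GraphL2 K ℓ :=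
  ∑ e, edgeIncl ℓ e ∘L (truncatedOp (volume.restrict (edgeInterval ℓ e))
    (measurableSet_cutoffSet R e) (volume_cutoffSet_le ℓ R e) (le_max_right _ _)
    (expFamily (kernelExponent (cutoffLength R ℓ e)) z)) ∘L edgeProj ℓ e

theorem differentiable_expFamily {X : Type*} [TopologicalSpace X] (g : X →ᵇ ℂ) :
    Differentiable ℂ (expFamily g) := fun z => (analyticAt_expFamily g z).differentiableAt

theorem differentiable_truncatedWave (R : ℝ) (i : WaveIndex K M) :
    Differentiable ℂ (truncatedWave ℓ R i) := by
  have h := differentiable_expFamily (waveExponent (cutoffLength R ℓ i.edge) i)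
  unfold truncatedWave
  fun_prop

theorem differentiable_truncatedFree (R : ℝ) :
    Differentiable ℂ (truncatedFree (K := K) ℓ R) := by
  unfold truncatedFree
  refine Differentiable.fun_sum fun e _ => ?_
  have h := differentiable_expFamily (kernelExponent (cutoffLength R ℓ e))
  refine (differentiable_const _).clm_comp (Differentiable.clm_comp ?_ (differentiable_const _))
  fun_prop

/-- Here and for `truncatedFree`, the lengths enter only through an upper bound `B`, so the estimate
is uniform over a compact set of lengths. -/
theorem norm_truncatedWave_le {R B ρ : ℝ} {i : WaveIndex K M} {z : ℂ} (hB : 0 ≤ B)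
    (h : cutoffLength R ℓ i.edge ≤ B) (hz : ‖z‖ ≤ ρ) :
    ‖truncatedWave ℓ R i z‖ ≤ Real.sqrt B * Real.exp (ρ * B) := by
  have hm : max (cutoffLength R ℓ i.edge) 0 ≤ B := max_le h hB
  rw [truncatedWave, norm_edgeIncl_apply]
  refine (ContinuousLinearMap.le_opNorm _ _).trans ?_
  refine mul_le_mul (norm_truncatedLp_le.trans (Real.sqrt_le_sqrt hm)) ?_ (norm_nonneg _)
    (Real.sqrt_nonneg _)
  refine (norm_expFamily_le _ _).trans (Real.exp_le_exp.2 ?_)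
  exact mul_le_mul hz ((norm_waveExponent_le _ _).trans hm) (norm_nonneg _)
    ((norm_nonneg _).trans hz)

theorem norm_truncatedFree_le {R B ρ : ℝ} {z : ℂ} (hB : 0 ≤ B)
    (h : ∀ e : Fin K ⊕ Fin M, cutoffLength R ℓ e ≤ B) (hz : ‖z‖ ≤ ρ) :
    ‖truncatedFree (K := K) ℓ R z‖ ≤ (K + M : ℕ) * (B * Real.exp (ρ * B)) := by
  have h1 : ∀ e ∈ (Finset.univ : Finset (Fin K ⊕ Fin M)),
      ‖edgeIncl ℓ e ∘L (truncatedOp (volume.restrict (edgeInterval ℓ e))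
      (measurableSet_cutoffSet R e) (volume_cutoffSet_le ℓ R e) (le_max_right _ _)
      (expFamily (kernelExponent (cutoffLength R ℓ e)) z)) ∘L edgeProj ℓ e‖ ≤
      B * Real.exp (ρ * B) := by
    intro e _
    have hm : max (cutoffLength R ℓ e) 0 ≤ B := max_le (h e) hB
    refine (ContinuousLinearMap.opNorm_comp_le _ _).trans ?_
    refine (mul_le_mul (norm_edgeIncl_le ℓ e) (ContinuousLinearMap.opNorm_comp_le _ _)
      (norm_nonneg _) zero_le_one).trans ?_
    rw [one_mul]
    refine (mul_le_of_le_one_right (norm_nonneg _) (norm_edgeProj_le ℓ e)).trans ?_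
    refine (ContinuousLinearMap.le_opNorm _ _).trans ?_
    refine mul_le_mul (norm_truncatedOp_le.trans hm) ?_ (norm_nonneg _) hB
    refine (norm_expFamily_le _ _).trans (Real.exp_le_exp.2 ?_)
    exact mul_le_mul hz ((norm_kernelExponent_le _).trans hm) (norm_nonneg _)
      ((norm_nonneg _).trans hz)
  refine (norm_sum_le_of_le _ h1).trans ?_
  simp

end graphOperators

/-! ### The explicit resolvent in the upper half-plane -/

namespace OpenGraph

variable {J K M : ℕ}

/-- The finite rank operator that corrects the free resolvent, in terms of a family of waves. -/
def scatteringOp (G : OpenGraph J K M) (ℓ : Fin M → ℝ) (z : ℂ) (E : WaveIndex K M → GraphL2 K ℓ) :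
    GraphL2 K ℓ →L[ℂ] GraphL2 K ℓ :=
  ∑ i, ∑ j, G.resCoeff ℓ z i j • (graphPairing ℓ (E j)).smulRight (E i)

theorem scatteringOp_apply (G : OpenGraph J K M) (ℓ : Fin M → ℝ) (z : ℂ)
    (E : WaveIndex K M → GraphL2 K ℓ) (f : GraphL2 K ℓ) :
    G.scatteringOp ℓ z E f = ∑ i, (∑ j, G.resCoeff ℓ z i j * graphPairing ℓ (E j) f) • E i := by
  simp only [scatteringOp, _root_.sum_apply, _root_.smul_apply,
    ContinuousLinearMap.smulRight_apply, Finset.sum_smul, smul_smul]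

/-- An explicit formula for the cut-off resolvent. -/
def continuedResolvent (G : OpenGraph J K M) (ℓ : Fin M → ℝ) (R : ℝ) (z : ℂ) :
    GraphL2 K ℓ →L[ℂ] GraphL2 K ℓ :=
  (Complex.I / (2 * z)) • (truncatedFree ℓ R z +
    (G.resDet ℓ z)⁻¹ • G.scatteringOp ℓ z fun i => truncatedWave ℓ R i z)

variable {G : OpenGraph J K M} {ℓ : Fin M → ℝ} {z : ℂ}

/-- The waves as elements of the Hilbert space. -/
def fullWave (hz : 0 < z.im) (ℓ : Fin M → ℝ) (i : WaveIndex K M) : GraphL2 K ℓ :=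
  edgeIncl ℓ i.edge (WaveIndex.memLp_wave hz ℓ i).toLp

/-- The operator with kernel `exp (i z |x - y|)` on an edge. -/
def edgeFree (hz : 0 < z.im) (ℓ : Fin M → ℝ) (e : Fin K ⊕ Fin M) : EdgeL2 ℓ e →L[ℂ] EdgeL2 ℓ e :=
  (isSchurKernel_right hz (edgeInterval ℓ e)).op + (isSchurKernel_left hz (edgeInterval ℓ e)).op

/-- An explicit formula for the resolvent. -/
def fullResolvent (G : OpenGraph J K M) (hz : 0 < z.im) (ℓ : Fin M → ℝ) :
    GraphL2 K ℓ →L[ℂ] GraphL2 K ℓ :=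
  (Complex.I / (2 * z)) • ((∑ e, edgeIncl ℓ e ∘L edgeFree hz ℓ e ∘L edgeProj ℓ e) +
    (G.resDet ℓ z)⁻¹ • G.scatteringOp ℓ z fun i => fullWave hz ℓ i)

theorem sum_edgeIncl_apply (S : ∀ e : Fin K ⊕ Fin M, EdgeL2 ℓ e →L[ℂ] EdgeL2 ℓ e)
    (f : GraphL2 K ℓ) (e : Fin K ⊕ Fin M) :
    (∑ e, edgeIncl ℓ e ∘L S e ∘L edgeProj ℓ e) f e = S e (f e) := by
  rw [_root_.sum_apply, ← edgeProj_apply, map_sum, Finset.sum_eq_single e]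
  · simp
  · intro e' _ h
    exact edgeIncl_of_ne ℓ h.symm _
  · simp

theorem coeFn_sum_fullWave (hz : 0 < z.im) (x : WaveIndex K M ⊕ Fin J → ℂ) (e : Fin K ⊕ Fin M) :
    (∑ i, x (Sum.inl i) • fullWave hz ℓ i) e =ᵐ[volume.restrict (edgeInterval ℓ e)]
      fun t : ℝ => rightAmplitude x e * Complex.exp (Complex.I * z * t) +
        leftAmplitude x e * Complex.exp (-(Complex.I * z) * t) := by
  have hzero : ∀ i : WaveIndex K M, i.edge ≠ e → (x (Sum.inl i) • fullWave hz ℓ i) e = 0 := by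
    intro i hi
    rw [PiLp.smul_apply, fullWave, edgeIncl_of_ne ℓ hi.symm, smul_zero]
  have hwave : ∀ (i : WaveIndex K M) (e : Fin K ⊕ Fin M), i.edge = e →
      (fullWave hz ℓ i) e =ᵐ[volume.restrict (edgeInterval ℓ e)] WaveIndex.wave z i := by
    rintro i e rfl
    rw [fullWave, edgeIncl_same]
    exact (WaveIndex.memLp_wave hz ℓ i).coeFn_toLp
  rw [← edgeProj_apply, map_sum]
  simp only [edgeProj_apply]
  rcases e with k | m
  · rw [Fintype.sum_sum_type, Finset.sum_eq_single k, Finset.sum_eq_zero, add_zero]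
    · filter_upwards [Lp.coeFn_smul (x (Sum.inl (Sum.inl k))) (fullWave hz ℓ (Sum.inl k) (Sum.inl k)),
        hwave (Sum.inl k) _ rfl] with t h1 h2
      rw [PiLp.smul_apply, h1, Pi.smul_apply, h2]
      simp [rightAmplitude, leftAmplitude, WaveIndex.wave, WaveIndex.sign]
    · rintro (m | m) _ <;> exact hzero _ (by simp [WaveIndex.edge])
    · intro k' _ hk
      exact hzero _ (by simpa [WaveIndex.edge] using hk)
    · simp
  · rw [Fintype.sum_sum_type, Finset.sum_eq_zero, zero_add, Fintype.sum_sum_type,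
      Finset.sum_eq_single m, Finset.sum_eq_single m]
    · filter_upwards [Lp.coeFn_add ((x (Sum.inl (Sum.inr (Sum.inl m))) •
          fullWave hz ℓ (Sum.inr (Sum.inl m))) (Sum.inr m))
          ((x (Sum.inl (Sum.inr (Sum.inr m))) • fullWave hz ℓ (Sum.inr (Sum.inr m))) (Sum.inr m)),
        Lp.coeFn_smul (x (Sum.inl (Sum.inr (Sum.inl m))))
          (fullWave hz ℓ (Sum.inr (Sum.inl m)) (Sum.inr m)),
        Lp.coeFn_smul (x (Sum.inl (Sum.inr (Sum.inr m))))
          (fullWave hz ℓ (Sum.inr (Sum.inr m)) (Sum.inr m)),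
        hwave (Sum.inr (Sum.inl m)) _ rfl, hwave (Sum.inr (Sum.inr m)) _ rfl] with t h0 h1 h2 h3 h4
      rw [h0, Pi.add_apply, PiLp.smul_apply, PiLp.smul_apply, h1, h2, Pi.smul_apply, Pi.smul_apply, h3, h4]
      simp [rightAmplitude, leftAmplitude, WaveIndex.wave, WaveIndex.sign]
    · intro k' _ hk
      exact hzero _ (by simpa [WaveIndex.edge] using hk)
    · simp
    · intro k' _ hk
      exact hzero _ (by simpa [WaveIndex.edge] using hk)
    · simp
    · intro k _
      exact hzero _ (by simp [WaveIndex.edge])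

theorem hamiltonianRel_fullResolvent (hz : 0 < z.im) (hℓ : ∀ m, 0 < ℓ m) (f : GraphL2 K ℓ) :
    G.HamiltonianRel ℓ (G.fullResolvent hz ℓ f) (f + z ^ 2 • G.fullResolvent hz ℓ f) := by
  have hD := G.resDet_ne_zero hz hℓ
  set φ : WaveIndex K M → ℂ := fun j => graphPairing ℓ (fullWave hz ℓ j) f with hφ
  -- The solution of the boundary system by Cramer's rule; its wave components are the coefficients
  -- in `scatteringOp`, divided by `resDet`.
  set x : WaveIndex K M ⊕ Fin J → ℂ := (G.resDet ℓ z)⁻¹ •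
    (LinearMap.toMatrix' (G.boundaryMap ℓ z)).adjugate.mulVec (G.boundaryData ℓ z φ) with hx
  have hxl : ∀ i, x (Sum.inl i) = (G.resDet ℓ z)⁻¹ * ∑ j, G.resCoeff ℓ z i j * φ j := by
    intro i
    rw [hx, Pi.smul_apply, smul_eq_mul, ← LinearMap.toMatrix'_mulVec (G.boundaryData ℓ z),
      Matrix.mulVec_mulVec]
    rfl
  have hsolve : G.boundaryMap ℓ z x = G.boundaryData ℓ z φ := by
    rw [← LinearMap.toMatrix'_mulVec (G.boundaryMap ℓ z), hx, Matrix.mulVec_smul,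
      Matrix.mulVec_mulVec, Matrix.mul_adjugate, Matrix.smul_mulVec, Matrix.one_mulVec]
    exact inv_smul_smul₀ hD _
  have hφi : ∀ i, φ i = ∫ t in edgeInterval ℓ i.edge, i.wave z t * f i.edge t := by
    intro i
    rw [hφ]
    simp only [fullWave, graphPairing_edgeIncl]
    refine integral_congr_ae ?_
    filter_upwards [(WaveIndex.memLp_wave hz ℓ i).coeFn_toLp] with t ht
    rw [ht]
  have hdom := isDomainFunction_resolventFunction (f := fun e => f e) hz hℓ
    (fun e => Lp.memLp (f e)) hφi hsolve
  have hT : G.fullResolvent hz ℓ f = (Complex.I / (2 * z)) •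
      ((∑ e, edgeIncl ℓ e ∘L edgeFree hz ℓ e ∘L edgeProj ℓ e) f +
      ∑ i, x (Sum.inl i) • fullWave hz ℓ i) := by
    simp only [fullResolvent, _root_.smul_apply, _root_.add_apply, scatteringOp_apply, hxl,
      Finset.smul_sum, smul_smul, hφ]
  have hu : ∀ e, G.fullResolvent hz ℓ f e =ᵐ[volume.restrict (edgeInterval ℓ e)]
      resolventFunction z (fun e => f e) φ x e := by
    intro e
    rw [hT, PiLp.smul_apply, PiLp.add_apply, sum_edgeIncl_apply, edgeFree, _root_.add_apply]
    have hφr : φ (rightIndex e) =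
        ∫ t in edgeInterval ℓ e, Complex.exp (Complex.I * z * t) * f e t := by
      rw [hφi, wave_rightIndex, edge_rightIndex]
    filter_upwards [Lp.coeFn_smul (Complex.I / (2 * z))
        ((isSchurKernel_right hz (edgeInterval ℓ e)).op (f e) +
          (isSchurKernel_left hz (edgeInterval ℓ e)).op (f e) +
          (∑ i, x (Sum.inl i) • fullWave hz ℓ i) e),
      Lp.coeFn_add ((isSchurKernel_right hz (edgeInterval ℓ e)).op (f e) +
          (isSchurKernel_left hz (edgeInterval ℓ e)).op (f e))
          ((∑ i, x (Sum.inl i) • fullWave hz ℓ i) e),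
      Lp.coeFn_add ((isSchurKernel_right hz (edgeInterval ℓ e)).op (f e))
          ((isSchurKernel_left hz (edgeInterval ℓ e)).op (f e)),
      (isSchurKernel_right hz (edgeInterval ℓ e)).coeFn_op (f e),
      (isSchurKernel_left hz (edgeInterval ℓ e)).coeFn_op (f e), coeFn_sum_fullWave hz x e,
      ae_restrict_mem (measurableSet_edgeInterval ℓ e)] with t h1 h2 h3 h4 h5 h6 ht
    rw [h1, Pi.smul_apply, h2, Pi.add_apply, h3, Pi.add_apply, h4, h5, h6,
      integral_rightKernel (edgeInterval_subset ℓ e ht).1 (edgeInterval_inter_Iic ℓ e ht),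
      integral_leftKernel (edgeInterval_subset ℓ e ht).1 (edgeInterval_inter_Iic ℓ e ht)
        (integrable_exp_mul hz (Lp.memLp (f e))), ← hφr]
    rfl
  refine hamiltonianRel_iff.2 ⟨_, _, _, hdom, hu, fun e => ?_⟩
  rw [PiLp.add_apply, PiLp.smul_apply]
  filter_upwards [Lp.coeFn_add (f e) (z ^ 2 • G.fullResolvent hz ℓ f e),
    Lp.coeFn_smul (z ^ 2) (G.fullResolvent hz ℓ f e), hu e] with t h1 h2 h3
  rw [h1, Pi.add_apply, h2, Pi.smul_apply, h3, neg_neg, smul_eq_mul]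

/-- The formula gives a right inverse. It is a left inverse too, because solutions of the equation
are unique. -/
theorem isResolventAt_fullResolvent (hz : 0 < z.im) (hℓ : ∀ m, 0 < ℓ m) :
    G.IsResolventAt ℓ (z ^ 2) (G.fullResolvent hz ℓ) := by
  refine ⟨hamiltonianRel_fullResolvent hz hℓ, fun u g hu => ?_⟩
  refine HamiltonianRel.unique hℓ hz (hamiltonianRel_fullResolvent hz hℓ (g - z ^ 2 • u)) ?_
  rwa [sub_add_cancel]

end OpenGraph

end

/-! ### The cut-off of the explicit resolvent -/

noncomputable section

namespace OpenGraph

variable {J K M : ℕ} {G : OpenGraph J K M} {ℓ : Fin M → ℝ} {z : ℂ}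

theorem mem_Icc_of_mem_cutoffSet {R : ℝ} {e : Fin K ⊕ Fin M} {x : ℝ} (hx : x ∈ edgeInterval ℓ e)
    (hx' : x ∈ cutoffSet R e) : x ∈ Icc 0 (cutoffLength R ℓ e) := by
  rw [← edgeInterval_inter_cutoffSet]; exact ⟨hx, hx'⟩

theorem coeFn_truncatedLp_wave (R : ℝ) (i : WaveIndex K M) (z : ℂ) :
    truncatedLp (volume.restrict (edgeInterval ℓ i.edge))
      (measurableSet_cutoffSet R i.edge) (volume_cutoffSet_le ℓ R i.edge)
      (expFamily (waveExponent (cutoffLength R ℓ i.edge) i) z)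
    =ᵐ[volume.restrict (edgeInterval ℓ i.edge)] (cutoffSet R i.edge).indicator (i.wave z) := by
  filter_upwards [coeFn_truncatedLp (hA := measurableSet_cutoffSet R i.edge)
    (hc := volume_cutoffSet_le ℓ R i.edge) (expFamily (waveExponent (cutoffLength R ℓ i.edge) i) z),
    ae_restrict_mem (measurableSet_edgeInterval ℓ i.edge)] with x h1 h2
  rw [h1]
  by_cases hx : x ∈ cutoffSet R i.edge
  · rw [indicator_of_mem hx, indicator_of_mem hx, expFamily_apply, WaveIndex.wave]
    simp only [waveExponent, BoundedContinuousFunction.coe_ofNormedAddCommGroup,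
      clamp_of_mem (mem_Icc_of_mem_cutoffSet h2 hx)]
    ring_nf
  · rw [indicator_of_notMem hx, indicator_of_notMem hx]

theorem cutoffOp_fullWave (hz : 0 < z.im) (R : ℝ) (i : WaveIndex K M) :
    cutoffOp K ℓ R (fullWave hz ℓ i) = truncatedWave ℓ R i z := by
  rw [fullWave, cutoffOp_edgeIncl, truncatedWave]
  congr 1
  apply Lp.ext
  filter_upwards [coeFn_truncatedLp_wave (ℓ := ℓ) R i z,
    coeFn_indicatorOp _ (cutoffSet R i.edge) (measurableSet_cutoffSet R i.edge)
      (WaveIndex.memLp_wave hz ℓ i).toLp, (WaveIndex.memLp_wave hz ℓ i).coeFn_toLp] with x h1 h2 h3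
  by_cases hx : x ∈ cutoffSet R i.edge
  · rw [h1, h2, indicator_of_mem hx, indicator_of_mem hx, h3]
  · rw [h1, h2, indicator_of_notMem hx, indicator_of_notMem hx]

theorem graphPairing_cutoffOp (u v : GraphL2 K ℓ) (R : ℝ) :
    graphPairing ℓ u (cutoffOp K ℓ R v) = graphPairing ℓ (cutoffOp K ℓ R u) v := by
  rw [graphPairing_apply, graphPairing_apply]
  refine Finset.sum_congr rfl fun e _ => integral_congr_ae ?_
  rw [cutoffOp_apply, cutoffOp_apply]
  filter_upwards [coeFn_indicatorOp _ (cutoffSet R e) (measurableSet_cutoffSet R e) (u e),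
    coeFn_indicatorOp _ (cutoffSet R e) (measurableSet_cutoffSet R e) (v e)] with x h1 h2
  by_cases hx : x ∈ cutoffSet R e
  · rw [h1, h2, indicator_of_mem hx, indicator_of_mem hx]
  · rw [h1, h2, indicator_of_notMem hx, indicator_of_notMem hx, mul_zero, zero_mul]

/-- After both cut-offs only `x` and `y` in `[0, L]` matter, and there the clamped exponent equals
`i |x - y|`. The right-hand side makes sense for every `z`; decay at infinity is needed only before
the cut-off. -/
theorem indicatorOp_edgeFree_indicatorOp (hz : 0 < z.im) (R : ℝ) (e : Fin K ⊕ Fin M)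
    (f : EdgeL2 ℓ e) :
    indicatorOp _ (cutoffSet R e) (measurableSet_cutoffSet R e)
      (edgeFree hz ℓ e (indicatorOp _ (cutoffSet R e) (measurableSet_cutoffSet R e) f)) =
    truncatedOp (volume.restrict (edgeInterval ℓ e))
      (measurableSet_cutoffSet R e) (volume_cutoffSet_le ℓ R e) (le_max_right _ _)
      (expFamily (kernelExponent (cutoffLength R ℓ e)) z) f := by
  set g := indicatorOp _ (cutoffSet R e) (measurableSet_cutoffSet R e) f with hg
  have hr := isSchurKernel_right hz (edgeInterval ℓ e)
  have hl := isSchurKernel_left hz (edgeInterval ℓ e)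
  apply Lp.ext
  filter_upwards [coeFn_indicatorOp _ (cutoffSet R e) (measurableSet_cutoffSet R e)
      (edgeFree hz ℓ e g),
    coeFn_truncatedOp (hA := measurableSet_cutoffSet R e) (hc := volume_cutoffSet_le ℓ R e)
      (h0 := le_max_right _ _) (expFamily (kernelExponent (cutoffLength R ℓ e)) z) f,
    Lp.coeFn_add (hr.op g) (hl.op g), hr.coeFn_op g, hl.coeFn_op g,
    hr.ae_integrable (Lp.memLp g), hl.ae_integrable (Lp.memLp g),
    ae_restrict_mem (measurableSet_edgeInterval ℓ e)] with x h1 h2 h3 h4 h5 h6 h7 hx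
  rw [h1, h2]
  by_cases hxc : x ∈ cutoffSet R e
  · rw [indicator_of_mem hxc]
    change (hr.op g + hl.op g) x = _
    rw [h3, Pi.add_apply, h4, h5, ← integral_add h6 h7]
    refine integral_congr_ae ?_
    filter_upwards [coeFn_indicatorOp _ (cutoffSet R e) (measurableSet_cutoffSet R e) f,
      ae_restrict_mem (measurableSet_edgeInterval ℓ e)] with y hy hys
    rw [hg, hy]
    by_cases hyc : y ∈ cutoffSet R e
    · rw [indicator_of_mem hyc, indicator_of_mem (mk_mem_prod hxc hyc), expFamily_apply, ← add_mul]
      congr 1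
      simp only [kernelExponent, BoundedContinuousFunction.coe_ofNormedAddCommGroup,
        clamp_of_mem (mem_Icc_of_mem_cutoffSet hx hxc),
        clamp_of_mem (mem_Icc_of_mem_cutoffSet hys hyc), rightKernel, leftKernel]
      split_ifs with hyx
      · rw [add_zero, abs_of_nonneg (sub_nonneg.2 hyx)]
        push_cast
        ring_nf
      · rw [zero_add, abs_of_neg (sub_neg.2 (not_le.1 hyx))]
        push_cast
        ring_nf
    · rw [indicator_of_notMem hyc, indicator_of_notMem (fun h => hyc h.2)]
      simp
  · rw [indicator_of_notMem hxc]
    have : ∀ y, ((cutoffSet R e) ×ˢ (cutoffSet R e)).indicator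
        (expFamily (kernelExponent (cutoffLength R ℓ e)) z) (x, y) * f y = 0 := fun y => by
      rw [indicator_of_notMem (fun h => hxc h.1), zero_mul]
    simp [this]

/-- The left cut-off acts on the waves in the range of the finite rank term; the right one is moved
onto the waves in the functionals, since the pairing is symmetric under it. Everything that remains
is defined for all `z` off the zeros of `z` and `resDet`. -/
theorem cutoffOp_fullResolvent (hz : 0 < z.im) (R : ℝ) :
    cutoffOp K ℓ R ∘L G.fullResolvent hz ℓ ∘L cutoffOp K ℓ R = G.continuedResolvent ℓ R z := by
  ext1 f
  simp only [ContinuousLinearMap.comp_apply, fullResolvent, continuedResolvent, _root_.smul_apply,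
    _root_.add_apply, map_smul, map_add, scatteringOp_apply, map_sum, cutoffOp_fullWave,
    graphPairing_cutoffOp]
  congr 2
  ext e : 1
  rw [cutoffOp_apply, sum_edgeIncl_apply, cutoffOp_apply, indicatorOp_edgeFree_indicatorOp,
    truncatedFree]
  exact (sum_edgeIncl_apply (fun e => truncatedOp (volume.restrict (edgeInterval ℓ e))
      (measurableSet_cutoffSet R e) (volume_cutoffSet_le ℓ R e) (le_max_right _ _)
      (expFamily (kernelExponent (cutoffLength R ℓ e)) z)) f e).symm

end OpenGraph

end

noncomputable section

/-! ### Principal parts -/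

section principalPart

theorem Finsupp.exists_forall_ge_eq_zero {V : Type*} [Zero V] (A : ℕ →₀ V) : ∃ N, ∀ j, N ≤ j → A j = 0 := by
  refine ⟨A.support.sup id + 1, fun j hj => ?_⟩
  by_contra hcon
  have h1 : id j ≤ A.support.sup id := Finset.le_sup (Finsupp.mem_support_iff.2 hcon)
  have h2 : j ≤ A.support.sup id := h1
  omega

variable {V : Type*} [NormedAddCommGroup V] [NormedSpace ℂ V]

theorem AnalyticAt.exists_eq_add_sub_smul {E : ℂ → V} {ζ : ℂ} (hE : AnalyticAt ℂ E ζ) :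
    ∃ g : ℂ → V, AnalyticAt ℂ g ζ ∧ ∀ᶠ z in 𝓝 ζ, E z = E ζ + (z - ζ) • g z := by
  have h1 : AnalyticAt ℂ (fun z => E z - E ζ) ζ := hE.sub analyticAt_const
  have h2 : ((1 : ℕ) : ℕ∞) ≤ analyticOrderAt (fun z => E z - E ζ) ζ := by
    rw [Nat.cast_one, Order.one_le_iff_ne_zero, h1.analyticOrderAt_ne_zero, sub_self]
  obtain ⟨g, hg, h⟩ := (natCast_le_analyticOrderAt h1).1 h2
  refine ⟨g, hg, h.mono fun z hz => ?_⟩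
  rw [pow_one] at hz
  rw [← hz, add_sub_cancel]

/-- Taylor's formula for analytic functions. -/
theorem AnalyticAt.exists_taylor {E : ℂ → V} {ζ : ℂ} (hE : AnalyticAt ℂ E ζ) (n : ℕ) :
    ∃ (p : ℕ → V) (g : ℂ → V), AnalyticAt ℂ g ζ ∧ p 0 = E ζ ∧
      ∀ᶠ z in 𝓝 ζ, E z = (∑ i ∈ Finset.range n, (z - ζ) ^ i • p i) + (z - ζ) ^ n • g z := by
  induction n generalizing E with
  | zero => exact ⟨fun _ => E ζ, E, hE, rfl, by simp⟩
  | succ n ih =>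
    obtain ⟨E', hE', h⟩ := hE.exists_eq_add_sub_smul
    obtain ⟨p, g, hg, -, hp⟩ := ih hE'
    refine ⟨fun i => Nat.casesOn i (E ζ) p, g, hg, rfl, ?_⟩
    filter_upwards [h, hp] with z h1 h2
    rw [h1, h2, Finset.sum_range_succ']
    simp only [pow_zero, one_smul, pow_succ' (z - ζ), mul_smul, smul_add, Finset.smul_sum]
    show _ = _ + E ζ + _
    abel

theorem Finsupp.sum_principalPart_eq {A : ℕ →₀ V} {N : ℕ} (hA : ∀ j, N ≤ j → A j = 0) (w : ℂ) :
    (A.sum fun j a => (w ^ (j + 1))⁻¹ • a) = ∑ j ∈ Finset.range N, (w ^ (j + 1))⁻¹ • A j := by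
  refine Finsupp.sum_of_support_subset _ (fun j hj => ?_) _ (by simp)
  rw [Finset.mem_range]
  by_contra hcon
  exact Finsupp.mem_support_iff.1 hj (hA j (not_lt.1 hcon))

theorem exists_isPrincipalPart {F : ℂ → V} {ζ : ℂ} (hF : MeromorphicAt F ζ) :
    ∃ A, IsPrincipalPart F ζ A := by
  obtain ⟨n, hn⟩ := hF
  obtain ⟨p, g, hg, -, hp⟩ := hn.exists_taylor n
  -- In `(z - ζ) ^ (-n) ∑ (z - ζ) ^ i p i` the power `-(j + 1)` comes from `i = n - 1 - j`.
  let A : ℕ →₀ V := Finsupp.onFinset (Finset.range n) (fun j => if j < n then p (n - 1 - j) else 0)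
    (by intro j hj; by_contra hcon; simp_all)
  refine ⟨A, g, hg, ?_⟩
  filter_upwards [hp.filter_mono nhdsWithin_le_nhds, self_mem_nhdsWithin] with z hz hne
  have hne' : z - ζ ≠ 0 := sub_ne_zero.2 hne
  rw [Finsupp.sum_principalPart_eq (N := n) (fun j hj => by
    simp [A, Finsupp.onFinset_apply, not_lt.2 hj])]
  have h1 : F z = ((z - ζ) ^ n)⁻¹ • ((∑ i ∈ Finset.range n, (z - ζ) ^ i • p i) + (z - ζ) ^ n • g z) := by
    rw [← hz, inv_smul_smul₀ (pow_ne_zero n hne')]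
  rw [h1, smul_add, inv_smul_smul₀ (pow_ne_zero n hne'), add_comm, Finset.smul_sum,
    ← Finset.sum_range_reflect]
  congr 1
  refine Finset.sum_congr rfl fun j hj => ?_
  rw [Finset.mem_range] at hj
  simp only [A, Finsupp.onFinset_apply, if_pos hj]
  rw [smul_smul]
  congr 1
  rw [eq_comm, inv_eq_iff_eq_inv, mul_inv, inv_inv, ← div_eq_mul_inv, eq_div_iff
    (pow_ne_zero _ hne'), ← pow_add]
  congr 1
  omega

namespace IsPrincipalPart

variable {F : ℂ → V} {ζ : ℂ} {A : ℕ →₀ V}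

theorem eventually_eq_sum (h : IsPrincipalPart F ζ A) {N : ℕ} (hA : ∀ j, N ≤ j → A j = 0) :
    ∃ g : ℂ → V, AnalyticAt ℂ g ζ ∧ ∀ᶠ z in 𝓝[≠] ζ,
      F z = g z + ∑ j ∈ Finset.range N, ((z - ζ) ^ (j + 1))⁻¹ • A j := by
  obtain ⟨g, hg, hF⟩ := h
  exact ⟨g, hg, hF.mono fun z hz => by rw [hz, Finsupp.sum_principalPart_eq hA]⟩

theorem exists_eq_zpow_smul (h : IsPrincipalPart F ζ A) {N : ℕ} (hA : ∀ j, N + 1 ≤ j → A j = 0) :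
    ∃ g : ℂ → V, AnalyticAt ℂ g ζ ∧ g ζ = A N ∧ ∀ᶠ z in 𝓝[≠] ζ, (z - ζ) ^ (N + 1) • F z = g z := by
  obtain ⟨g, hg, hF⟩ := h.eventually_eq_sum hA
  refine ⟨fun z => (z - ζ) ^ (N + 1) • g z + ∑ j ∈ Finset.range (N + 1), (z - ζ) ^ (N - j) • A j,
    by fun_prop, ?_, ?_⟩
  · simp only [sub_self]
    rw [Finset.sum_range_succ, Finset.sum_eq_zero]
    · simp
    · intro j hj
      rw [Finset.mem_range] at hj
      rw [zero_pow (by omega), zero_smul]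
  · filter_upwards [hF, self_mem_nhdsWithin] with z hz hne
    have hne' : z - ζ ≠ 0 := sub_ne_zero.2 hne
    rw [hz, smul_add, Finset.smul_sum]
    congr 1
    refine Finset.sum_congr rfl fun j hj => ?_
    rw [Finset.mem_range] at hj
    rw [smul_smul]
    congr 1
    rw [← div_eq_mul_inv, div_eq_iff (pow_ne_zero _ hne'), ← pow_add]
    congr 1
    omega

theorem tendsto (h : IsPrincipalPart F ζ A) {N : ℕ} (hA : ∀ j, N + 1 ≤ j → A j = 0) :
    Tendsto (fun z => (z - ζ) ^ (N + 1) • F z) (𝓝[≠] ζ) (𝓝 (A N)) := by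
  obtain ⟨g, hg, hgA, hF⟩ := h.exists_eq_zpow_smul hA
  rw [← hgA]
  exact (hg.continuousAt.tendsto.mono_left nhdsWithin_le_nhds).congr'
    (hF.mono fun z hz => hz.symm)

theorem meromorphicAt (h : IsPrincipalPart F ζ A) : MeromorphicAt F ζ := by
  obtain ⟨N, hN⟩ := A.exists_forall_ge_eq_zero
  obtain ⟨g, hg, hF⟩ := h.eventually_eq_sum hN
  refine MeromorphicAt.congr ?_ (EventuallyEq.symm hF)
  exact hg.meromorphicAt.add (MeromorphicAt.fun_sum fun j => by fun_prop)

theorem neg_le_meromorphicOrderAt (h : IsPrincipalPart F ζ A) {N : ℕ}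
    (hA : ∀ j, N ≤ j → A j = 0) : ((-(N : ℤ) : ℤ) : WithTop ℤ) ≤ meromorphicOrderAt F ζ := by
  obtain ⟨g, hg, -, hF⟩ := h.exists_eq_zpow_smul (N := N) fun j hj => hA j (by omega)
  obtain ⟨g', hg', hF'⟩ : ∃ g' : ℂ → V, AnalyticAt ℂ g' ζ ∧
      ∀ᶠ z in 𝓝[≠] ζ, F z = (z - ζ) ^ (-(N : ℤ)) • g' z := by
    rcases N with _ | N
    · obtain ⟨g', hg', hF'⟩ := h.eventually_eq_sum hA
      exact ⟨g', hg', hF'.mono fun z hz => by simpa using hz⟩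
    · obtain ⟨g', hg', -, hF'⟩ := h.exists_eq_zpow_smul (N := N) hA
      refine ⟨g', hg', ?_⟩
      filter_upwards [hF', self_mem_nhdsWithin] with z hz hne
      rw [← hz, zpow_neg, zpow_natCast, inv_smul_smul₀ (pow_ne_zero _ (sub_ne_zero.2 hne))]
  rw [meromorphicOrderAt_congr hF', fun_meromorphicOrderAt_smul (by fun_prop) hg'.meromorphicAt,
    fun_meromorphicOrderAt_zpow_id_sub_const]
  calc ((-(N : ℤ) : ℤ) : WithTop ℤ) = ((-(N : ℤ) : ℤ) : WithTop ℤ) + 0 := (add_zero _).symm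
    _ ≤ _ := by gcongr; exact hg'.meromorphicOrderAt_nonneg

/-- The highest remaining coefficient is the limit of `(z - ζ) ^ (N + 1) F z`, which is zero;
descent on `N` does the rest. Through this lemma, linear relations that hold for `F` modulo analytic
functions pass to the coefficients of the principal part. -/
theorem eq_zero_of_analytic (h : IsPrincipalPart F ζ A) {g : ℂ → V} (hg : AnalyticAt ℂ g ζ)
    (hF : ∀ᶠ z in 𝓝[≠] ζ, F z = g z) : A = 0 := by
  have key : ∀ N, (∀ j, N ≤ j → A j = 0) → ∀ j, A j = 0 := by
    intro N
    induction N with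
    | zero => exact fun h j => h j (Nat.zero_le _)
    | succ N ih =>
      intro hN
      refine ih fun j hj => ?_
      rcases hj.eq_or_lt with rfl | hj
      · have h1 := h.tendsto hN
        have h2 : Tendsto (fun z => (z - ζ) ^ (N + 1) • F z) (𝓝[≠] ζ) (𝓝 0) := by
          have h3 : ContinuousAt (fun z => (z - ζ) ^ (N + 1) • g z) ζ :=
            ContinuousAt.smul (by fun_prop) hg.continuousAt
          have h4 := h3.tendsto.mono_left (nhdsWithin_le_nhds (s := {ζ}ᶜ))
          simp only [sub_self, zero_pow (Nat.succ_ne_zero N), zero_smul] at h4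
          exact h4.congr' (hF.mono fun z hz => by simp only [hz])
        exact tendsto_nhds_unique h1 h2
      · exact hN j hj
  obtain ⟨N, hN⟩ := A.exists_forall_ge_eq_zero
  exact Finsupp.ext (key N hN)

theorem congr {F' : ℂ → V} (h : IsPrincipalPart F ζ A) (hF : ∀ᶠ z in 𝓝[≠] ζ, F' z = F z) :
    IsPrincipalPart F' ζ A := by
  obtain ⟨g, hg, h⟩ := h
  exact ⟨g, hg, by filter_upwards [h, hF] with z h1 h2; rw [h2, h1]⟩

theorem map {W : Type*} [NormedAddCommGroup W] [NormedSpace ℂ W] (h : IsPrincipalPart F ζ A)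
    (L : V →L[ℂ] W) :
    IsPrincipalPart (fun z => L (F z)) ζ (A.mapRange L (map_zero L)) := by
  obtain ⟨g, hg, h⟩ := h
  refine ⟨fun z => L (g z), (L.analyticAt _).comp hg, ?_⟩
  filter_upwards [h] with z hz
  rw [hz, map_add, Finsupp.sum_mapRange_index (by simp), Finsupp.sum, map_sum]
  simp [Finsupp.sum]

end IsPrincipalPart

end principalPart

/-! ### Meromorphic functions on the plane -/

section meromorphic

variable {V : Type*} [NormedAddCommGroup V] [NormedSpace ℂ V]

/-- The identity theorem for meromorphic functions on the plane. -/
theorem eventuallyEq_of_eqOn_upperHalfPlane [CompleteSpace V] {F F' : ℂ → V}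
    (hF : MeromorphicOn F univ) (hF' : MeromorphicOn F' univ) (h : ∀ z : ℂ, 0 < z.im → F z = F' z)
    (z : ℂ) : F =ᶠ[𝓝[≠] z] F' := by
  have hm : MeromorphicOn (F - F') univ := hF.sub hF'
  -- The difference vanishes near `i`, so it has infinite order there; on a connected set infinite
  -- order at one point propagates to all.
  have hI : meromorphicOrderAt (F - F') Complex.I = ⊤ := by
    rw [meromorphicOrderAt_eq_top_iff]
    have : {z : ℂ | 0 < z.im} ∈ 𝓝 Complex.I :=
      (isOpen_lt continuous_const Complex.continuous_im).mem_nhds (by simp)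
    filter_upwards [nhdsWithin_le_nhds this] with w hw
    rw [Pi.sub_apply, h w hw, sub_self]
  have hz : meromorphicOrderAt (F - F') z = ⊤ := by
    by_contra hcon
    exact (hm.meromorphicOrderAt_ne_top_of_isPreconnected isPreconnected_univ (mem_univ z)
      (mem_univ Complex.I) hcon) hI
  filter_upwards [meromorphicOrderAt_eq_top_iff.1 hz] with w hw
  exact sub_eq_zero.1 hw

/-- Removal of the singularities of a meromorphic function without poles. -/
theorem MeromorphicOn.exists_analyticOnNhd [CompleteSpace V] {F : ℂ → V} {U : Set ℂ}
    (hF : MeromorphicOn F U) (ho : ∀ z ∈ U, 0 ≤ meromorphicOrderAt F z) :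
    ∃ g : ℂ → V, AnalyticOnNhd ℂ g U ∧ (∀ z ∈ U, g =ᶠ[𝓝[≠] z] F) ∧
      ∀ z ∈ U, ContinuousAt F z → g z = F z := by
  have han : AnalyticOnNhd ℂ (toMeromorphicNFOn F U) U := fun z hz => by
    have h := meromorphicNFOn_toMeromorphicNFOn F U hz
    rw [← h.meromorphicOrderAt_nonneg_iff_analyticAt, meromorphicOrderAt_toMeromorphicNFOn hF hz]
    exact ho z hz
  refine ⟨toMeromorphicNFOn F U, han, fun z hz => hF.toMeromorphicNFOn_eq_self_on_nhdsNE hz,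
    fun z hz hc => ?_⟩
  have h1 := (han z hz).continuousAt.tendsto.mono_left (nhdsWithin_le_nhds (s := {z}ᶜ))
  have h2 := hc.tendsto.mono_left (nhdsWithin_le_nhds (s := {z}ᶜ))
  exact tendsto_nhds_unique (h1.congr' (hF.toMeromorphicNFOn_eq_self_on_nhdsNE hz)) h2

theorem meromorphicOrderAt_prod_sub_pow (S : Finset ℂ) (n : ℂ → ℕ) (w : ℂ) :
    meromorphicOrderAt (fun z => ∏ ζ ∈ S, (z - ζ) ^ n ζ) w =
      ((if w ∈ S then (n w : ℤ) else 0 : ℤ) : WithTop ℤ) := by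
  classical
  rw [meromorphicOrderAt_fun_prod fun ζ _ => by fun_prop]
  have h : ∀ ζ ∈ S, meromorphicOrderAt (fun z => (z - ζ) ^ n ζ) w =
      if w = ζ then ((n ζ : ℤ) : WithTop ℤ) else 0 := by
    intro ζ _
    split_ifs with hw
    · subst hw
      exact fun_meromorphicOrderAt_pow_id_sub_const
    · have han : AnalyticAt ℂ (fun z => (z - ζ) ^ n ζ) w := by fun_prop
      rw [han.meromorphicOrderAt_eq, han.analyticOrderAt_eq_zero.2
        (pow_ne_zero _ (sub_ne_zero.2 hw))]
      rfl
  rw [Finset.sum_congr rfl h, Finset.sum_ite_eq]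
  split_ifs <;> simp

end meromorphic

/-! ### Counting zeros -/

theorem analyticOrderAt_ne_top_of_ne_zero {f : ℂ → ℂ} (hf : Differentiable ℂ f) {c : ℂ}
    (hc : f c ≠ 0) (ζ : ℂ) : analyticOrderAt f ζ ≠ ⊤ := by
  intro h
  have h1 := (AnalyticOnNhd.eqOn_zero_of_preconnected_of_eventuallyEq_zero (f := f) (z₀ := ζ)
    (fun z _ => hf.analyticAt z) isPreconnected_univ (mem_univ ζ) (analyticOrderAt_eq_top.1 h))
    (mem_univ c)
  exact hc h1

/-- Division of an entire function by some of its zeros. -/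
theorem exists_eq_prod_mul {f : ℂ → ℂ} (hf : Differentiable ℂ f) {c : ℂ} (hc : f c ≠ 0)
    (S : Finset ℂ) : ∃ g : ℂ → ℂ, AnalyticOnNhd ℂ g univ ∧
      ∀ z, f z = (∏ ζ ∈ S, (z - ζ) ^ analyticOrderNatAt f ζ) * g z := by
  set P : ℂ → ℂ := fun z => ∏ ζ ∈ S, (z - ζ) ^ analyticOrderNatAt f ζ with hP
  have hPd : Differentiable ℂ P := by fun_prop
  have hPm : ∀ z, MeromorphicAt P z := fun z => (hPd.analyticAt z).meromorphicAt
  have hm : MeromorphicOn (fun z => (P z)⁻¹ * f z) univ := fun z _ =>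
    (hPm z).inv.mul (hf.analyticAt z).meromorphicAt
  obtain ⟨g, hg, hgF, -⟩ := hm.exists_analyticOnNhd (fun z _ => by
    rw [show (fun z => (P z)⁻¹ * f z) = P⁻¹ * f from rfl,
      meromorphicOrderAt_mul (hPm z).inv (hf.analyticAt z).meromorphicAt,
      meromorphicOrderAt_inv, hP, meromorphicOrderAt_prod_sub_pow]
    split_ifs with hz
    · rw [(hf.analyticAt z).meromorphicOrderAt_eq,
        ← Nat.cast_analyticOrderNatAt (analyticOrderAt_ne_top_of_ne_zero hf hc z)]
      have : (((analyticOrderNatAt f z : ℕ) : ℕ∞).map (fun n : ℕ => (n : ℤ)) : WithTop ℤ) =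
        ((analyticOrderNatAt f z : ℤ) : WithTop ℤ) := rfl
      rw [this, show -((analyticOrderNatAt f z : ℤ) : WithTop ℤ) = ((-(analyticOrderNatAt f z : ℤ) : ℤ) :
        WithTop ℤ) from rfl, ← WithTop.coe_add, neg_add_cancel]
      exact le_rfl
    · have := (hf.analyticAt z).meromorphicOrderAt_nonneg
      simpa using this)
  refine ⟨g, hg, fun z => ?_⟩
  have h1 : Tendsto f (𝓝[≠] z) (𝓝 (f z)) :=
    (hf.continuous.tendsto z).mono_left nhdsWithin_le_nhds
  have h2 : Tendsto (fun z => P z * g z) (𝓝[≠] z) (𝓝 (P z * g z)) :=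
    ((hPd.continuous.tendsto z).mul (hg z (mem_univ z)).continuousAt.tendsto).mono_left
      nhdsWithin_le_nhds
  refine tendsto_nhds_unique h1 (h2.congr' ?_)
  have hP0 : ∀ᶠ w in 𝓝[≠] z, P w ≠ 0 := by
    rw [← meromorphicOrderAt_ne_top_iff_eventually_ne_zero (hPm z), hP,
      meromorphicOrderAt_prod_sub_pow]
    exact WithTop.coe_ne_top
  filter_upwards [hgF z (mem_univ z), hP0] with w h1 h2
  rw [h1]
  field_simp

/-- A bound on the number of zeros in a disc. -/
theorem two_pow_sum_analyticOrderNatAt_le {f : ℂ → ℂ} (hf : Differentiable ℂ f) {c : ℂ}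
    (hc : f c ≠ 0) {r M : ℝ} (hr : 0 < r) (hM : ∀ z ∈ Metric.sphere c (3 * r), ‖f z‖ ≤ M)
    {S : Finset ℂ} (hS : ∀ ζ ∈ S, ‖ζ - c‖ ≤ r) :
    2 ^ (∑ ζ ∈ S, analyticOrderNatAt f ζ) ≤ M / ‖f c‖ := by
  obtain ⟨g, hg, hfg⟩ := exists_eq_prod_mul hf hc S
  set n := ∑ ζ ∈ S, analyticOrderNatAt f ζ with hn
  -- A zero at distance at most `r` from `c` is at distance at least `2 r` from the sphere of radius
  -- `3 r`. Thus each zero contributes at least `2 r` on the sphere and at most `r` at the centre,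
  -- and the quotient of the two is the factor `2` in the conclusion.
  have h1 : ∀ z ∈ Metric.sphere c (3 * r), ‖g z‖ ≤ M / (2 * r) ^ n := by
    intro z hz
    rw [le_div_iff₀ (by positivity), mul_comm]
    refine le_trans ?_ (hM z hz)
    rw [hfg z, norm_mul, norm_prod]
    gcongr
    rw [hn, ← Finset.prod_pow_eq_pow_sum]
    refine Finset.prod_le_prod (fun _ _ => by positivity) fun ζ hζ => ?_
    rw [norm_pow]
    refine pow_le_pow_left₀ (by positivity) ?_ _
    have h2 := hS ζ hζ
    have h3 : ‖z - c‖ = 3 * r := by simpa using hz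
    have h4 : ‖z - c‖ ≤ ‖z - ζ‖ + ‖ζ - c‖ := norm_sub_le_norm_sub_add_norm_sub z ζ c
    linarith
  have h2 : ‖g c‖ ≤ M / (2 * r) ^ n := by
    refine Complex.norm_le_of_forall_mem_frontier_norm_le (U := Metric.ball c (3 * r))
      Metric.isBounded_ball ?_ ?_ (subset_closure (Metric.mem_ball_self (by positivity)))
    · have : Differentiable ℂ g := fun z => (hg z (mem_univ z)).differentiableAt
      exact this.diffContOnCl
    · rw [frontier_ball c (by positivity)]
      exact h1
  have h3 : ‖f c‖ ≤ r ^ n * (M / (2 * r) ^ n) := by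
    rw [hfg c, norm_mul, norm_prod]
    refine mul_le_mul ?_ h2 (norm_nonneg _) (by positivity)
    rw [hn, ← Finset.prod_pow_eq_pow_sum]
    refine Finset.prod_le_prod (fun _ _ => by positivity) fun ζ hζ => ?_
    rw [norm_pow, norm_sub_rev]
    exact pow_le_pow_left₀ (norm_nonneg _) (hS ζ hζ) _
  rw [le_div_iff₀ (norm_pos_iff.2 hc)]
  calc 2 ^ n * ‖f c‖ ≤ 2 ^ n * (r ^ n * (M / (2 * r) ^ n)) := by gcongr
    _ = M := by
      rw [mul_pow]
      field_simp

end

/-! ### The cut-off resolvent as a quotient of entire functions -/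

noncomputable section

theorem Differentiable.smulRight {E F : Type*} [NormedAddCommGroup E] [NormedSpace ℂ E]
    [NormedAddCommGroup F] [NormedSpace ℂ F] {c : ℂ → E →L[ℂ] ℂ} {f : ℂ → F}
    (hc : Differentiable ℂ c) (hf : Differentiable ℂ f) :
    Differentiable ℂ fun z => (c z).smulRight (f z) := by
  fun_prop

namespace OpenGraph

variable {J K M : ℕ} {G : OpenGraph J K M} {ℓ : Fin M → ℝ} {z : ℂ} {R : ℝ}

/-- The denominator of the cut-off resolvent. -/
def denominator (G : OpenGraph J K M) (ℓ : Fin M → ℝ) (z : ℂ) : ℂ := z * G.resDet ℓ z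

/-- The numerator of the cut-off resolvent. -/
def numerator (G : OpenGraph J K M) (ℓ : Fin M → ℝ) (R : ℝ) (z : ℂ) :
    GraphL2 K ℓ →L[ℂ] GraphL2 K ℓ :=
  (Complex.I / 2) • (G.resDet ℓ z • truncatedFree ℓ R z +
    G.scatteringOp ℓ z fun i => truncatedWave ℓ R i z)

theorem differentiable_denominator : Differentiable ℂ (G.denominator ℓ) :=
  differentiable_id.mul (G.differentiable_resDet ℓ)

theorem continuous_denominator (G : OpenGraph J K M) :
    Continuous fun p : ℂ × (Fin M → ℝ) => G.denominator p.2 p.1 :=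
  continuous_fst.mul G.continuous_resDet

theorem denominator_ne_zero (hz : 0 < z.im) (hℓ : ∀ m, 0 < ℓ m) : G.denominator ℓ z ≠ 0 :=
  mul_ne_zero (by rintro rfl; simp at hz) (resDet_ne_zero hz hℓ)

theorem differentiable_scatteringOp {E : ℂ → WaveIndex K M → GraphL2 K ℓ}
    (hE : ∀ i, Differentiable ℂ fun z => E z i) :
    Differentiable ℂ fun z => G.scatteringOp ℓ z (E z) := by
  unfold scatteringOp
  refine Differentiable.fun_sum fun i _ => Differentiable.fun_sum fun j _ => ?_
  refine (G.differentiable_resCoeff ℓ i j).smul ?_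
  have h1 : Differentiable ℂ fun z => graphPairing ℓ (E z j) :=
    (graphPairing ℓ).differentiable.comp (hE j)
  exact h1.smulRight (hE i)

theorem differentiable_numerator : Differentiable ℂ (G.numerator ℓ R) := by
  unfold numerator
  have h1 : Differentiable ℂ fun z => G.resDet ℓ z • truncatedFree (K := K) ℓ R z :=
    (G.differentiable_resDet ℓ).smul (differentiable_truncatedFree ℓ R)
  have h2 : Differentiable ℂ fun z => G.scatteringOp ℓ z fun i => truncatedWave ℓ R i z :=
    differentiable_scatteringOp fun i => differentiable_truncatedWave ℓ R i
  exact (h1.add h2).const_smul (Complex.I / 2)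

theorem continuedResolvent_eq (hz : G.resDet ℓ z ≠ 0) :
    G.continuedResolvent ℓ R z = (G.denominator ℓ z)⁻¹ • G.numerator ℓ R z := by
  rw [continuedResolvent, denominator, numerator]
  simp only [smul_add, smul_smul]
  congr 2
  · field_simp
  · field_simp

theorem meromorphicOn_fraction :
    MeromorphicOn (fun z => (G.denominator ℓ z)⁻¹ • G.numerator ℓ R z) univ := fun z _ =>
  ((differentiable_denominator.analyticAt z).meromorphicAt.inv).smul
    (differentiable_numerator.analyticAt z).meromorphicAt

theorem analyticAt_fraction (hz : G.denominator ℓ z ≠ 0) :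
    AnalyticAt ℂ (fun z => (G.denominator ℓ z)⁻¹ • G.numerator ℓ R z) z :=
  ((differentiable_denominator.analyticAt z).inv hz).smul (differentiable_numerator.analyticAt z)

theorem fraction_eq (hz : 0 < z.im) (hℓ : ∀ m, 0 < ℓ m) :
    (G.denominator ℓ z)⁻¹ • G.numerator ℓ R z =
      cutoffOp K ℓ R ∘L G.fullResolvent hz ℓ ∘L cutoffOp K ℓ R := by
  rw [cutoffOp_fullResolvent, continuedResolvent_eq (resDet_ne_zero hz hℓ)]

/-- The quotient is analytic in the upper half-plane, where the denominator has no zeros, so passing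
to the normal form does not change its values there. -/
theorem isCutoffResolvent_toMeromorphicNFOn (hℓ : ∀ m, 0 < ℓ m) :
    G.IsCutoffResolvent ℓ R
      (toMeromorphicNFOn (fun z => (G.denominator ℓ z)⁻¹ • G.numerator ℓ R z) univ) := by
  refine ⟨meromorphicNFOn_toMeromorphicNFOn _ _, fun z hz =>
    ⟨G.fullResolvent hz ℓ, isResolventAt_fullResolvent hz hℓ, ?_⟩⟩
  rw [toMeromorphicNFOn_eq_toMeromorphicNFAt meromorphicOn_fraction (mem_univ z),
    toMeromorphicNFAt_eq_self.2
      (analyticAt_fraction (denominator_ne_zero hz hℓ)).meromorphicNFAt]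
  exact fraction_eq hz hℓ

theorem isCutoffResolvent_cutoffResolvent (hℓ : ∀ m, 0 < ℓ m) (R : ℝ) :
    G.IsCutoffResolvent ℓ R (G.cutoffResolvent ℓ R) := by
  have h : ∃ F, G.IsCutoffResolvent ℓ R F := ⟨_, isCutoffResolvent_toMeromorphicNFOn hℓ⟩
  rw [cutoffResolvent, dif_pos h]
  exact h.choose_spec

theorem IsResolventAt.unique {T T' : GraphL2 K ℓ →L[ℂ] GraphL2 K ℓ} (hℓ : ∀ m, 0 < ℓ m)
    (hz : 0 < z.im) (h : G.IsResolventAt ℓ (z ^ 2) T) (h' : G.IsResolventAt ℓ (z ^ 2) T') :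
    T = T' :=
  ContinuousLinearMap.ext fun f => HamiltonianRel.unique hℓ hz (h.1 f) (h'.1 f)

theorem cutoffResolvent_eq_comp (hℓ : ∀ m, 0 < ℓ m) (hz : 0 < z.im) :
    G.cutoffResolvent ℓ R z = cutoffOp K ℓ R ∘L G.fullResolvent hz ℓ ∘L cutoffOp K ℓ R := by
  obtain ⟨T, hT, h⟩ := (isCutoffResolvent_cutoffResolvent (G := G) hℓ R).2 z hz
  rw [h, hT.unique hℓ hz (isResolventAt_fullResolvent hz hℓ)]

/-- `cutoffResolvent` is defined by choice. The identity theorem shows that it is the quotient, and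
from here on only the quotient matters near each point. -/
theorem cutoffResolvent_eventuallyEq (hℓ : ∀ m, 0 < ℓ m) (z : ℂ) :
    G.cutoffResolvent ℓ R =ᶠ[𝓝[≠] z] fun z => (G.denominator ℓ z)⁻¹ • G.numerator ℓ R z := by
  refine eventuallyEq_of_eqOn_upperHalfPlane
    (isCutoffResolvent_cutoffResolvent hℓ R).1.meromorphicOn meromorphicOn_fraction
    (fun z hz => ?_) z
  rw [cutoffResolvent_eq_comp hℓ hz, fraction_eq hz hℓ]

theorem cutoffResolvent_eventuallyEq_nhds (hℓ : ∀ m, 0 < ℓ m) (hz : G.denominator ℓ z ≠ 0) :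
    G.cutoffResolvent ℓ R =ᶠ[𝓝 z] fun z => (G.denominator ℓ z)⁻¹ • G.numerator ℓ R z :=
  (MeromorphicNFAt.eventuallyEq_nhdsNE_iff_eventuallyEq_nhds
    ((isCutoffResolvent_cutoffResolvent hℓ R).1 (mem_univ z))
    (analyticAt_fraction hz).meromorphicNFAt).1 (cutoffResolvent_eventuallyEq hℓ z)

theorem meromorphicAt_cutoffResolvent (hℓ : ∀ m, 0 < ℓ m) (R : ℝ) (z : ℂ) :
    MeromorphicAt (G.cutoffResolvent ℓ R) z :=
  (isCutoffResolvent_cutoffResolvent hℓ R).1.meromorphicOn z (mem_univ z)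

theorem analyticAt_cutoffResolvent (hℓ : ∀ m, 0 < ℓ m) (hR : 0 < R) (hz : z ∉ G.Res ℓ) :
    AnalyticAt ℂ (G.cutoffResolvent ℓ R) z := by
  rw [← MeromorphicNFAt.meromorphicOrderAt_nonneg_iff_analyticAt
    ((isCutoffResolvent_cutoffResolvent hℓ R).1 (mem_univ z))]
  exact not_lt.1 fun h => hz ⟨R, hR, h⟩

theorem Res_subset (hℓ : ∀ m, 0 < ℓ m) {ζ : ℂ} (h : ζ ∈ G.Res ℓ) : G.denominator ℓ ζ = 0 := by
  by_contra hne
  obtain ⟨R, hR, h⟩ := h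
  rw [meromorphicOrderAt_congr (cutoffResolvent_eventuallyEq hℓ ζ)] at h
  exact absurd h (not_lt.2 (analyticAt_fraction hne).meromorphicOrderAt_nonneg)

end OpenGraph

end

/-! ### The multiplicity is bounded by the order of the zero of the denominator -/

noncomputable section

open scoped BoundedContinuousFunction

/-- The projection `q` with kernel `W` turns `F z f` into an analytic function, so the principal
part of the composition vanishes. -/
theorem IsPrincipalPart.apply_mem {H : Type*} [NormedAddCommGroup H] [InnerProductSpace ℂ H]
    {F : ℂ → H →L[ℂ] H} {ζ : ℂ} {A : ℕ →₀ (H →L[ℂ] H)} (h : IsPrincipalPart F ζ A)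
    (W : Submodule ℂ H) [W.HasOrthogonalProjection] (f : H) {g : ℂ → H} (hg : AnalyticAt ℂ g ζ)
    (hF : ∀ᶠ z in 𝓝[≠] ζ, F z f - g z ∈ W) (j : ℕ) : A j f ∈ W := by
  set q : H →L[ℂ] H := ContinuousLinearMap.id ℂ H - W.starProjection with hq
  have hqW : ∀ y, q y = 0 ↔ y ∈ W := fun y => by
    rw [hq, _root_.sub_apply, ContinuousLinearMap.id_apply, sub_eq_zero, eq_comm,
      Submodule.starProjection_eq_self_iff]
  have h1 := (h.map (ContinuousLinearMap.apply ℂ H f)).map q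
  have h2 := h1.eq_zero_of_analytic (g := fun z => q (g z)) ((q.analyticAt _).comp hg)
    (hF.mono fun z hz => by
      rw [← sub_eq_zero, ← map_sub]
      exact (hqW _).2 hz)
  rw [← hqW]
  simpa using DFunLike.congr_fun h2 j

/-- At `z = 0` the kernel is constant on `A × A`, so the operator has rank one, and its range is
spanned by the cut-off constant, the common value of all the waves at `z = 0`. Hence the pole of `1
/ z` in front of the free part adds nothing to the span of the waves. -/
theorem truncatedOp_expFamily_zero {μ : Measure ℝ} [SFinite μ] {A : Set ℝ} (hA : MeasurableSet A)
    {c : ℝ} (hc : μ A ≤ ENNReal.ofReal c) (h0 : 0 ≤ c) (k : (ℝ × ℝ) →ᵇ ℂ) (g : ℝ →ᵇ ℂ)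
    (f : Lp ℂ 2 μ) :
    truncatedOp μ hA hc h0 (expFamily k 0) f =
      (∫ y, A.indicator 1 y * f y ∂μ) • truncatedLp μ hA hc (expFamily g 0) := by
  apply Lp.ext
  filter_upwards [coeFn_truncatedOp (hA := hA) (hc := hc) (h0 := h0) (expFamily k 0) f,
    coeFn_truncatedLp (hA := hA) (hc := hc) (expFamily g 0),
    Lp.coeFn_smul (∫ y, A.indicator 1 y * f y ∂μ) (truncatedLp μ hA hc (expFamily g 0))]
    with x h1 h2 h3
  rw [h1, h3, Pi.smul_apply, h2]
  by_cases hx : x ∈ A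
  · rw [indicator_of_mem hx, expFamily_apply, zero_mul, Complex.exp_zero, smul_eq_mul, mul_one]
    refine integral_congr_ae (Eventually.of_forall fun y => ?_)
    by_cases hy : y ∈ A
    · simp [hx, hy, expFamily_apply]
    · simp [hy]
  · rw [indicator_of_notMem hx, smul_zero]
    simp [hx]

namespace OpenGraph

variable {J K M : ℕ} {G : OpenGraph J K M} {ℓ : Fin M → ℝ} {z : ℂ} {R : ℝ}

theorem truncatedFree_zero_mem (f : GraphL2 K ℓ) {W : Submodule ℂ (GraphL2 K ℓ)}
    (hW : ∀ i, truncatedWave ℓ R i 0 ∈ W) : truncatedFree ℓ R 0 f ∈ W := by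
  rw [truncatedFree, _root_.sum_apply]
  refine W.sum_mem fun e _ => ?_
  have key : ∀ i : WaveIndex K M, edgeIncl ℓ i.edge (truncatedOp (volume.restrict
      (edgeInterval ℓ i.edge)) (measurableSet_cutoffSet R i.edge) (volume_cutoffSet_le ℓ R i.edge)
      (le_max_right _ _) (expFamily (kernelExponent (cutoffLength R ℓ i.edge)) 0)
      (edgeProj ℓ i.edge f)) ∈ W := fun i => by
    rw [truncatedOp_expFamily_zero _ _ _ _ (waveExponent (cutoffLength R ℓ i.edge) i), map_smul]
    exact W.smul_mem _ (hW i)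
  have h := key (rightIndex e)
  rw [edge_rightIndex] at h
  exact h

/-- Only `ζ = 0` is an issue, and there the singular part of `z⁻¹ g z` is `z⁻¹ g 0`. -/
theorem exists_analyticAt_inv_smul_sub_mem {H : Type*} [NormedAddCommGroup H] [NormedSpace ℂ H]
    {g : ℂ → H} {ζ : ℂ} (hg : AnalyticAt ℂ g ζ) (W : Submodule ℂ H) (h0 : ζ = 0 → g 0 ∈ W) :
    ∃ h : ℂ → H, AnalyticAt ℂ h ζ ∧ ∀ᶠ z in 𝓝[≠] ζ, z⁻¹ • g z - h z ∈ W := by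
  by_cases hζ : ζ = 0
  · subst hζ
    obtain ⟨h, hh, hgh⟩ := hg.exists_eq_add_sub_smul
    refine ⟨h, hh, ?_⟩
    filter_upwards [hgh.filter_mono nhdsWithin_le_nhds, self_mem_nhdsWithin] with z hz hne
    have hne' : z ≠ 0 := hne
    rw [hz, sub_zero, smul_add, inv_smul_smul₀ hne', add_sub_cancel_right]
    exact W.smul_mem _ (h0 rfl)
  · exact ⟨fun z => z⁻¹ • g z, (analyticAt_id.inv hζ).smul hg, Eventually.of_forall fun z => by
      rw [sub_self]; exact W.zero_mem⟩

/-- Near `ζ` the denominator is `(z - ζ) ^ n d z` with `d ζ ≠ 0`. In the Taylor expansion of each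
cut-off wave to order `n` the remainder absorbs this zero. So, modulo analytic functions, the
cut-off resolvent takes its values in the span `W` of `n` Taylor coefficients for each wave. The
space `W` depends on `R`, the bound on its dimension does not. -/
theorem resMultiplicity_le (hℓ : ∀ m, 0 < ℓ m) (ζ : ℂ) : G.resMultiplicity ℓ ζ ≤
    (Fintype.card (WaveIndex K M) * analyticOrderNatAt (G.denominator ℓ) ζ : ℕ) := by
  refine iSup₂_le fun R hR => iSup₂_le fun A hA => ?_
  have hden : AnalyticAt ℂ (G.denominator ℓ) ζ := differentiable_denominator.analyticAt ζ
  have hfin : analyticOrderAt (G.denominator ℓ) ζ ≠ ⊤ :=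
    analyticOrderAt_ne_top_of_ne_zero differentiable_denominator
      (denominator_ne_zero (z := Complex.I) (by simp) hℓ) ζ
  set n := analyticOrderNatAt (G.denominator ℓ) ζ with hn
  obtain ⟨d, hd, hd0, hd_eq⟩ := (hden.analyticOrderAt_ne_top).1 hfin
  choose p g hg hp0 hp using fun i : WaveIndex K M =>
    ((differentiable_truncatedWave (K := K) ℓ R i).analyticAt ζ).exists_taylor n
  set W : Submodule ℂ (GraphL2 K ℓ) :=
    Submodule.span ℂ (range fun x : WaveIndex K M × Fin n => p x.1 x.2) with hW
  have hWfin : FiniteDimensional ℂ W := FiniteDimensional.span_of_finite ℂ (finite_range _)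
  have hmem : ∀ i k, k < n → p i k ∈ W := fun i k hk =>
    Submodule.subset_span ⟨(i, ⟨k, hk⟩), rfl⟩
  have hA' := hA.congr ((cutoffResolvent_eventuallyEq (G := G) (R := R) hℓ ζ).mono
    fun z hz => hz.symm)
  have key : ∀ j f, A j f ∈ W := by
    intro j f
    obtain ⟨h, hh, hfree⟩ := exists_analyticAt_inv_smul_sub_mem
      (g := fun z => truncatedFree ℓ R z f) (ζ := ζ)
      (((ContinuousLinearMap.apply ℂ (GraphL2 K ℓ) f).analyticAt _).comp
        ((differentiable_truncatedFree (K := K) ℓ R).analyticAt ζ)) W (by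
        rintro rfl
        refine truncatedFree_zero_mem f fun i => ?_
        rw [← hp0]
        -- The factor `z` makes the denominator vanish at `0`; thus `n ≥ 1`, and the value of the
        -- wave at `0` is among the spanning vectors.
        refine hmem i 0 (Nat.pos_of_ne_zero fun h0 => ?_)
        rw [hn, analyticOrderNatAt, ENat.toNat_eq_zero, hden.analyticOrderAt_eq_zero] at h0
        simp [denominator, hfin] at h0)
    let b : WaveIndex K M → ℂ → ℂ := fun i z =>
      ∑ j, G.resCoeff ℓ z i j * graphPairing ℓ (truncatedWave ℓ R j z) f
    have hb : ∀ i, AnalyticAt ℂ (b i) ζ := by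
      intro i
      have : Differentiable ℂ (b i) := by
        refine Differentiable.fun_sum fun j _ => (G.differentiable_resCoeff ℓ i j).mul ?_
        exact ((graphPairing ℓ).flip f).differentiable.comp (differentiable_truncatedWave ℓ R j)
      exact this.analyticAt ζ
    refine hA'.apply_mem W f (g := fun z => (Complex.I / 2) • (h z + ∑ i, (b i z * (d z)⁻¹) • g i z))
      ?_ ?_ j
    · have h2 : AnalyticAt ℂ (fun z => ∑ i, (b i z * (d z)⁻¹) • g i z) ζ :=
        Finset.analyticAt_fun_sum _ fun i _ => ((hb i).mul (hd.inv hd0)).smul (hg i)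
      have h3 : AnalyticAt ℂ (fun _ : ℂ => Complex.I / 2) ζ := analyticAt_const
      exact h3.smul (hh.add h2)
    · have h0 : ∀ᶠ z in 𝓝[≠] ζ, G.denominator ℓ z ≠ 0 :=
        (hden.eventually_eq_zero_or_eventually_ne_zero).resolve_left
          fun h => hfin (analyticOrderAt_eq_top.2 h)
      filter_upwards [hfree, h0, hd_eq.filter_mono nhdsWithin_le_nhds,
        (eventually_all.2 hp).filter_mono nhdsWithin_le_nhds, self_mem_nhdsWithin]
        with z h1 h2 h3 h4 hne
      have hne' : z - ζ ≠ 0 := sub_ne_zero.2 hne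
      have h2' : z ≠ 0 ∧ G.resDet ℓ z ≠ 0 := by
        rw [denominator] at h2; exact ne_zero_and_ne_zero_of_mul h2
      -- The free part lies in `W` up to `h`, the Taylor polynomials lie in `W`, and the remainders
      -- form the analytic part that is subtracted.
      have h5 : ((G.denominator ℓ z)⁻¹ • G.numerator ℓ R z) f -
          (Complex.I / 2) • (h z + ∑ i, (b i z * (d z)⁻¹) • g i z) =
          (Complex.I / 2) • ((z⁻¹ • truncatedFree ℓ R z f - h z) + ∑ i,
            ((G.denominator ℓ z)⁻¹ * b i z) • ∑ k ∈ Finset.range n, (z - ζ) ^ k • p i k) := by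
        have e1 : G.numerator ℓ R z f = (Complex.I / 2) • (G.resDet ℓ z • truncatedFree ℓ R z f +
            ∑ i, b i z • truncatedWave ℓ R i z) := by
          rw [numerator, _root_.smul_apply, _root_.add_apply, _root_.smul_apply, scatteringOp_apply]
        have e2 : (G.denominator ℓ z)⁻¹ * G.resDet ℓ z = z⁻¹ := by
          rw [denominator, mul_inv, inv_mul_cancel_right₀ h2'.2]
        have e3 : ∀ i, (G.denominator ℓ z)⁻¹ • b i z • truncatedWave ℓ R i z =
            ((G.denominator ℓ z)⁻¹ * b i z) • (∑ k ∈ Finset.range n, (z - ζ) ^ k • p i k) +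
              (b i z * (d z)⁻¹) • g i z := by
          intro i
          rw [h4 i, smul_smul, smul_add, smul_smul]
          congr 2
          rw [h3, smul_eq_mul, mul_inv]
          have := pow_ne_zero n hne'
          field_simp
          rw [← hn]
          ring
        rw [_root_.smul_apply, e1, smul_comm, ← smul_sub, smul_add, smul_smul, e2, Finset.smul_sum,
          Finset.sum_congr rfl fun i _ => e3 i, Finset.sum_add_distrib]
        congr 1
        abel
      rw [h5]
      refine W.smul_mem _ (W.add_mem h1 (W.sum_mem fun i _ => W.smul_mem _ (W.sum_mem fun k hk =>
        W.smul_mem _ (hmem i k (Finset.mem_range.1 hk)))))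
  have hle : (⨆ j, LinearMap.range ((A j : GraphL2 K ℓ →ₗ[ℂ] GraphL2 K ℓ))) ≤ W := by
    refine iSup_le fun j => ?_
    rintro _ ⟨f, rfl⟩
    exact key j f
  have h1 : Module.finrank ℂ W ≤ Fintype.card (WaveIndex K M) * n := by
    refine (finrank_range_le_card _).trans ?_
    simp
  calc _ ≤ Cardinal.toENat (Module.rank ℂ W) := by
        gcongr
        exact Submodule.rank_mono hle
    _ = (Module.finrank ℂ W : ℕ∞) := by rw [← Module.finrank_eq_rank]; simp
    _ ≤ _ := by exact_mod_cast h1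

end OpenGraph

end

/-! ### The order of a pole different from zero is at most its multiplicity -/

noncomputable section

namespace IsPrincipalPart

variable {V : Type*} [NormedAddCommGroup V] [NormedSpace ℂ V] {F F' : ℂ → V} {ζ : ℂ}
  {A A' : ℕ →₀ V}

theorem add (h : IsPrincipalPart F ζ A) (h' : IsPrincipalPart F' ζ A') :
    IsPrincipalPart (fun z => F z + F' z) ζ (A + A') := by
  obtain ⟨g, hg, h⟩ := h
  obtain ⟨g', hg', h'⟩ := h'
  refine ⟨fun z => g z + g' z, hg.add hg', ?_⟩
  filter_upwards [h, h'] with z h1 h2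
  rw [h1, h2, Finsupp.sum_add_index' (by simp) (fun _ _ _ => smul_add _ _ _)]
  abel

/-- Multiplication by `z - ζ` shifts the coefficients down by one, and `A 0` moves into the analytic
part. -/
theorem sub_smul (h : IsPrincipalPart F ζ A) :
    IsPrincipalPart (fun z => (z - ζ) • F z) ζ
      (A.comapDomain Nat.succ Nat.succ_injective.injOn) := by
  obtain ⟨N, hN⟩ := A.exists_forall_ge_eq_zero
  obtain ⟨g, hg, hF⟩ := h.eventually_eq_sum (N := N + 1) (fun j hj => hN j (by omega))
  refine ⟨fun z => (z - ζ) • g z + A 0, by fun_prop, ?_⟩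
  filter_upwards [hF, self_mem_nhdsWithin] with z hz hne
  have hne' : z - ζ ≠ 0 := sub_ne_zero.2 hne
  rw [hz, Finsupp.sum_principalPart_eq (A := A.comapDomain Nat.succ Nat.succ_injective.injOn)
    (N := N) (fun j hj => hN _ (Nat.le_succ_of_le hj)),
    Finset.sum_range_succ', smul_add, smul_add, Finset.smul_sum, zero_add, pow_one,
    smul_inv_smul₀ hne']
  have : ∀ j ∈ Finset.range N, (z - ζ) • ((z - ζ) ^ (j + 1 + 1))⁻¹ • A (j + 1) =
      ((z - ζ) ^ (j + 1))⁻¹ • A.comapDomain Nat.succ Nat.succ_injective.injOn j := by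
    intro j _
    rw [smul_smul, Finsupp.comapDomain_apply]
    congr 1
    rw [pow_succ (z - ζ) (j + 1)]
    field_simp
  rw [Finset.sum_congr rfl this]
  abel

end IsPrincipalPart

/-- A chain of vectors on which an operator acts as a shift up to terms of higher order is linearly
independent; the operator is given in the weak sense. -/
theorem linearIndependent_of_jordan_chain {V : Type*} [AddCommGroup V] [Module ℂ V] {u : ℕ → V}
    {N : ℕ} (hN : u N ≠ 0) (hu : ∀ j, N < j → u j = 0) {ζ : ℂ} (hζ : ζ ≠ 0)
    {ι : Type*} (Λ Λ' : ι → V →ₗ[ℂ] ℂ)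
    (hsep : ∀ v ∈ Submodule.span ℂ (range u), (∀ i, Λ i v = 0) → v = 0)
    (hΛ : ∀ i j, Λ' i (u j) = 2 * ζ * Λ i (u (j + 1)) + Λ i (u (j + 2))) :
    LinearIndependent ℂ fun j : Fin (N + 1) => u j := by
  -- In a vanishing combination of `u 0, …, u N` the lowest coefficient is zero; `d` is the distance
  -- of its index from `N`.
  have key : ∀ d ≤ N, ∀ c : ℕ → ℂ, (∀ j, j < N - d → c j = 0) →
      ∑ j ∈ Finset.range (N + 1), c j • u j = 0 → c (N - d) = 0 := by
    intro d
    induction d with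
    | zero =>
      intro _ c hc h
      rw [Finset.sum_range_succ, Finset.sum_eq_zero, zero_add, smul_eq_zero] at h
      · exact h.resolve_right hN
      · intro j hj
        rw [hc j (by simpa using hj), zero_smul]
    | succ d ih =>
      intro hd c hc h
      -- The operator carries the relation with coefficients `c` to one with coefficients `c'`,
      -- which starts one index higher. Its lowest coefficient is `2 ζ` times that of `c`, and here
      -- `ζ ≠ 0` is indispensable.
      set c' : ℕ → ℂ := fun j => match j with
        | 0 => 0
        | 1 => 2 * ζ * c 0
        | j + 2 => 2 * ζ * c (j + 1) + c j with hc'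
      have hsum : ∑ j ∈ Finset.range (N + 1), c' j • u j = 0 := by
        refine hsep _ (Submodule.sum_mem _ fun j _ => Submodule.smul_mem _ _
          (Submodule.subset_span ⟨j, rfl⟩)) fun i => ?_
        have h1 : ∑ j ∈ Finset.range (N + 1), c j * Λ' i (u j) = 0 := by
          have := congrArg (Λ' i) h
          simpa using this
        have h2 : Λ i (u (N + 1)) = 0 := by rw [hu _ (by omega), map_zero]
        have h3 : Λ i (u (N + 2)) = 0 := by rw [hu _ (by omega), map_zero]
        have h4 : ∑ j ∈ Finset.range (N + 1), c' j * Λ i (u j) =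
            ∑ j ∈ Finset.range (N + 1 + 2), c' j * Λ i (u j) := by
          rw [Finset.sum_range_succ _ (N + 2), Finset.sum_range_succ _ (N + 1), h2, h3]
          simp
        have h5 : ∑ j ∈ Finset.range (N + 1), 2 * ζ * c j * Λ i (u (j + 1)) =
            (∑ j ∈ Finset.range (N + 1), 2 * ζ * c (j + 1) * Λ i (u (j + 2))) +
              2 * ζ * c 0 * Λ i (u 1) := by
          rw [← Finset.sum_range_succ' (fun j => 2 * ζ * c j * Λ i (u (j + 1))) (N + 1),
            Finset.sum_range_succ _ (N + 1), h3, mul_zero, add_zero]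
        simp only [map_sum, map_smul, smul_eq_mul]
        rw [h4, Finset.sum_range_succ', Finset.sum_range_succ', ← h1]
        simp only [hΛ, mul_add, Finset.sum_add_distrib]
        simp only [hc', zero_mul, add_zero, zero_add, add_mul, Finset.sum_add_distrib]
        have h6 : ∑ j ∈ Finset.range (N + 1), c j * (2 * ζ * Λ i (u (j + 1))) =
            ∑ j ∈ Finset.range (N + 1), 2 * ζ * c j * Λ i (u (j + 1)) :=
          Finset.sum_congr rfl fun j _ => by ring
        rw [h6, h5]
        ring
      have h1 := ih (by omega) c' (fun j hj => by
        match j with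
        | 0 => rfl
        | 1 => simp only [hc']; rw [hc 0 (by omega), mul_zero]
        | j + 2 =>
          simp only [hc']
          rw [hc (j + 1) (by omega), hc j (by omega), mul_zero, add_zero]) hsum
      obtain ⟨k, hk⟩ : ∃ k, N - d = k + 1 := ⟨N - d - 1, by omega⟩
      have hk' : N - (d + 1) = k := by omega
      rw [hk] at h1
      rw [hk']
      rw [hk'] at hc
      have h2 : c' (k + 1) = 2 * ζ * c k := by
        rcases k with _ | k
        · rfl
        · simp only [hc']
          rw [hc k (by omega), add_zero]
      rw [h2] at h1
      exact (mul_eq_zero.1 h1).resolve_left (mul_ne_zero two_ne_zero hζ)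
  rw [Fintype.linearIndependent_iff]
  intro c h i
  set c' : ℕ → ℂ := fun j => if hj : j < N + 1 then c ⟨j, hj⟩ else 0 with hc'
  have hsum : ∑ j ∈ Finset.range (N + 1), c' j • u j = 0 := by
    rw [← h, Finset.sum_range]
    refine Finset.sum_congr rfl fun j _ => ?_
    simp only [hc', dif_pos j.2]
  have hall : ∀ j, j ≤ N → c' j = 0 := by
    intro j
    induction j using Nat.strong_induction_on with
    | _ j ih =>
      intro hj
      have h1 := key (N - j) (by omega) c' (fun k hk => ih k (by omega) (by omega)) hsum
      rwa [Nat.sub_sub_self hj] at h1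
  have := hall i (by omega)
  simpa only [hc', dif_pos i.2] using this

theorem LinearIndependent.le_toENat_rank {V : Type*} [AddCommGroup V] [Module ℂ V] {n : ℕ}
    {u : Fin n → V} (hu : LinearIndependent ℂ u) {S : Submodule ℂ V} (hS : ∀ i, u i ∈ S) :
    (n : ℕ∞) ≤ Cardinal.toENat (Module.rank ℂ S) := by
  have h1 : LinearIndependent ℂ fun i => (⟨u i, hS i⟩ : S) :=
    LinearIndependent.of_comp S.subtype hu
  have h2 := h1.cardinal_lift_le_rank
  rw [Cardinal.mk_fin, Cardinal.lift_natCast] at h2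
  have h3 := Cardinal.toENat.monotone' h2
  simpa using h3

/-- The principal part of an operator valued function that solves, in the weak sense, an equation
`(D + z ^ 2) F z = -1`, at a point different from `0`. -/
theorem IsPrincipalPart.le_toENat_rank_of_ne_zero {V : Type*} [NormedAddCommGroup V]
    [NormedSpace ℂ V] {F : ℂ → V →L[ℂ] V} {ζ : ℂ} {A : ℕ →₀ (V →L[ℂ] V)}
    (h : IsPrincipalPart F ζ A) (hζ : ζ ≠ 0) {ι : Type*} (Λ Λ' : ι → V →L[ℂ] ℂ)
    (hsep : ∀ v ∈ (⨆ j, LinearMap.range ((A j : V →ₗ[ℂ] V)) : Submodule ℂ V),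
      (∀ i, Λ i v = 0) → v = 0)
    (hΛ : ∀ i f, ∀ᶠ z in 𝓝[≠] ζ, Λ' i (F z f) + z ^ 2 * Λ i (F z f) = -Λ i f)
    {j : ℕ} (hj : A j ≠ 0) :
    ((j + 1 : ℕ) : ℕ∞) ≤
      Cardinal.toENat (Module.rank ℂ (⨆ j, LinearMap.range ((A j : V →ₗ[ℂ] V)) : Submodule ℂ V)) := by
  have hne : A.support.Nonempty := ⟨j, Finsupp.mem_support_iff.2 hj⟩
  set N := A.support.max' hne with hN
  have hjN : j ≤ N := Finset.le_max' _ _ (Finsupp.mem_support_iff.2 hj)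
  have hAN : A N ≠ 0 := Finsupp.mem_support_iff.1 (Finset.max'_mem _ hne)
  have hA : ∀ k, N < k → A k = 0 := fun k hk => by
    by_contra hcon
    exact absurd (Finset.le_max' _ _ (Finsupp.mem_support_iff.2 hcon)) (not_le.2 hk)
  obtain ⟨f, hf⟩ : ∃ f, A N f ≠ 0 := by
    by_contra! hcon
    exact hAN (ContinuousLinearMap.ext hcon)
  have hmem : ∀ k, A k f ∈ (⨆ j, LinearMap.range ((A j : V →ₗ[ℂ] V)) : Submodule ℂ V) := fun k =>
    Submodule.mem_iSup_of_mem k ⟨f, rfl⟩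
  have hspan : Submodule.span ℂ (range fun k => A k f) ≤
      (⨆ j, LinearMap.range ((A j : V →ₗ[ℂ] V)) : Submodule ℂ V) :=
    Submodule.span_le.2 (by rintro _ ⟨k, rfl⟩; exact hmem k)
  have hind := linearIndependent_of_jordan_chain (u := fun k => A k f) (N := N) hf
    (fun k hk => by rw [hA k hk]; rfl) hζ (fun i => (Λ i : V →ₗ[ℂ] ℂ))
    -- If `Λ'` tests the second derivative, this is the weak form of `P - ζ²`.
    (fun i => -(Λ' i : V →ₗ[ℂ] ℂ) - (ζ ^ 2) • (Λ i : V →ₗ[ℂ] ℂ))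
    (fun v hv => hsep v (hspan hv)) (fun i k => by
      have h0 := h.map (ContinuousLinearMap.apply ℂ V f)
      have h1 := h0.map (Λ i)
      have h2 := h0.map (Λ' i)
      have h3 := h1.sub_smul
      have h4 := h3.sub_smul
      -- The expansion `z² = ζ² + 2 ζ (z - ζ) + (z - ζ)²` rewrites the equation in terms of the two
      -- shifts. Its right-hand side is constant in `z`, so the coefficients on the left vanish.
      have h5 := ((h2.add (h1.map (ζ ^ 2 • ContinuousLinearMap.id ℂ ℂ))).add
        (h3.map ((2 * ζ) • ContinuousLinearMap.id ℂ ℂ))).add h4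
      have h6 := h5.eq_zero_of_analytic (g := fun _ => -Λ i f) analyticAt_const (by
        filter_upwards [hΛ i f] with z hz
        rw [← hz]
        simp
        ring)
      have h7 := DFunLike.congr_fun h6 k
      simp at h7
      simp
      linear_combination -h7)
  refine le_trans ?_ (hind.le_toENat_rank fun k => hmem k)
  exact_mod_cast Nat.succ_le_succ hjN

end

/-! ### The resolvent equation in weak form -/

noncomputable section

open scoped BoundedContinuousFunction

theorem MeromorphicAt.clm_comp {V W : Type*} [NormedAddCommGroup V] [NormedSpace ℂ V]
    [NormedAddCommGroup W] [NormedSpace ℂ W] {F : ℂ → V} {ζ : ℂ} (hF : MeromorphicAt F ζ)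
    (L : V →L[ℂ] W) : MeromorphicAt (fun z => L (F z)) ζ := by
  obtain ⟨A, hA⟩ := exists_isPrincipalPart hF
  exact (hA.map L).meromorphicAt

/-- A function with its first two derivatives, for tests on the interval `(0, L)`. -/
structure IntervalTestFunction (L : ℝ) where
  /-- the function -/
  toFun : ℝ →ᵇ ℂ
  /-- the first derivative -/
  fst : ℝ →ᵇ ℂ
  /-- the second derivative -/
  snd : ℝ →ᵇ ℂ
  hasDerivAt : ∀ x, HasDerivAt toFun (fst x) x
  hasDerivAt_fst : ∀ x, HasDerivAt fst (snd x) x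
  zero_left : toFun 0 = 0
  zero_right : toFun L = 0
  fst_left : fst 0 = 0
  fst_right : fst L = 0

/-- A smooth function with compact support in `(0, L)` as a test function. -/
theorem exists_intervalTestFunction {L : ℝ} {φ : ℝ → ℝ} (hφ : ContDiff ℝ 2 φ) (hc : HasCompactSupport φ)
    (hs : tsupport φ ⊆ Ioo 0 L) : ∃ t : IntervalTestFunction L, ∀ x, t.toFun x = φ x := by
  have hφ1 : ContDiff ℝ 1 (deriv φ) := 
    (contDiff_succ_iff_deriv (n := 1)).1 (by rw [one_add_one_eq_two]; exact hφ) |>.2.2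
  have hφ2 : Continuous (deriv (deriv φ)) :=
    ((contDiff_succ_iff_deriv (n := 0)).1 (by rw [zero_add]; exact hφ1)).2.2.continuous
  have hs1 : tsupport (deriv φ) ⊆ Ioo 0 L := tsupport_deriv_subset.trans hs
  have key : ∀ g : ℝ → ℝ, Continuous g → HasCompactSupport g →
      ∃ t : ℝ →ᵇ ℂ, ∀ x, t x = g x := fun g hg hgc => by
    obtain ⟨C, hC⟩ := hgc.exists_bound_of_continuous hg
    exact ⟨BoundedContinuousFunction.ofNormedAddCommGroup (fun x => (g x : ℂ)) (by fun_prop) C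
      (fun x => by simpa using hC x), fun x => rfl⟩
  have hzero : ∀ {g : ℝ → ℝ}, tsupport g ⊆ Ioo 0 L → ∀ x ∉ Ioo 0 L, (g x : ℂ) = 0 :=
    fun hg x hx => by rw [image_eq_zero_of_notMem_tsupport fun h => hx (hg h), Complex.ofReal_zero]
  obtain ⟨t, ht⟩ := key φ hφ.continuous hc
  obtain ⟨t1, ht1⟩ := key (deriv φ) hφ1.continuous hc.deriv
  obtain ⟨t2, ht2⟩ := key (deriv (deriv φ)) hφ2 hc.deriv.deriv
  refine ⟨⟨t, t1, t2, fun x => ?_, fun x => ?_, ?_, ?_, ?_, ?_⟩, ht⟩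
  · rw [funext ht, ht1]
    exact ((hφ.differentiable (by norm_num)) x).hasDerivAt.ofReal_comp
  · rw [funext ht1, ht2]
    exact ((hφ1.differentiable (by norm_num)) x).hasDerivAt.ofReal_comp
  · rw [ht, hzero hs _ (by simp)]
  · rw [ht, hzero hs _ (by simp)]
  · rw [ht1, hzero hs1 _ (by simp)]
  · rw [ht1, hzero hs1 _ (by simp)]

theorem IntervalTestFunction.integral_eq_zero {L : ℝ} (φ : IntervalTestFunction L) {w w₁ w₂ : ℝ → ℂ}
    (hw : IsPrimitive L w w₁) (hw₁ : IsPrimitive L w₁ w₂) :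
    ∫ x in (0 : ℝ)..L, (φ.snd x * w x - φ.toFun x * w₂ x) = 0 := by
  have hL := hw.nonneg
  have h1 := IsPrimitive.of_hasDerivAt hL φ.hasDerivAt φ.fst.continuous
  have h2 := IsPrimitive.of_hasDerivAt hL φ.hasDerivAt_fst φ.snd.continuous
  have h3 := h2.mul hw
  have h4 := h1.mul hw₁
  have e3 := h3.eq_integral L (right_mem_Icc.2 hL)
  have e4 := h4.eq_integral L (right_mem_Icc.2 hL)
  rw [φ.fst_left, φ.fst_right, zero_mul, zero_mul, zero_add] at e3
  rw [φ.zero_left, φ.zero_right, zero_mul, zero_mul, zero_add] at e4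
  have h5 := intervalIntegral.integral_sub h3.integrable h4.integrable
  rw [← e3, ← e4, sub_zero] at h5
  rw [← h5]
  congr 1
  ext x
  ring

namespace OpenGraph

variable {J K M : ℕ} {G : OpenGraph J K M} {ℓ : Fin M → ℝ} {z : ℂ} {R : ℝ}

theorem cutoffOp_cutoffOp (f : GraphL2 K ℓ) : cutoffOp K ℓ R (cutoffOp K ℓ R f) = cutoffOp K ℓ R f := by
  refine graphL2_ext ℓ fun e => ?_
  rw [cutoffOp_apply, cutoffOp_apply]
  filter_upwards [coeFn_indicatorOp _ (cutoffSet R e) (measurableSet_cutoffSet R e)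
      (indicatorOp _ (cutoffSet R e) (measurableSet_cutoffSet R e) (f e)),
    coeFn_indicatorOp _ (cutoffSet R e) (measurableSet_cutoffSet R e) (f e)] with x h1 h2
  rw [h1]
  by_cases hx : x ∈ cutoffSet R e
  · rw [indicator_of_mem hx]
  · rw [indicator_of_notMem hx, h2, indicator_of_notMem hx]

theorem exists_isDomainFunction (hℓ : ∀ m, 0 < ℓ m) (hz : 0 < z.im) (R : ℝ) (f : GraphL2 K ℓ) :
    ∃ w w₁ w₂, G.IsDomainFunction ℓ w w₁ w₂ ∧
      (∀ e, G.cutoffResolvent ℓ R z f e =ᵐ[volume.restrict (edgeInterval ℓ e)]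
        (cutoffSet R e).indicator (w e)) ∧
      ∀ e, ∀ᵐ x ∂volume.restrict (edgeInterval ℓ e),
        -w₂ e x = (cutoffSet R e).indicator (f e) x + z ^ 2 * w e x := by
  obtain ⟨w, w₁, w₂, hw, h1, h2⟩ :=
    hamiltonianRel_iff.1 (hamiltonianRel_fullResolvent (G := G) hz hℓ (cutoffOp K ℓ R f))
  refine ⟨w, w₁, w₂, hw, fun e => ?_, fun e => ?_⟩
  · rw [cutoffResolvent_eq_comp hℓ hz, ContinuousLinearMap.comp_apply,
      ContinuousLinearMap.comp_apply, cutoffOp_apply]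
    filter_upwards [h1 e, coeFn_indicatorOp _ (cutoffSet R e) (measurableSet_cutoffSet R e)
      (G.fullResolvent hz ℓ (cutoffOp K ℓ R f) e)] with x a1 a2
    rw [a2]
    by_cases hx : x ∈ cutoffSet R e
    · rw [indicator_of_mem hx, indicator_of_mem hx, a1]
    · rw [indicator_of_notMem hx, indicator_of_notMem hx]
  · have h3 := h2 e
    rw [PiLp.add_apply, PiLp.smul_apply, cutoffOp_apply] at h3
    filter_upwards [h1 e, h3, coeFn_indicatorOp _ (cutoffSet R e) (measurableSet_cutoffSet R e)
      (f e), Lp.coeFn_add (indicatorOp _ (cutoffSet R e) (measurableSet_cutoffSet R e) (f e))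
        (z ^ 2 • G.fullResolvent hz ℓ (cutoffOp K ℓ R f) e),
      Lp.coeFn_smul (z ^ 2) (G.fullResolvent hz ℓ (cutoffOp K ℓ R f) e)] with x a1 a2 a3 a4 a5
    rw [← a2, a4, Pi.add_apply, a3, a5, Pi.smul_apply, a1, smul_eq_mul]

theorem setIntegral_indicator_cutoffSet (hℓ : ∀ m, 0 < ℓ m) (hR : 0 ≤ R) (e : Fin K ⊕ Fin M)
    (g : ℝ → ℂ) : ∫ x in edgeInterval ℓ e, (cutoffSet R e).indicator g x =
      ∫ x in (0 : ℝ)..cutoffLength R ℓ e, g x := by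
  rw [setIntegral_indicator (measurableSet_cutoffSet R e), edgeInterval_inter_cutoffSet,
    integral_Icc_eq_integral_Ioc, intervalIntegral.integral_of_le (cutoffLength_nonneg hR hℓ e)]

theorem intervalIntegrable_lp (hℓ : ∀ m, 0 < ℓ m) (hR : 0 ≤ R) (e : Fin K ⊕ Fin M)
    (f : EdgeL2 ℓ e) : IntervalIntegrable f volume 0 (cutoffLength R ℓ e) :=
  (Lp.memLp f).intervalIntegrable_of_subset (cutoffLength_nonneg hR hℓ e)
    (Icc_cutoffLength_subset R ℓ e)

/-- Integration against a function on a cut-off edge. -/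
def edgeFunctional (ℓ : Fin M → ℝ) (R : ℝ) (e : Fin K ⊕ Fin M) (φ : ℝ →ᵇ ℂ) : GraphL2 K ℓ →L[ℂ] ℂ :=
  graphPairing ℓ (edgeIncl ℓ e (truncatedLp (volume.restrict (edgeInterval ℓ e))
    (measurableSet_cutoffSet R e) (volume_cutoffSet_le ℓ R e) φ))

theorem edgeFunctional_apply (hℓ : ∀ m, 0 < ℓ m) (hR : 0 ≤ R) (e : Fin K ⊕ Fin M) (φ : ℝ →ᵇ ℂ)
    (f : GraphL2 K ℓ) :
    edgeFunctional ℓ R e φ f = ∫ x in (0 : ℝ)..cutoffLength R ℓ e, φ x * f e x := by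
  rw [edgeFunctional, graphPairing_edgeIncl, ← setIntegral_indicator_cutoffSet hℓ hR]
  refine integral_congr_ae ?_
  filter_upwards [coeFn_truncatedLp (hA := measurableSet_cutoffSet R e)
    (hc := volume_cutoffSet_le ℓ R e) φ] with x hx
  rw [hx]
  by_cases h : x ∈ cutoffSet R e
  · rw [indicator_of_mem h, indicator_of_mem h]
  · rw [indicator_of_notMem h, indicator_of_notMem h, zero_mul]

/-- Two integrations by parts against a function that vanishes with its derivative at both ends.
Vertex conditions and the cut at `R` do not enter, so the identity involves the cut-off resolvent
alone. -/
theorem edgeFunctional_cutoffResolvent (hℓ : ∀ m, 0 < ℓ m) (hz : 0 < z.im) (hR : 0 ≤ R)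
    (e : Fin K ⊕ Fin M) (φ : IntervalTestFunction (cutoffLength R ℓ e)) (f : GraphL2 K ℓ) :
    edgeFunctional ℓ R e φ.snd (G.cutoffResolvent ℓ R z f) +
      z ^ 2 * edgeFunctional ℓ R e φ.toFun (G.cutoffResolvent ℓ R z f) =
    -edgeFunctional ℓ R e φ.toFun f := by
  obtain ⟨w, w₁, w₂, hw, h1, h2⟩ := exists_isDomainFunction (G := G) hℓ hz R f
  have h0 := φ.integral_eq_zero (hw.isPrimitive hℓ hR e) (hw.isPrimitive_fst hℓ hR e)
  have hu := intervalIntegrable_lp hℓ hR e (G.cutoffResolvent ℓ R z f e)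
  have hf := intervalIntegrable_lp hℓ hR e (f e)
  rw [eq_neg_iff_add_eq_zero, edgeFunctional_apply hℓ hR, edgeFunctional_apply hℓ hR,
    edgeFunctional_apply hℓ hR, ← intervalIntegral.integral_const_mul,
    ← intervalIntegral.integral_add (hu.continuousOn_mul φ.snd.continuous.continuousOn)
      ((hu.continuousOn_mul φ.toFun.continuous.continuousOn).const_mul _),
    ← intervalIntegral.integral_add
      ((hu.continuousOn_mul φ.snd.continuous.continuousOn).add
        ((hu.continuousOn_mul φ.toFun.continuous.continuousOn).const_mul _))
      (hf.continuousOn_mul φ.toFun.continuous.continuousOn), ← h0,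
    intervalIntegral.integral_of_le (cutoffLength_nonneg hR hℓ e),
    intervalIntegral.integral_of_le (cutoffLength_nonneg hR hℓ e)]
  refine integral_congr_ae ?_
  have hle : volume.restrict (Ioc 0 (cutoffLength R ℓ e)) ≤ volume.restrict (edgeInterval ℓ e) :=
    Measure.restrict_mono (Ioc_subset_Icc_self.trans (Icc_cutoffLength_subset R ℓ e)) le_rfl
  filter_upwards [ae_mono hle (h1 e), ae_mono hle (h2 e), ae_restrict_mem measurableSet_Ioc]
    with x a1 a2 hx
  have hx' : x ∈ cutoffSet R e := by
    have : x ∈ edgeInterval ℓ e ∩ cutoffSet R e := by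
      rw [edgeInterval_inter_cutoffSet]; exact Ioc_subset_Icc_self hx
    exact this.2
  rw [indicator_of_mem hx'] at a1 a2
  rw [a1]
  linear_combination (-φ.toFun x) * a2

/-- The weak equation is an identity between scalar meromorphic functions and so extends from the
upper half-plane. No domain for the continued resolvent is needed. -/
theorem eventually_edgeFunctional_cutoffResolvent (hℓ : ∀ m, 0 < ℓ m) (hR : 0 ≤ R)
    (e : Fin K ⊕ Fin M) (φ : IntervalTestFunction (cutoffLength R ℓ e)) (f : GraphL2 K ℓ) (ζ : ℂ) :
    ∀ᶠ z in 𝓝[≠] ζ, edgeFunctional ℓ R e φ.snd (G.cutoffResolvent ℓ R z f) +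
      z ^ 2 * edgeFunctional ℓ R e φ.toFun (G.cutoffResolvent ℓ R z f) =
    -edgeFunctional ℓ R e φ.toFun f := by
  have hm : ∀ (L : GraphL2 K ℓ →L[ℂ] ℂ) z,
      MeromorphicAt (fun z => L (G.cutoffResolvent ℓ R z f)) z := fun L z =>
    ((meromorphicAt_cutoffResolvent hℓ R z).clm_comp
      (ContinuousLinearMap.apply ℂ (GraphL2 K ℓ) f)).clm_comp L
  refine eventuallyEq_of_eqOn_upperHalfPlane (F' := fun _ => -edgeFunctional ℓ R e φ.toFun f)
    (fun z _ => ?_) (fun z _ => by fun_prop)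
    (fun z hz => edgeFunctional_cutoffResolvent hℓ hz hR e φ f) ζ
  have h1 : MeromorphicAt (fun z : ℂ => z ^ 2) z := by fun_prop
  exact (hm _ z).add (h1.mul (hm _ z))

/-- The operator `cutoffOp - 1` annihilates the cut-off resolvent, hence also its principal part.
Without this, functionals supported in `{r ≤ R}` would not separate the ranges of the coefficients.
-/
theorem cutoffOp_principalPart (hℓ : ∀ m, 0 < ℓ m) {ζ : ℂ}
    {A : ℕ →₀ (GraphL2 K ℓ →L[ℂ] GraphL2 K ℓ)}
    (hA : IsPrincipalPart (G.cutoffResolvent ℓ R) ζ A) (j : ℕ) (f : GraphL2 K ℓ) :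
    cutoffOp K ℓ R (A j f) = A j f := by
  set q : GraphL2 K ℓ →L[ℂ] GraphL2 K ℓ := cutoffOp K ℓ R - ContinuousLinearMap.id ℂ _ with hq
  have h1 := (hA.map (ContinuousLinearMap.apply ℂ (GraphL2 K ℓ) f)).map q
  have h2 := h1.eq_zero_of_analytic (g := fun _ => 0) analyticAt_const
    (eventuallyEq_of_eqOn_upperHalfPlane (F' := fun _ => 0)
      (fun z _ => ((meromorphicAt_cutoffResolvent hℓ R z).clm_comp
        (ContinuousLinearMap.apply ℂ (GraphL2 K ℓ) f)).clm_comp q) (fun z _ => by fun_prop)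
      (fun z hz => by
        rw [cutoffResolvent_eq_comp hℓ hz, ContinuousLinearMap.apply_apply, hq,
          _root_.sub_apply, ContinuousLinearMap.comp_apply, cutoffOp_cutoffOp,
          ContinuousLinearMap.id_apply, sub_self]) ζ)
  have h3 := DFunLike.congr_fun h2 j
  rw [Finsupp.mapRange_apply, Finsupp.mapRange_apply, ContinuousLinearMap.apply_apply, hq,
    _root_.sub_apply, ContinuousLinearMap.id_apply] at h3
  exact sub_eq_zero.1 h3

theorem eq_zero_of_edgeFunctional (hℓ : ∀ m, 0 < ℓ m) (hR : 0 ≤ R) {v : GraphL2 K ℓ}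
    (hv : cutoffOp K ℓ R v = v)
    (h : ∀ e, ∀ φ : IntervalTestFunction (cutoffLength R ℓ e), edgeFunctional ℓ R e φ.toFun v = 0) :
    v = 0 := by
  refine graphL2_ext ℓ fun e => ?_
  have hv' : v e =ᵐ[volume.restrict (edgeInterval ℓ e)] (cutoffSet R e).indicator (v e) := by
    have := coeFn_indicatorOp _ (cutoffSet R e) (measurableSet_cutoffSet R e) (v e)
    rwa [← cutoffOp_apply, hv] at this
  set L := cutoffLength R ℓ e with hL
  have hL0 : 0 ≤ L := cutoffLength_nonneg hR hℓ e
  have hint := intervalIntegrable_lp hℓ hR e (v e)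
  have hIoo : IntegrableOn (v e) (Ioo 0 L) := by
    rw [intervalIntegrable_iff_integrableOn_Ioc_of_le hL0] at hint
    exact hint.mono_set Ioo_subset_Ioc_self
  have h1 := isOpen_Ioo.ae_eq_zero_of_integral_contDiff_smul_eq_zero (μ := volume)
    (U := Ioo 0 L) hIoo.locallyIntegrableOn (fun φ hφ hc hs => by
      obtain ⟨t, ht⟩ := exists_intervalTestFunction 
        (hφ.of_le (WithTop.coe_le_coe.2 (le_top (a := (2 : ℕ∞))))) hc hs
      have h2 := h e t
      rw [edgeFunctional_apply hℓ hR, intervalIntegral.integral_of_le hL0,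
        integral_Ioc_eq_integral_Ioo] at h2
      rw [← h2, ← integral_indicator measurableSet_Ioo]
      congr 1
      ext x
      by_cases hx : x ∈ Ioo 0 L
      · rw [indicator_of_mem hx, ht, Complex.real_smul]
      · rw [indicator_of_notMem hx, image_eq_zero_of_notMem_tsupport fun h => hx (hs h), zero_smul])
  have h3 : ∀ᵐ x ∂volume, x ∈ Icc 0 L → v e x = 0 := by
    filter_upwards [h1, Measure.ae_ne volume 0, Measure.ae_ne volume L] with x a1 a2 a3 hx
    exact a1 ⟨lt_of_le_of_ne hx.1 a2.symm, lt_of_le_of_ne hx.2 a3⟩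
  filter_upwards [hv', ae_restrict_of_ae h3, ae_restrict_mem (measurableSet_edgeInterval ℓ e),
    Lp.coeFn_zero ℂ 2 (volume.restrict (edgeInterval ℓ e))] with x a1 a2 hx a3
  rw [PiLp.zero_apply, a3, a1]
  by_cases hx' : x ∈ cutoffSet R e
  · rw [indicator_of_mem hx', a2 (mem_Icc_of_mem_cutoffSet hx hx')]; rfl
  · rw [indicator_of_notMem hx']; rfl

theorem le_toENat_rank_of_ne_zero (hℓ : ∀ m, 0 < ℓ m) (hR : 0 ≤ R) {ζ : ℂ} (hζ : ζ ≠ 0)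
    {A : ℕ →₀ (GraphL2 K ℓ →L[ℂ] GraphL2 K ℓ)}
    (hA : IsPrincipalPart (G.cutoffResolvent ℓ R) ζ A) {j : ℕ} (hj : A j ≠ 0) :
    ((j + 1 : ℕ) : ℕ∞) ≤ Cardinal.toENat (Module.rank ℂ
      (⨆ j, LinearMap.range ((A j : GraphL2 K ℓ →ₗ[ℂ] GraphL2 K ℓ)) :
        Submodule ℂ (GraphL2 K ℓ))) := by
  refine hA.le_toENat_rank_of_ne_zero hζ
    (ι := Σ e : Fin K ⊕ Fin M, IntervalTestFunction (cutoffLength R ℓ e))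
    (fun i => edgeFunctional ℓ R i.1 i.2.toFun) (fun i => edgeFunctional ℓ R i.1 i.2.snd)
    (fun v hv h => ?_)
    (fun i f => eventually_edgeFunctional_cutoffResolvent hℓ hR i.1 i.2 f ζ) hj
  refine eq_zero_of_edgeFunctional hℓ hR ?_ fun e φ => h ⟨e, φ⟩
  have hle : (⨆ j, LinearMap.range ((A j : GraphL2 K ℓ →ₗ[ℂ] GraphL2 K ℓ)) :
      Submodule ℂ (GraphL2 K ℓ)) ≤
      LinearMap.eqLocus (cutoffOp K ℓ R : GraphL2 K ℓ →ₗ[ℂ] GraphL2 K ℓ) LinearMap.id := by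
    refine iSup_le fun j => ?_
    rintro _ ⟨f, rfl⟩
    exact cutoffOp_principalPart hℓ hA j f
  exact hle hv

end OpenGraph

end

/-! ### Energy and flux on the imaginary axis -/

noncomputable section

open scoped BoundedContinuousFunction

theorem intervalIntegrable_norm_sq {s : Set ℝ} {L : ℝ} {f : ℝ → ℂ}
    (hf : MemLp f 2 (volume.restrict s)) (hL : 0 ≤ L) (hs : Icc 0 L ⊆ s) :
    IntervalIntegrable (fun x => ‖f x‖ ^ 2) volume 0 L := by
  rw [intervalIntegrable_iff_integrableOn_Icc_of_le hL]
  have h : MemLp f 2 (volume.restrict (Icc 0 L)) := hf.mono_measure (Measure.restrict_mono hs le_rfl)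
  exact h.integrable_norm_pow (by norm_num)

/-- Expand `∫ (L ‖f‖ - a)² ≥ 0` with `a = ∫ ‖f‖`. -/
theorem sq_integral_norm_le {L : ℝ} (hL : 0 < L) {f : ℝ → ℂ}
    (hf : IntervalIntegrable f volume 0 L)
    (hf2 : IntervalIntegrable (fun x => ‖f x‖ ^ 2) volume 0 L) :
    (∫ x in (0 : ℝ)..L, ‖f x‖) ^ 2 ≤ L * ∫ x in (0 : ℝ)..L, ‖f x‖ ^ 2 := by
  set a := ∫ x in (0 : ℝ)..L, ‖f x‖ with ha
  have h1 : 0 ≤ ∫ x in (0 : ℝ)..L, (L * ‖f x‖ - a) ^ 2 :=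
    intervalIntegral.integral_nonneg hL.le fun x _ => sq_nonneg _
  have h2 : ∫ x in (0 : ℝ)..L, (L * ‖f x‖ - a) ^ 2 =
      L ^ 2 * (∫ x in (0 : ℝ)..L, ‖f x‖ ^ 2) - 2 * L * a * a + L * a ^ 2 := by
    have e : ∀ x, (L * ‖f x‖ - a) ^ 2 = L ^ 2 * ‖f x‖ ^ 2 - 2 * L * a * ‖f x‖ + a ^ 2 := fun x => by
      ring
    simp only [e]
    rw [intervalIntegral.integral_add ((hf2.const_mul _).sub (hf.norm.const_mul _))
      intervalIntegrable_const,
      intervalIntegral.integral_sub (hf2.const_mul _) (hf.norm.const_mul _),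
      intervalIntegral.integral_const_mul, intervalIntegral.integral_const_mul, ← ha]
    simp
  rw [h2] at h1
  have h3 : 0 ≤ L * (L * (∫ x in (0 : ℝ)..L, ‖f x‖ ^ 2) - a ^ 2) := by linarith
  nlinarith [(mul_nonneg_iff_of_pos_left hL).1 h3]

/-- A one-dimensional Sobolev estimate: the increment of `p` is at most `∫ ‖q‖`, followed by
Cauchy–Schwarz and `(a + b)² ≤ 2 a² + 2 b²`. -/
theorem IsPrimitive.norm_sq_le {L : ℝ} {p q : ℝ → ℂ} (h : IsPrimitive L p q) (hL : 0 < L)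
    (hq : IntervalIntegrable (fun x => ‖q x‖ ^ 2) volume 0 L) {x y : ℝ} (hx : x ∈ Icc 0 L)
    (hy : y ∈ Icc 0 L) :
    ‖p x‖ ^ 2 ≤ 2 * ‖p y‖ ^ 2 + 2 * L * ∫ t in (0 : ℝ)..L, ‖q t‖ ^ 2 := by
  have h1 : ‖p x - p y‖ ≤ ∫ t in (0 : ℝ)..L, ‖q t‖ := by
    rw [h.sub_eq_integral hy hx]
    refine (intervalIntegral.norm_integral_le_integral_norm_uIoc).trans ?_
    rw [intervalIntegral.integral_of_le hL.le]
    refine setIntegral_mono_set ?_ (Eventually.of_forall fun _ => norm_nonneg _) ?_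
    · have := h.integrable.norm
      rwa [intervalIntegrable_iff_integrableOn_Ioc_of_le hL.le] at this
    · refine LE.le.eventuallyLE ?_
      exact Ioc_subset_Ioc (le_min hy.1 hx.1) (max_le hy.2 hx.2)
  have h2 := sq_integral_norm_le hL h.integrable hq
  have h3 : ‖p x‖ ≤ ‖p y‖ + ∫ t in (0 : ℝ)..L, ‖q t‖ := by
    have := norm_sub_norm_le (p x) (p y)
    linarith
  have h4 : ‖p x‖ ^ 2 ≤ (‖p y‖ + ∫ t in (0 : ℝ)..L, ‖q t‖) ^ 2 :=
    pow_le_pow_left₀ (norm_nonneg _) h3 2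
  nlinarith [sq_nonneg (‖p y‖ - ∫ t in (0 : ℝ)..L, ‖q t‖)]

namespace OpenGraph

variable {J K M : ℕ} {G : OpenGraph J K M} {ℓ : Fin M → ℝ} {z : ℂ} {R : ℝ}

theorem inner_eq_intervalIntegral (hℓ : ∀ m, 0 < ℓ m) (hR : 0 ≤ R) {e : Fin K ⊕ Fin M}
    {a : EdgeL2 ℓ e} {w : ℝ → ℂ}
    (ha : a =ᵐ[volume.restrict (edgeInterval ℓ e)] (cutoffSet R e).indicator w) (b : EdgeL2 ℓ e) :
    inner ℂ a b = ∫ x in (0 : ℝ)..cutoffLength R ℓ e, starRingEnd ℂ (w x) * b x := by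
  rw [L2.inner_def, ← setIntegral_indicator_cutoffSet hℓ hR]
  refine integral_congr_ae ?_
  filter_upwards [ha] with x hx
  rw [hx]
  by_cases h : x ∈ cutoffSet R e
  · rw [indicator_of_mem h, indicator_of_mem h, RCLike.inner_apply, mul_comm]
  · rw [indicator_of_notMem h, indicator_of_notMem h, inner_zero_left]

theorem intervalIntegral_congr_cutoff (hℓ : ∀ m, 0 < ℓ m) (hR : 0 ≤ R) {e : Fin K ⊕ Fin M}
    {a w : ℝ → ℂ}
    (ha : a =ᵐ[volume.restrict (edgeInterval ℓ e)] (cutoffSet R e).indicator w)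
    (g : ℝ → ℂ → ℂ) :
    ∫ x in (0 : ℝ)..cutoffLength R ℓ e, g x (a x) =
      ∫ x in (0 : ℝ)..cutoffLength R ℓ e, g x (w x) := by
  rw [← setIntegral_indicator_cutoffSet hℓ hR, ← setIntegral_indicator_cutoffSet hℓ hR]
  refine integral_congr_ae ?_
  filter_upwards [ha] with x hx
  by_cases h : x ∈ cutoffSet R e
  · rw [indicator_of_mem h, indicator_of_mem h, hx, indicator_of_mem h]
  · rw [indicator_of_notMem h, indicator_of_notMem h]

theorem norm_sq_eq_intervalIntegral (hℓ : ∀ m, 0 < ℓ m) (hR : 0 ≤ R) {e : Fin K ⊕ Fin M}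
    {a : EdgeL2 ℓ e} {w : ℝ → ℂ}
    (ha : a =ᵐ[volume.restrict (edgeInterval ℓ e)] (cutoffSet R e).indicator w) :
    ‖a‖ ^ 2 = ∫ x in (0 : ℝ)..cutoffLength R ℓ e, ‖w x‖ ^ 2 := by
  have h1 := inner_eq_intervalIntegral hℓ hR ha a
  rw [inner_self_eq_norm_sq_to_K,
    intervalIntegral_congr_cutoff hℓ hR ha (fun x y => starRingEnd ℂ (w x) * y)] at h1
  have h2 : ∀ x, starRingEnd ℂ (w x) * w x = ((‖w x‖ ^ 2 : ℝ) : ℂ) := fun x => by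
    rw [Complex.conj_mul']; push_cast; rfl
  simp only [h2] at h1
  rw [intervalIntegral.integral_ofReal] at h1
  refine Complex.ofReal_injective ?_
  rw [← h1]
  simp

/-- The indicator function of `{r ≤ R}`. -/
def cutoffOne (ℓ : Fin M → ℝ) (R : ℝ) : GraphL2 K ℓ :=
  WithLp.toLp 2 fun e => truncatedLp (volume.restrict (edgeInterval ℓ e))
    (measurableSet_cutoffSet R e) (volume_cutoffSet_le ℓ R e) (BoundedContinuousFunction.const ℝ 1)

theorem inner_cutoffOne (hℓ : ∀ m, 0 < ℓ m) (hR : 0 ≤ R) (u : GraphL2 K ℓ) :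
    inner ℂ (cutoffOne ℓ R) u = ∑ e, ∫ x in (0 : ℝ)..cutoffLength R ℓ e, u e x := by
  rw [PiLp.inner_apply]
  refine Finset.sum_congr rfl fun e _ => ?_
  rw [inner_eq_intervalIntegral hℓ hR (w := fun _ => 1)]
  · simp
  · exact coeFn_truncatedLp (hA := measurableSet_cutoffSet R e)
      (hc := volume_cutoffSet_le ℓ R e) (BoundedContinuousFunction.const ℝ 1)

/-- The quantities in the energy identity and in the flux identity on the imaginary axis. -/
theorem exists_energy_estimate (hℓ : ∀ m, 0 < ℓ m) (hR : 0 < R) {ε : ℝ} (hε : 0 < ε)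
    {f u : GraphL2 K ℓ} (hu : u = G.cutoffResolvent ℓ R (Complex.I * ε) f) :
    ∃ (X : ℝ) (b : Fin K → ℂ), 0 ≤ X ∧
      X + ε ^ 2 * ‖u‖ ^ 2 + ε * ∑ k, ‖b k‖ ^ 2 = (inner ℂ u f).re ∧
      (∀ k, ‖u (Sum.inl k)‖ ^ 2 ≤ R * (2 * ‖b k‖ ^ 2 + 2 * R * X)) ∧
      (∀ k, R * ‖b k‖ ^ 2 ≤ 2 * ‖u (Sum.inl k)‖ ^ 2 + 2 * R ^ 2 * X) ∧
      ε * ∑ k, b k + ε ^ 2 * inner ℂ (cutoffOne ℓ R) u = inner ℂ (cutoffOne ℓ R) f := by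
  set z : ℂ := Complex.I * ε with hz_def
  have hz : 0 < z.im := by simpa [hz_def] using hε
  -- At `z = i ε` one has `-z² = ε²` and `-i z = ε`, so all terms of the energy identity are
  -- nonnegative and each of them is controlled by `⟨u, f⟩`.
  have hz2 : z ^ 2 = -(ε : ℂ) ^ 2 := by rw [hz_def, mul_pow, Complex.I_sq]; ring
  have hIz : Complex.I * z = -(ε : ℂ) := by
    rw [hz_def, ← mul_assoc, Complex.I_mul_I]; ring
  obtain ⟨w, w₁, w₂, hw, h1, h2⟩ := exists_isDomainFunction (G := G) hℓ hz R f
  rw [← hu] at h1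
  have hf0 : ∀ k, ∀ᵐ x ∂volume.restrict (Ici (0 : ℝ)), R < x →
      (cutoffSet R (Sum.inl k : Fin K ⊕ Fin M)).indicator (f (Sum.inl k)) x = 0 := fun k =>
    Eventually.of_forall fun x hx => indicator_of_notMem (by simpa [cutoffSet] using hx) _
  have hen := hw.energy hℓ hz hR.le h2 hf0
  have hout := hw.fst_eq_of_outgoing hz hR.le h2 hf0
  have hflux := hw.sum_integral_snd hℓ hR.le
  have hq : ∀ e, IntervalIntegrable (fun x => ‖w₁ e x‖ ^ 2) volume 0 (cutoffLength R ℓ e) :=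
    fun e => intervalIntegrable_norm_sq (hw.sobolev e).memLp_fst (cutoffLength_nonneg hR.le hℓ e)
      (Icc_cutoffLength_subset R ℓ e)
  have hq0 : ∀ e, IntervalIntegrable (fun x => ‖w e x‖ ^ 2) volume 0 (cutoffLength R ℓ e) :=
    fun e => intervalIntegrable_norm_sq (hw.sobolev e).memLp (cutoffLength_nonneg hR.le hℓ e)
      (Icc_cutoffLength_subset R ℓ e)
  set X : ℝ := ∑ e, ∫ x in (0 : ℝ)..cutoffLength R ℓ e, ‖w₁ e x‖ ^ 2 with hX
  have hXe : ∀ e, 0 ≤ ∫ x in (0 : ℝ)..cutoffLength R ℓ e, ‖w₁ e x‖ ^ 2 := fun e =>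
    intervalIntegral.integral_nonneg (cutoffLength_nonneg hR.le hℓ e) fun _ _ => sq_nonneg _
  have hXk : ∀ e, ∫ x in (0 : ℝ)..cutoffLength R ℓ e, ‖w₁ e x‖ ^ 2 ≤ X := fun e =>
    Finset.single_le_sum (f := fun e => ∫ x in (0 : ℝ)..cutoffLength R ℓ e, ‖w₁ e x‖ ^ 2)
      (fun e _ => hXe e) (Finset.mem_univ e)
  have hnorm : ∀ e, ‖u e‖ ^ 2 = ∫ x in (0 : ℝ)..cutoffLength R ℓ e, ‖w e x‖ ^ 2 := fun e =>
    norm_sq_eq_intervalIntegral hℓ hR.le (h1 e)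
  have hY : ∑ e, ∫ x in (0 : ℝ)..cutoffLength R ℓ e, ‖w e x‖ ^ 2 = ‖u‖ ^ 2 := by
    rw [PiLp.norm_sq_eq_of_L2]
    exact Finset.sum_congr rfl fun e _ => (hnorm e).symm
  have hind : ∀ e (g : ℝ → ℂ → ℂ), ∫ x in (0 : ℝ)..cutoffLength R ℓ e,
      g x ((cutoffSet R e).indicator (f e) x) = ∫ x in (0 : ℝ)..cutoffLength R ℓ e, g x (f e x) :=
    fun e g => intervalIntegral_congr_cutoff hℓ hR.le EventuallyEq.rfl g
  have hinner : ∑ e, ∫ x in (0 : ℝ)..cutoffLength R ℓ e,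
      starRingEnd ℂ (w e x) * (cutoffSet R e).indicator (f e) x = inner ℂ u f := by
    rw [PiLp.inner_apply]
    refine Finset.sum_congr rfl fun e _ => ?_
    rw [inner_eq_intervalIntegral hℓ hR.le (h1 e),
      hind e (fun x y => starRingEnd ℂ (w e x) * y)]
  have hsob : ∀ k, ∀ x ∈ Icc 0 R, ∀ y ∈ Icc 0 R,
      ‖w (Sum.inl k) x‖ ^ 2 ≤ 2 * ‖w (Sum.inl k) y‖ ^ 2 + 2 * R * X := by
    intro k x hx y hy
    have h3 := (hw.isPrimitive hℓ hR.le (Sum.inl k)).norm_sq_le hR (hq (Sum.inl k)) hx hy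
    have h4 : 2 * R * (∫ t in (0 : ℝ)..cutoffLength R ℓ (Sum.inl k : Fin K ⊕ Fin M),
        ‖w₁ (Sum.inl k) t‖ ^ 2) ≤ 2 * R * X :=
      mul_le_mul_of_nonneg_left (hXk _) (by positivity)
    exact h3.trans (add_le_add_right h4 _)
  -- `X` is the Dirichlet energy on `{r ≤ R}` and `b k` is the value of the solution at `r = R` on
  -- the lead `k`.
  refine ⟨X, fun k => w (Sum.inl k) R, Finset.sum_nonneg fun e _ => hXe e, ?_, fun k => ?_,
    fun k => ?_, ?_⟩
  · rw [hinner, hIz, hz2, hY] at hen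
    rw [← hen]
    simp [← Complex.ofReal_pow]
  · rw [hnorm]
    have h3 := intervalIntegral.integral_mono_on hR.le (hq0 (Sum.inl k))
      (intervalIntegrable_const (c := 2 * ‖w (Sum.inl k) R‖ ^ 2 + 2 * R * X))
      (fun x hx => hsob k x hx R (right_mem_Icc.2 hR.le))
    rw [intervalIntegral.integral_const, sub_zero, smul_eq_mul] at h3
    exact h3
  · rw [hnorm]
    have hk : IntervalIntegrable (fun x => ‖w (Sum.inl k) x‖ ^ 2) volume 0 R := hq0 (Sum.inl k)
    have h3 := intervalIntegral.integral_mono_on hR.le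
      (intervalIntegrable_const (c := ‖w (Sum.inl k) R‖ ^ 2))
      ((hk.const_mul 2).add (intervalIntegrable_const (c := 2 * R * X)))
      (fun x hx => hsob k R (right_mem_Icc.2 hR.le) x hx)
    rw [intervalIntegral.integral_const, sub_zero, smul_eq_mul,
      intervalIntegral.integral_add (hk.const_mul 2) intervalIntegrable_const,
      intervalIntegral.integral_const_mul, intervalIntegral.integral_const, sub_zero,
      smul_eq_mul] at h3
    refine h3.trans (le_of_eq ?_)
    simp only [cutoffLength, Sum.elim_inl]
    ring
  -- The integral of `w₂ = ε² u - f` equals the flux through `r = R`, which is `-ε ∑ b k` by the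
  -- outgoing condition.
  · rw [inner_cutoffOne hℓ hR.le, inner_cutoffOne hℓ hR.le, Finset.mul_sum, Finset.mul_sum]
    simp only [hout, hIz] at hflux
    have h3 : ∀ e, ∫ x in (0 : ℝ)..cutoffLength R ℓ e, w₂ e x =
        ε ^ 2 * (∫ x in (0 : ℝ)..cutoffLength R ℓ e, u e x) -
          ∫ x in (0 : ℝ)..cutoffLength R ℓ e, f e x := by
      intro e
      have hL := cutoffLength_nonneg hR.le hℓ e
      have hwi : IntervalIntegrable (w e) volume 0 (cutoffLength R ℓ e) :=
        (hw.sobolev e).memLp.intervalIntegrable_of_subset hL (Icc_cutoffLength_subset R ℓ e)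
      rw [intervalIntegral_congr_cutoff hℓ hR.le (h1 e) (fun _ y => y),
        ← intervalIntegral.integral_const_mul, ← intervalIntegral.integral_sub (hwi.const_mul _)
        (intervalIntegrable_lp hℓ hR.le e (f e)), intervalIntegral.integral_of_le hL,
        intervalIntegral.integral_of_le hL]
      refine integral_congr_ae ?_
      have hle : volume.restrict (Ioc 0 (cutoffLength R ℓ e)) ≤
          volume.restrict (edgeInterval ℓ e) :=
        Measure.restrict_mono (Ioc_subset_Icc_self.trans (Icc_cutoffLength_subset R ℓ e)) le_rfl
      filter_upwards [ae_mono hle (h2 e), ae_restrict_mem measurableSet_Ioc] with x a2 hx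
      have hx' : x ∈ edgeInterval ℓ e ∩ cutoffSet R e := by
        rw [edgeInterval_inter_cutoffSet]; exact Ioc_subset_Icc_self hx
      rw [indicator_of_mem hx'.2, hz2] at a2
      linear_combination -a2
    rw [Finset.sum_congr rfl fun e _ => h3 e, Finset.sum_sub_distrib] at hflux
    simp only [neg_mul, Finset.sum_neg_distrib] at hflux
    linear_combination hflux
end OpenGraph

end

/-! ### The order of a pole at zero is at most its multiplicity -/

noncomputable section

open scoped BoundedContinuousFunction

theorem tendsto_I_mul_nhdsGT : Tendsto (fun ε : ℝ => Complex.I * ε) (𝓝[>] 0) (𝓝[≠] 0) := by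
  refine tendsto_nhdsWithin_iff.2 ⟨?_, ?_⟩
  · have h : Continuous fun ε : ℝ => Complex.I * ε := by fun_prop
    have := (h.tendsto 0).mono_left (nhdsWithin_le_nhds (s := Ioi 0))
    simpa using this
  · filter_upwards [self_mem_nhdsWithin] with ε hε
    have : (ε : ℂ) ≠ 0 := by exact_mod_cast (ne_of_gt hε)
    exact mul_ne_zero Complex.I_ne_zero this

theorem eq_zero_of_tendsto_of_norm_sq_le {V : Type*} [NormedAddCommGroup V] {v : ℝ → V} {a : V}
    (h : Tendsto v (𝓝[>] 0) (𝓝 a)) {C : ℝ} (hC : ∀ ε, 0 < ε → ε ≤ 1 → ‖v ε‖ ^ 2 ≤ C * ε) :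
    a = 0 := by
  have h1 : Tendsto (fun ε => ‖v ε‖ ^ 2) (𝓝[>] 0) (𝓝 (‖a‖ ^ 2)) := h.norm.pow 2
  have h2 : Tendsto (fun ε : ℝ => C * ε) (𝓝[>] 0) (𝓝 0) := by
    have : Continuous fun ε : ℝ => C * ε := by fun_prop
    simpa using (this.tendsto 0).mono_left (nhdsWithin_le_nhds (s := Ioi 0))
  have h3 : ‖a‖ ^ 2 ≤ 0 := by
    refine le_of_tendsto_of_tendsto h1 h2 ?_
    filter_upwards [Ioc_mem_nhdsGT one_pos] with ε hε
    exact hC ε hε.1 hε.2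
  exact norm_eq_zero.1 (pow_eq_zero_iff two_ne_zero |>.1 (le_antisymm h3 (sq_nonneg _)))

namespace OpenGraph

variable {J K M : ℕ} {G : OpenGraph J K M} {ℓ : Fin M → ℝ} {R : ℝ}
  {A : ℕ →₀ (GraphL2 K ℓ →L[ℂ] GraphL2 K ℓ)}

theorem tendsto_cutoffResolvent_I_mul (hA : IsPrincipalPart (G.cutoffResolvent ℓ R) 0 A) {N : ℕ}
    (hN : ∀ j, N + 1 ≤ j → A j = 0) (f : GraphL2 K ℓ) :
    Tendsto (fun ε : ℝ => (Complex.I * ε) ^ (N + 1) • G.cutoffResolvent ℓ R (Complex.I * ε) f)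
      (𝓝[>] 0) (𝓝 (A N f)) := by
  have h := (hA.tendsto hN).comp tendsto_I_mul_nhdsGT
  have h2 := ((ContinuousLinearMap.apply ℂ (GraphL2 K ℓ) f).continuous.tendsto _).comp h
  simpa [Function.comp_def] using h2

theorem norm_I_mul_pow {ε : ℝ} (hε : 0 < ε) (n : ℕ) : ‖(Complex.I * ε) ^ n‖ = ε ^ n := by
  rw [norm_pow, norm_mul, Complex.norm_I, one_mul, Complex.norm_real, Real.norm_of_nonneg hε.le]

/-- Only the term `ε² ‖u‖²` of the energy is kept and compared with `‖u‖ ‖f‖`. -/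
theorem sq_mul_norm_cutoffResolvent_le (hℓ : ∀ m, 0 < ℓ m) (hR : 0 < R) {ε : ℝ} (hε : 0 < ε)
    (f : GraphL2 K ℓ) : ε ^ 2 * ‖G.cutoffResolvent ℓ R (Complex.I * ε) f‖ ≤ ‖f‖ := by
  obtain ⟨X, b, hX, h1, -⟩ := exists_energy_estimate (G := G) hℓ hR hε (f := f) rfl
  set u := G.cutoffResolvent ℓ R (Complex.I * ε) f with hu
  have h2 : (inner ℂ u f).re ≤ ‖u‖ * ‖f‖ :=
    (Complex.re_le_norm _).trans (norm_inner_le_norm u f)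
  have h3 : 0 ≤ ε * ∑ k, ‖b k‖ ^ 2 := mul_nonneg hε.le (Finset.sum_nonneg fun _ _ => sq_nonneg _)
  rcases (norm_nonneg u).eq_or_lt with h | h
  · rw [← h, mul_zero]; exact norm_nonneg _
  · refine le_of_mul_le_mul_left ?_ h
    nlinarith

/-- Since `ε² u` stays bounded, `(i ε) ^ (j + 1) u` tends to zero for `j ≥ 2`; its limit is `A j f`
once all higher coefficients are known to vanish. -/
theorem principalPart_zero_eq_zero (hℓ : ∀ m, 0 < ℓ m) (hR : 0 < R)
    (hA : IsPrincipalPart (G.cutoffResolvent ℓ R) 0 A) {j : ℕ} (hj : 2 ≤ j) : A j = 0 := by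
  have key : ∀ n, (∀ j, 2 + n ≤ j → A j = 0) → ∀ j, 2 ≤ j → A j = 0 := by
    intro n
    induction n with
    | zero => exact fun h j hj => h j hj
    | succ n ih =>
      intro h
      refine ih fun j hj => ?_
      rcases hj.eq_or_lt with rfl | hj
      · refine ContinuousLinearMap.ext fun f => ?_
        refine eq_zero_of_tendsto_of_norm_sq_le (tendsto_cutoffResolvent_I_mul hA h f)
          (C := ‖f‖ ^ 2) fun ε hε hε1 => ?_
        have h1 := sq_mul_norm_cutoffResolvent_le (G := G) hℓ hR hε f
        rw [norm_smul, norm_I_mul_pow hε]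
        have h2 : ε ^ (2 + n + 1) * ‖G.cutoffResolvent ℓ R (Complex.I * ε) f‖ ≤ ε * ‖f‖ := by
          calc ε ^ (2 + n + 1) * ‖G.cutoffResolvent ℓ R (Complex.I * ε) f‖
              = ε ^ n * (ε * (ε ^ 2 * ‖G.cutoffResolvent ℓ R (Complex.I * ε) f‖)) := by ring
            _ ≤ 1 * (ε * ‖f‖) := by
              gcongr
              exact pow_le_one₀ hε.le hε1
            _ = ε * ‖f‖ := one_mul _
        calc (ε ^ (2 + n + 1) * ‖G.cutoffResolvent ℓ R (Complex.I * ε) f‖) ^ 2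
            ≤ (ε * ‖f‖) ^ 2 := by gcongr
          _ = ‖f‖ ^ 2 * ε * ε := by ring
          _ ≤ ‖f‖ ^ 2 * ε * 1 := by gcongr
          _ = ‖f‖ ^ 2 * ε := mul_one _
      · exact h j (by omega)
  obtain ⟨N, hN⟩ := A.exists_forall_ge_eq_zero
  exact key N (fun j hj => hN j (by omega)) j hj

/-- The coefficient of `z⁻²` has no component in the leads. -/
theorem principalPart_zero_lead (hℓ : ∀ m, 0 < ℓ m) (hR : 0 < R)
    (hA : IsPrincipalPart (G.cutoffResolvent ℓ R) 0 A) (f : GraphL2 K ℓ) (k : Fin K) :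
    A 1 f (Sum.inl k) = 0 := by
  have h := tendsto_cutoffResolvent_I_mul hA (N := 1)
    (fun j hj => principalPart_zero_eq_zero hℓ hR hA hj) f
  have h2 := ((edgeProj ℓ (Sum.inl k)).continuous.tendsto _).comp h
  refine eq_zero_of_tendsto_of_norm_sq_le h2 (C := (2 * R + 2 * R ^ 2) * ‖f‖ ^ 2)
    fun ε hε hε1 => ?_
  obtain ⟨X, b, hX, h1, h3, -⟩ := exists_energy_estimate (G := G) hℓ hR hε (f := f) rfl
  have h0 := sq_mul_norm_cutoffResolvent_le (G := G) hℓ hR hε f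
  rw [Function.comp_apply, map_smul, norm_smul, norm_I_mul_pow hε, edgeProj_apply]
  set u := G.cutoffResolvent ℓ R (Complex.I * ε) f with hu
  have h4 : (inner ℂ u f).re ≤ ‖u‖ * ‖f‖ :=
    (Complex.re_le_norm _).trans (norm_inner_le_norm u f)
  have h5 : ‖b k‖ ^ 2 ≤ ∑ k, ‖b k‖ ^ 2 :=
    Finset.single_le_sum (f := fun k => ‖b k‖ ^ 2) (fun _ _ => sq_nonneg _) (Finset.mem_univ k)
  have hb0 : 0 ≤ ε * ∑ k, ‖b k‖ ^ 2 := mul_nonneg hε.le (Finset.sum_nonneg fun _ _ => sq_nonneg _)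
  have hu0 : 0 ≤ ε ^ 2 * ‖u‖ ^ 2 := by positivity
  -- The energy bounds `X` and `ε |b k|²` by `‖u‖ ‖f‖ = O(ε⁻²)`. The Sobolev estimate on the lead
  -- then makes the square of the norm of `u` there `O(ε⁻³)`, one power better than the general
  -- bound `O(ε⁻⁴)`.
  have h6 : ε * ‖b k‖ ^ 2 ≤ ‖u‖ * ‖f‖ := by
    have := mul_le_mul_of_nonneg_left h5 hε.le
    linarith
  have h7 : X ≤ ‖u‖ * ‖f‖ := by linarith
  have h8 : ε ^ 2 * (‖u‖ * ‖f‖) ≤ ‖f‖ ^ 2 := by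
    have := mul_le_mul_of_nonneg_right h0 (norm_nonneg f)
    nlinarith
  have h9 : ε ^ 3 * (ε * ‖b k‖ ^ 2) ≤ ε * ‖f‖ ^ 2 := by
    calc ε ^ 3 * (ε * ‖b k‖ ^ 2) ≤ ε ^ 3 * (‖u‖ * ‖f‖) := by gcongr
      _ = ε * (ε ^ 2 * (‖u‖ * ‖f‖)) := by ring
      _ ≤ ε * ‖f‖ ^ 2 := by gcongr
  have h10 : ε ^ 4 * X ≤ ε * ‖f‖ ^ 2 := by
    calc ε ^ 4 * X ≤ ε ^ 4 * (‖u‖ * ‖f‖) := by gcongr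
      _ = ε * ε * (ε ^ 2 * (‖u‖ * ‖f‖)) := by ring
      _ ≤ 1 * ε * ‖f‖ ^ 2 := by gcongr
      _ = ε * ‖f‖ ^ 2 := by ring
  calc (ε ^ (1 + 1) * ‖u (Sum.inl k)‖) ^ 2 = ε ^ 4 * ‖u (Sum.inl k)‖ ^ 2 := by ring
    _ ≤ ε ^ 4 * (R * (2 * ‖b k‖ ^ 2 + 2 * R * X)) := by gcongr; exact h3 k
    _ = 2 * R * (ε ^ 3 * (ε * ‖b k‖ ^ 2)) + 2 * R ^ 2 * (ε ^ 4 * X) := by ring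
    _ ≤ 2 * R * (ε * ‖f‖ ^ 2) + 2 * R ^ 2 * (ε * ‖f‖ ^ 2) := by gcongr
    _ = (2 * R + 2 * R ^ 2) * ‖f‖ ^ 2 * ε := by ring

theorem norm_inner_edgeIncl_le (u : GraphL2 K ℓ) (e : Fin K ⊕ Fin M) (g : EdgeL2 ℓ e) :
    ‖inner ℂ u (edgeIncl ℓ e g)‖ ≤ ‖u e‖ * ‖g‖ := by
  rw [PiLp.inner_apply, Finset.sum_eq_single e]
  · rw [edgeIncl_same]; exact norm_inner_le_norm _ _
  · intro e' _ he
    rw [edgeIncl_of_ne ℓ he, inner_zero_right]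
  · simp

/-- The coefficient of `z⁻²` vanishes on the functions that are supported in a lead. -/
theorem principalPart_zero_apply_lead (hℓ : ∀ m, 0 < ℓ m) (hR : 0 < R)
    (hA : IsPrincipalPart (G.cutoffResolvent ℓ R) 0 A) (k : Fin K)
    (g : EdgeL2 ℓ (Sum.inl k)) : A 1 (edgeIncl ℓ (Sum.inl k) g) = 0 := by
  have h := tendsto_cutoffResolvent_I_mul hA (N := 1)
    (fun j hj => principalPart_zero_eq_zero hℓ hR hA hj) (edgeIncl ℓ (Sum.inl k) g)
  refine eq_zero_of_tendsto_of_norm_sq_le h (C := (2 * R + 2 * R ^ 2) * ‖g‖ ^ 2)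
    fun ε hε hε1 => ?_
  obtain ⟨X, b, hX, h1, h3, -⟩ := exists_energy_estimate (G := G) hℓ hR hε
    (f := edgeIncl ℓ (Sum.inl k) g) rfl
  rw [norm_smul, norm_I_mul_pow hε]
  set u := G.cutoffResolvent ℓ R (Complex.I * ε) (edgeIncl ℓ (Sum.inl k) g) with hu
  set s := ‖u (Sum.inl k)‖ with hs
  have hs0 : 0 ≤ s := norm_nonneg _
  have h4 : (inner ℂ u (edgeIncl ℓ (Sum.inl k) g)).re ≤ s * ‖g‖ :=
    (Complex.re_le_norm _).trans (norm_inner_edgeIncl_le u _ g)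
  have h5 : ‖b k‖ ^ 2 ≤ ∑ k, ‖b k‖ ^ 2 :=
    Finset.single_le_sum (f := fun k => ‖b k‖ ^ 2) (fun _ _ => sq_nonneg _) (Finset.mem_univ k)
  have hb0 : 0 ≤ ε * ∑ k, ‖b k‖ ^ 2 := mul_nonneg hε.le (Finset.sum_nonneg fun _ _ => sq_nonneg _)
  have hu0 : 0 ≤ ε ^ 2 * ‖u‖ ^ 2 := by positivity
  have h6 : ε * ‖b k‖ ^ 2 ≤ s * ‖g‖ := by
    have := mul_le_mul_of_nonneg_left h5 hε.le
    linarith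
  have h7 : X ≤ s * ‖g‖ := by linarith
  have h8 : ε ^ 2 * ‖u‖ ^ 2 ≤ s * ‖g‖ := by linarith
  -- For `f` supported in the lead only `s`, the norm of `u` on that lead, enters the energy bound.
  -- The Sobolev estimate gives `ε s² ≤ C s`, so `s = O(ε⁻¹)`; fed back into `ε² ‖u‖² ≤ s ‖g‖`, this
  -- shows that `ε² u` tends to zero.
  have h9 : ε * s ≤ (2 * R + 2 * R ^ 2) * ‖g‖ := by
    rcases hs0.eq_or_lt with h | h
    · rw [← h, mul_zero]; positivity
    · refine le_of_mul_le_mul_left ?_ h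
      calc s * (ε * s) = ε * s ^ 2 := by ring
        _ ≤ ε * (R * (2 * ‖b k‖ ^ 2 + 2 * R * X)) := by gcongr; exact h3 k
        _ = 2 * R * (ε * ‖b k‖ ^ 2) + 2 * R ^ 2 * (ε * X) := by ring
        _ ≤ 2 * R * (s * ‖g‖) + 2 * R ^ 2 * (1 * (s * ‖g‖)) := by gcongr
        _ = s * ((2 * R + 2 * R ^ 2) * ‖g‖) := by ring
  calc (ε ^ (1 + 1) * ‖u‖) ^ 2 = ε ^ 2 * (ε ^ 2 * ‖u‖ ^ 2) := by ring
    _ ≤ ε ^ 2 * (s * ‖g‖) := by gcongr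
    _ = ε * ‖g‖ * (ε * s) := by ring
    _ ≤ ε * ‖g‖ * ((2 * R + 2 * R ^ 2) * ‖g‖) := by gcongr
    _ = (2 * R + 2 * R ^ 2) * ‖g‖ ^ 2 * ε := by ring

theorem norm_cutoffOne_sq (hℓ : ∀ m, 0 < ℓ m) (hR : 0 < R) (k : Fin K) :
    ‖cutoffOne (K := K) ℓ R (Sum.inl k)‖ ^ 2 = R := by
  refine (norm_sq_eq_intervalIntegral hℓ hR.le (a := cutoffOne (K := K) ℓ R (Sum.inl k))
    (w := fun _ => 1)
    (coeFn_truncatedLp (hA := measurableSet_cutoffSet R (Sum.inl k : Fin K ⊕ Fin M))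
      (hc := volume_cutoffSet_le ℓ R (Sum.inl k))
      (BoundedContinuousFunction.const ℝ 1))).trans ?_
  simp [cutoffLength]

theorem inner_cutoffOne_edgeIncl (hℓ : ∀ m, 0 < ℓ m) (hR : 0 < R) (k : Fin K) :
    inner ℂ (cutoffOne ℓ R) (edgeIncl ℓ (Sum.inl k) (cutoffOne (K := K) ℓ R (Sum.inl k))) =
      (R : ℂ) := by
  rw [PiLp.inner_apply, Finset.sum_eq_single (Sum.inl k)]
  · rw [edgeIncl_same, inner_self_eq_norm_sq_to_K]
    exact Eq.trans (by simp) (congrArg Complex.ofReal (norm_cutoffOne_sq (K := K) hℓ hR k))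
  · intro e' _ he
    rw [edgeIncl_of_ne ℓ he, inner_zero_right]
  · simp

/-- The coefficient of `z⁻¹` has a component in the leads. -/
theorem exists_principalPart_zero_lead_ne_zero (hℓ : ∀ m, 0 < ℓ m) (hR : 0 < R)
    (hA : IsPrincipalPart (G.cutoffResolvent ℓ R) 0 A) (k : Fin K) :
    ∃ k', A 0 (edgeIncl ℓ (Sum.inl k) (cutoffOne ℓ R (Sum.inl k))) (Sum.inl k') ≠ 0 := by
  by_contra! hcon
  set q : EdgeL2 ℓ (Sum.inl k : Fin K ⊕ Fin M) := cutoffOne ℓ R (Sum.inl k) with hq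
  set f : GraphL2 K ℓ := edgeIncl ℓ (Sum.inl k) q with hf
  have hA2 : ∀ j, 2 ≤ j → A j = 0 := fun j hj => principalPart_zero_eq_zero hℓ hR hA hj
  have hA1 : A 1 f = 0 := principalPart_zero_apply_lead hℓ hR hA k q
  obtain ⟨g, hg, hgF⟩ := hA.eventually_eq_sum hA2
  set u : ℝ → GraphL2 K ℓ := fun ε => G.cutoffResolvent ℓ R (Complex.I * ε) f with hu
  -- Under the contrary assumption, and since `A 1 f = 0`, no singular term is left on the leads, so
  -- `u` stays bounded there.
  have hlead : ∀ k', Tendsto (fun ε => u ε (Sum.inl k')) (𝓝[>] 0) (𝓝 (g 0 f (Sum.inl k'))) := by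
    intro k'
    have h1 : Tendsto g (𝓝[≠] 0) (𝓝 (g 0)) := hg.continuousAt.tendsto.mono_left nhdsWithin_le_nhds
    have h2 := ((edgeProj ℓ (Sum.inl k') ∘L
      ContinuousLinearMap.apply ℂ (GraphL2 K ℓ) f).continuous.tendsto _).comp
        (h1.comp tendsto_I_mul_nhdsGT)
    refine h2.congr' ?_
    filter_upwards [tendsto_I_mul_nhdsGT.eventually hgF] with ε hε
    have h3 : u ε = g (Complex.I * ε) f + (Complex.I * ε - 0)⁻¹ • A 0 f := by
      simp only [hu]
      rw [hε, Finset.sum_range_succ, Finset.sum_range_one]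
      simp [hA1]
    rw [h3, PiLp.add_apply, PiLp.smul_apply, hcon k', smul_zero, add_zero]
    rfl
  have hquad := tendsto_cutoffResolvent_I_mul hA (N := 1) hA2 f
  rw [hA1] at hquad
  -- The flux identity reads `ε ∑ b k = R - ε² ⟨1, u⟩`, and `ε² u` tends to `-A 1 f = 0`. The flux
  -- therefore tends to `R`.
  have hL : Tendsto (fun ε : ℝ => ‖(R : ℂ) - ε ^ 2 * inner ℂ (cutoffOne ℓ R) (u ε)‖) (𝓝[>] 0)
      (𝓝 R) := by
    have h1 := ((innerSL ℂ (cutoffOne (K := K) ℓ R)).continuous.tendsto _).comp hquad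
    have h2 := (h1.const_add (R : ℂ)).norm
    simp only [map_zero, add_zero, Complex.norm_real, Real.norm_of_nonneg hR.le] at h2
    refine h2.congr fun ε => ?_
    congr 1
    rw [Function.comp_apply, map_smul, innerSL_apply_apply, smul_eq_mul, mul_pow, Complex.I_sq]
    ring
  -- On the other hand each `ε |b k|` is bounded by such a square root, in terms of the values of
  -- `u` on the leads alone. These are bounded, so the flux tends to `0`, and `R ≤ 0` is the
  -- contradiction.
  have hB : Tendsto (fun ε : ℝ => ∑ k', Real.sqrt (ε ^ 2 * (2 * ‖u ε (Sum.inl k')‖ ^ 2 +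
      2 * R ^ 2 * (‖u ε (Sum.inl k)‖ * ‖q‖)) / R)) (𝓝[>] 0) (𝓝 0) := by
    suffices h : ∀ k', Tendsto (fun ε : ℝ => Real.sqrt (ε ^ 2 * (2 * ‖u ε (Sum.inl k')‖ ^ 2 +
        2 * R ^ 2 * (‖u ε (Sum.inl k)‖ * ‖q‖)) / R)) (𝓝[>] 0) (𝓝 0) by
      have h1 := tendsto_finsetSum Finset.univ fun k' _ => h k'
      rwa [Finset.sum_const_zero] at h1
    intro k'
    have h0 : Tendsto (fun ε : ℝ => ε ^ 2) (𝓝[>] 0) (𝓝 0) := by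
      have : Continuous fun ε : ℝ => ε ^ 2 := by fun_prop
      simpa using (this.tendsto 0).mono_left (nhdsWithin_le_nhds (s := Ioi 0))
    have h1 := (h0.mul ((((hlead k').norm.pow 2).const_mul 2).add
      (((hlead k).norm.mul_const ‖q‖).const_mul (2 * R ^ 2)))).div_const R
    rw [zero_mul, zero_div] at h1
    have h2 := (Real.continuous_sqrt.tendsto 0).comp h1
    rwa [Real.sqrt_zero] at h2
  have hle : R ≤ 0 := by
    refine le_of_tendsto_of_tendsto hL hB ?_
    filter_upwards [self_mem_nhdsWithin] with ε hε
    have hε : 0 < ε := hε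
    obtain ⟨X, b, hX, h1, -, h3, h4⟩ := exists_energy_estimate (G := G) hℓ hR hε (u := u ε)
      (f := f) rfl
    rw [hf, inner_cutoffOne_edgeIncl hℓ hR] at h4
    rw [← h4, add_sub_cancel_right, Finset.mul_sum]
    refine norm_sum_le_of_le _ fun k' _ => ?_
    have h5 : (inner ℂ (u ε) f).re ≤ ‖u ε (Sum.inl k)‖ * ‖q‖ :=
      (Complex.re_le_norm _).trans (norm_inner_edgeIncl_le (u ε) _ q)
    have hb0 : 0 ≤ ε * ∑ k, ‖b k‖ ^ 2 :=
      mul_nonneg hε.le (Finset.sum_nonneg fun _ _ => sq_nonneg _)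
    have hu0 : 0 ≤ ε ^ 2 * ‖u ε‖ ^ 2 := by positivity
    have h6 : X ≤ ‖u ε (Sum.inl k)‖ * ‖q‖ := by linarith
    refine Real.le_sqrt_of_sq_le ?_
    rw [le_div_iff₀ hR, norm_mul, Complex.norm_real, Real.norm_of_nonneg hε.le]
    calc (ε * ‖b k'‖) ^ 2 * R = ε ^ 2 * (R * ‖b k'‖ ^ 2) := by ring
      _ ≤ ε ^ 2 * (2 * ‖u ε (Sum.inl k')‖ ^ 2 + 2 * R ^ 2 * X) := by gcongr; exact h3 k'
      _ ≤ _ := by gcongr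
  exact absurd hR (not_lt.2 hle)

/-- The chain argument fails here, because the derivative of `z²` vanishes at `0`. As the order is
at most two, only a double pole needs care: a nonzero value of `A 1` vanishes on all leads, some
value of `A 0` does not, and the two are independent. -/
theorem le_toENat_rank_zero (hK : 0 < K) (hℓ : ∀ m, 0 < ℓ m) (hR : 0 < R)
    (hA : IsPrincipalPart (G.cutoffResolvent ℓ R) 0 A) {j : ℕ} (hj : A j ≠ 0) :
    ((j + 1 : ℕ) : ℕ∞) ≤ Cardinal.toENat (Module.rank ℂ
      (⨆ j, LinearMap.range ((A j : GraphL2 K ℓ →ₗ[ℂ] GraphL2 K ℓ)) :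
        Submodule ℂ (GraphL2 K ℓ))) := by
  have hmem : ∀ j f, A j f ∈ (⨆ j, LinearMap.range ((A j : GraphL2 K ℓ →ₗ[ℂ] GraphL2 K ℓ)) :
      Submodule ℂ (GraphL2 K ℓ)) := fun j f => Submodule.mem_iSup_of_mem j ⟨f, rfl⟩
  obtain ⟨f, hf⟩ : ∃ f, A j f ≠ 0 := by
    by_contra! hcon
    exact hj (ContinuousLinearMap.ext hcon)
  match j with
  | 0 =>
    have h1 : LinearIndependent ℂ ![A 0 f] := by
      rw [linearIndependent_unique_iff]
      exact hf
    exact h1.le_toENat_rank fun i => by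
      fin_cases i
      exact hmem 0 f
  | 1 =>
    obtain ⟨k', hk'⟩ := exists_principalPart_zero_lead_ne_zero hℓ hR hA ⟨0, hK⟩
    have h1 : LinearIndependent ℂ ![A 1 f,
        A 0 (edgeIncl ℓ (Sum.inl ⟨0, hK⟩) (cutoffOne ℓ R (Sum.inl ⟨0, hK⟩)))] := by
      rw [LinearIndependent.pair_iff]
      intro s t hst
      have h2 := congrArg (fun v : GraphL2 K ℓ => v (Sum.inl k')) hst
      simp only [PiLp.add_apply, PiLp.smul_apply, principalPart_zero_lead hℓ hR hA f k',
        smul_zero, zero_add, PiLp.zero_apply, smul_eq_zero] at h2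
      have ht := h2.resolve_right hk'
      rw [ht, zero_smul, add_zero, smul_eq_zero] at hst
      exact ⟨hst.resolve_right hf, ht⟩
    exact h1.le_toENat_rank fun i => by
      fin_cases i
      · exact hmem 1 f
      · exact hmem 0 _
  | j + 2 => exact absurd (principalPart_zero_eq_zero hℓ hR hA (by omega)) hj

/-- The order of a pole is at most its multiplicity. -/
theorem neg_resMultiplicity_le_meromorphicOrderAt (hK : 0 < K) (hℓ : ∀ m, 0 < ℓ m) (hR : 0 < R)
    (ζ : ℂ) : ((-((G.resMultiplicity ℓ ζ).toNat : ℤ) : ℤ) : WithTop ℤ) ≤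
      meromorphicOrderAt (G.cutoffResolvent ℓ R) ζ := by
  obtain ⟨A, hA⟩ := exists_isPrincipalPart (meromorphicAt_cutoffResolvent (G := G) hℓ R ζ)
  refine hA.neg_le_meromorphicOrderAt fun j hj => ?_
  by_contra hne
  have h1 : ((j + 1 : ℕ) : ℕ∞) ≤ Cardinal.toENat (Module.rank ℂ
      (⨆ j, LinearMap.range ((A j : GraphL2 K ℓ →ₗ[ℂ] GraphL2 K ℓ)) :
        Submodule ℂ (GraphL2 K ℓ))) := by
    by_cases hζ : ζ = 0
    · subst hζ
      exact le_toENat_rank_zero hK hℓ hR hA hne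
    · exact le_toENat_rank_of_ne_zero hℓ hR.le hζ hA hne
  have h2 : ((j + 1 : ℕ) : ℕ∞) ≤ G.resMultiplicity ℓ ζ :=
    h1.trans (le_iSup₂_of_le R hR (le_iSup₂_of_le A hA le_rfl))
  have h3 : G.resMultiplicity ℓ ζ ≠ ⊤ :=
    ne_top_of_le_ne_top (ENat.natCast_ne_top _) (resMultiplicity_le hℓ ζ)
  rw [← ENat.natCast_toNat h3] at h2
  have h4 : j + 1 ≤ (G.resMultiplicity ℓ ζ).toNat := by exact_mod_cast h2
  omega

end OpenGraph

end

/-! ### Bounds that are uniform in the lengths -/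

noncomputable section

theorem nonneg_meromorphicOrderAt_prod_smul {V : Type*} [NormedAddCommGroup V] [NormedSpace ℂ V]
    {F : ℂ → V} {w : ℂ} (hF : MeromorphicAt F w) (S : Finset ℂ) (n : ℂ → ℕ)
    (hS : w ∈ S → ((-(n w : ℤ) : ℤ) : WithTop ℤ) ≤ meromorphicOrderAt F w)
    (hS' : w ∉ S → 0 ≤ meromorphicOrderAt F w) :
    0 ≤ meromorphicOrderAt ((fun z => ∏ ζ ∈ S, (z - ζ) ^ n ζ) • F) w := by
  rw [meromorphicOrderAt_smul (by fun_prop) hF, meromorphicOrderAt_prod_sub_pow]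
  split_ifs with hw
  · calc (0 : WithTop ℤ) = ((n w : ℤ) : WithTop ℤ) + ((-(n w : ℤ) : ℤ) : WithTop ℤ) := by
          rw [← WithTop.coe_add, add_neg_cancel]; rfl
      _ ≤ _ := by
        gcongr
        exact hS hw
  · simpa using hS' hw

namespace OpenGraph

variable {J K M : ℕ} {G : OpenGraph J K M} {ℓ : Fin M → ℝ} {R : ℝ}

theorem isCompact_lengths (M : ℕ) {𝓛 : Set ℝ} (h𝓛 : IsCompact 𝓛) :
    IsCompact {ℓ : Fin M → ℝ | ∀ m, ℓ m ∈ 𝓛} := by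
  have h := isCompact_univ_pi (X := fun _ : Fin M => ℝ) (s := fun _ => 𝓛) fun _ => h𝓛
  convert h using 1
  ext ℓ
  simp

/-- The number of zeros of the denominator in a bounded set. -/
theorem exists_sum_analyticOrderNatAt_le (G : OpenGraph J K M) {𝓛 : Set ℝ} (h𝓛 : IsCompact 𝓛)
    (h𝓛_pos : 𝓛 ⊆ Set.Ioi 0) {Ω : Set ℂ} (hΩ : Bornology.IsBounded Ω) :
    ∃ C : ℕ, ∀ ℓ : Fin M → ℝ, (∀ m, ℓ m ∈ 𝓛) → ∀ S : Finset ℂ, (∀ ζ ∈ S, ζ ∈ Ω) →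
      ∑ ζ ∈ S, analyticOrderNatAt (G.denominator ℓ) ζ ≤ C := by
  have hP := isCompact_lengths M h𝓛
  have hcont := G.continuous_denominator
  obtain ⟨r, hr, hΩr⟩ := hΩ.subset_closedBall_lt 0 Complex.I
  -- The centre is `i`, where the denominator vanishes for no choice of lengths; compactness makes
  -- the lower bound uniform.
  obtain ⟨δ, hδ, hδ'⟩ := hP.exists_forall_le' (f := fun ℓ => ‖G.denominator ℓ Complex.I‖) (a := 0)
    ((hcont.comp (Continuous.prodMk_right Complex.I)).norm.continuousOn) fun ℓ hℓ =>
      norm_pos_iff.2 (denominator_ne_zero (by simp) fun m => h𝓛_pos (hℓ m))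
  obtain ⟨B, hB⟩ := ((isCompact_sphere Complex.I (3 * r)).prod hP).exists_bound_of_continuousOn
    hcont.continuousOn
  obtain ⟨C, hC⟩ := pow_unbounded_of_one_lt (max B 0 / δ) one_lt_two
  refine ⟨C, fun ℓ hℓ S hS => ?_⟩
  have h0 : G.denominator ℓ Complex.I ≠ 0 := norm_pos_iff.1 (hδ.trans_le (hδ' ℓ hℓ))
  have h1 := two_pow_sum_analyticOrderNatAt_le (differentiable_denominator (G := G) (ℓ := ℓ)) h0 hr
    (M := max B 0) (fun z hz => (hB (z, ℓ) ⟨hz, hℓ⟩).trans (le_max_left _ _)) (S := S)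
    (fun ζ hζ => by simpa [dist_eq_norm] using hΩr (hS ζ hζ))
  have h2 : max B 0 / ‖G.denominator ℓ Complex.I‖ ≤ max B 0 / δ :=
    div_le_div_of_nonneg_left (le_max_right _ _) hδ (hδ' ℓ hℓ)
  exact ((pow_lt_pow_iff_right₀ one_lt_two).1 ((h1.trans h2).trans_lt hC)).le

theorem one_le_analyticOrderNatAt (hℓ : ∀ m, 0 < ℓ m) {ζ : ℂ} (hζ : ζ ∈ G.Res ℓ) :
    1 ≤ analyticOrderNatAt (G.denominator ℓ) ζ := by
  have h0 := Res_subset hℓ hζ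
  have h1 := analyticOrderAt_ne_top_of_ne_zero (differentiable_denominator (G := G) (ℓ := ℓ))
    (denominator_ne_zero (z := Complex.I) (by simp) hℓ) ζ
  rw [Nat.one_le_iff_ne_zero, analyticOrderNatAt, Ne, ENat.toNat_eq_zero,
    (differentiable_denominator.analyticAt ζ).analyticOrderAt_eq_zero]
  simp [h0, h1]

/-- The number of resonances in a bounded set, with multiplicities. -/
theorem exists_sum_resMultiplicity_le (G : OpenGraph J K M) {𝓛 : Set ℝ} (h𝓛 : IsCompact 𝓛)
    (h𝓛_pos : 𝓛 ⊆ Set.Ioi 0) {Ω : Set ℂ} (hΩ : Bornology.IsBounded Ω) :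
    ∃ C : ℕ, ∀ ℓ : Fin M → ℝ, (∀ m, ℓ m ∈ 𝓛) → (G.Res ℓ ∩ Ω).Finite ∧
      ∀ S : Finset ℂ, (∀ ζ ∈ S, ζ ∈ Ω) → ∑ ζ ∈ S, G.resMultiplicity ℓ ζ ≤ (C : ℕ∞) := by
  obtain ⟨C, hC⟩ := G.exists_sum_analyticOrderNatAt_le h𝓛 h𝓛_pos hΩ
  refine ⟨Fintype.card (WaveIndex K M) * C, fun ℓ hℓ => ?_⟩
  have hpos : ∀ m, 0 < ℓ m := fun m => h𝓛_pos (hℓ m)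
  refine ⟨?_, fun S hS => ?_⟩
  -- Every resonance uses up at least one zero of the denominator, so `C + 1` distinct resonances
  -- cannot exist.
  · by_contra hinf
    obtain ⟨S, hS, hcard⟩ := Set.Infinite.exists_subset_card_eq hinf (C + 1)
    have h1 := hC ℓ hℓ S fun ζ hζ => (hS hζ).2
    have h2 : ∑ ζ ∈ S, 1 ≤ ∑ ζ ∈ S, analyticOrderNatAt (G.denominator ℓ) ζ :=
      Finset.sum_le_sum fun ζ hζ => one_le_analyticOrderNatAt hpos (hS hζ).1
    rw [Finset.sum_const, smul_eq_mul, mul_one, hcard] at h2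
    omega
  · refine (Finset.sum_le_sum fun ζ _ => resMultiplicity_le hpos ζ).trans ?_
    rw [← Nat.cast_sum, ← Finset.mul_sum]
    exact_mod_cast Nat.mul_le_mul_left _ (hC ℓ hℓ S hS)

theorem norm_graphPairing_le (ℓ : Fin M → ℝ) (u : GraphL2 K ℓ) :
    ‖graphPairing ℓ u‖ ≤ (K + M : ℕ) * ‖u‖ :=
  ContinuousLinearMap.opNorm_le_bound _ (by positivity) fun v => by
    rw [mul_assoc]; exact norm_graphPairing_apply_le ℓ u v

/-- The numerator is bounded, uniformly with respect to the lengths of the edges. -/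
theorem exists_norm_numerator_le (G : OpenGraph J K M) {𝓛 : Set ℝ} (h𝓛 : IsCompact 𝓛)
    (R ρ : ℝ) : ∃ C : ℝ, 0 ≤ C ∧ ∀ ℓ : Fin M → ℝ, (∀ m, ℓ m ∈ 𝓛) → ∀ z : ℂ, ‖z‖ ≤ ρ →
      ‖G.numerator ℓ R z‖ ≤ C := by
  have hP := (isCompact_closedBall (0 : ℂ) ρ).prod (isCompact_lengths M h𝓛)
  obtain ⟨D, hD⟩ := hP.exists_bound_of_continuousOn G.continuous_resDet.continuousOn
  choose c hc using fun i j : WaveIndex K M =>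
    hP.exists_bound_of_continuousOn (G.continuous_resCoeff i j).continuousOn
  obtain ⟨L, hL⟩ := h𝓛.bddAbove
  set B := max (max R L) 0 with hB
  have hB0 : 0 ≤ B := le_max_right _ _
  set e := Real.sqrt B * Real.exp (ρ * B) with he
  have he0 : 0 ≤ e := by positivity
  refine ⟨2⁻¹ * (max D 0 * ((K + M : ℕ) * (B * Real.exp (ρ * B))) +
    ∑ i : WaveIndex K M, ∑ j : WaveIndex K M, max (c i j) 0 * ((K + M : ℕ) * e * e)), ?_, ?_⟩
  · positivity
  intro ℓ hℓ z hz
  have hlen : ∀ e : Fin K ⊕ Fin M, cutoffLength R ℓ e ≤ B := by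
    rintro (k | m)
    · exact (le_max_left _ _).trans (le_max_left _ _)
    · exact ((hL (hℓ m)).trans (le_max_right _ _)).trans (le_max_left _ _)
  have hmem : (z, ℓ) ∈ Metric.closedBall (0 : ℂ) ρ ×ˢ {ℓ : Fin M → ℝ | ∀ m, ℓ m ∈ 𝓛} :=
    ⟨by simpa using hz, hℓ⟩
  have hwave : ∀ i : WaveIndex K M, ‖truncatedWave ℓ R i z‖ ≤ e := fun i =>
    norm_truncatedWave_le ℓ hB0 (hlen _) hz
  have h1 : ‖Complex.I / 2‖ = 2⁻¹ := by simp
  rw [numerator, norm_smul, h1]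
  refine mul_le_mul_of_nonneg_left ((norm_add_le _ _).trans (add_le_add ?_ ?_)) (by norm_num)
  · rw [norm_smul]
    exact mul_le_mul ((hD _ hmem).trans (le_max_left _ _)) (norm_truncatedFree_le ℓ hB0 hlen hz)
      (norm_nonneg _) (le_max_right _ _)
  · rw [scatteringOp]
    refine norm_sum_le_of_le _ fun i _ => norm_sum_le_of_le _ fun j _ => ?_
    rw [norm_smul, ContinuousLinearMap.norm_smulRight_apply]
    refine mul_le_mul ((hc i j _ hmem).trans (le_max_left _ _)) ?_ (by positivity)
      (le_max_right _ _)
    refine mul_le_mul ((norm_graphPairing_le ℓ _).trans ?_) (hwave i) (norm_nonneg _)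
      (by positivity)
    exact mul_le_mul_of_nonneg_left (hwave j) (by positivity)

/-- The local form of the bound: it follows from a lower bound for the denominator on a circle. -/
theorem norm_cutoffResolvent_le_of_sphere (hK : 0 < K) (hℓ : ∀ m, 0 < ℓ m) (hR : 0 < R)
    {Ω : Set ℂ} {c : ℂ} {r ρ δ H : ℝ} {N : ℕ} (hr : 0 < r) (hρ : 1 ≤ ρ) (hδ : 0 < δ)
    (hball : Metric.closedBall c r ⊆ Ω) (hΩ : ∀ z ∈ Ω, ‖z‖ ≤ ρ) (hfin : (G.Res ℓ ∩ Ω).Finite)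
    (hN : ∑ ζ ∈ hfin.toFinset, (G.resMultiplicity ℓ ζ).toNat ≤ N)
    (hden : ∀ z ∈ Metric.sphere c r, δ ≤ ‖G.denominator ℓ z‖)
    (hH : ∀ z, ‖z‖ ≤ ρ → ‖G.numerator ℓ R z‖ ≤ H) {z : ℂ} (hz : z ∈ Metric.ball c r)
    (hzR : z ∉ G.Res ℓ) :
    ‖G.cutoffResolvent ℓ R z‖ ≤ (2 * ρ) ^ N * (δ⁻¹ * H) *
      ∏ᶠ ζ ∈ G.Res ℓ ∩ Ω, (‖z - ζ‖⁻¹) ^ (G.resMultiplicity ℓ ζ).toNat := by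
  set S := hfin.toFinset with hS
  set n : ℂ → ℕ := fun ζ => (G.resMultiplicity ℓ ζ).toNat with hn
  set P : ℂ → ℂ := fun z => ∏ ζ ∈ S, (z - ζ) ^ n ζ with hP
  have hPd : Differentiable ℂ P := by fun_prop
  have hPm : ∀ w, MeromorphicAt P w := fun w => (hPd.analyticAt w).meromorphicAt
  have hFm := fun w => meromorphicAt_cutoffResolvent (G := G) hℓ R w
  have hm : MeromorphicOn (P • G.cutoffResolvent ℓ R) Ω := fun w _ => (hPm w).smul (hFm w)
  -- The poles in `Ω` are cancelled because their orders do not exceed the multiplicities. At points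
  -- that are not resonances `g` has the value of the product, by continuity.
  obtain ⟨g, hg, -, hgF⟩ := hm.exists_analyticOnNhd fun w hw =>
    nonneg_meromorphicOrderAt_prod_smul (hFm w) S n
      (fun _ => neg_resMultiplicity_le_meromorphicOrderAt hK hℓ hR w)
      fun hwS => (analyticAt_cutoffResolvent hℓ hR fun h =>
        hwS (hfin.mem_toFinset.2 ⟨h, hw⟩)).meromorphicOrderAt_nonneg
  have heq : ∀ w ∈ Ω, w ∉ G.Res ℓ → g w = P w • G.cutoffResolvent ℓ R w := fun w hw hwR =>
    hgF w hw (hPd.continuous.continuousAt.smul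
      (analyticAt_cutoffResolvent hℓ hR hwR).continuousAt)
  have hzΩ : z ∈ Ω := hball (Metric.ball_subset_closedBall hz)
  have hH0 : 0 ≤ H := (norm_nonneg _).trans (hH z (hΩ z hzΩ))
  -- On the circle the resolvent is the quotient itself. Each factor `|w - ζ|` is at most `2 ρ`, and
  -- `ρ ≥ 1` permits raising the number of factors to `N`.
  have hsphere : ∀ w ∈ Metric.sphere c r, ‖g w‖ ≤ (2 * ρ) ^ N * (δ⁻¹ * H) := by
    intro w hw
    have hwΩ : w ∈ Ω := hball (Metric.sphere_subset_closedBall hw)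
    have hd := hden w hw
    have hd0 : G.denominator ℓ w ≠ 0 := norm_pos_iff.1 (hδ.trans_le hd)
    rw [heq w hwΩ fun h => hd0 (Res_subset hℓ h),
      (cutoffResolvent_eventuallyEq_nhds hℓ hd0).self_of_nhds, norm_smul, norm_smul, norm_inv]
    refine mul_le_mul ?_ ?_ (by positivity) (by positivity)
    · rw [hP, norm_prod]
      calc ∏ ζ ∈ S, ‖(w - ζ) ^ n ζ‖ ≤ ∏ ζ ∈ S, (2 * ρ) ^ n ζ := by
            refine Finset.prod_le_prod (fun _ _ => norm_nonneg _) fun ζ hζ => ?_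
            rw [norm_pow]
            refine pow_le_pow_left₀ (norm_nonneg _) ?_ _
            have h1 := hΩ w hwΩ
            have h2 := hΩ ζ (hfin.mem_toFinset.1 hζ).2
            have h3 := norm_sub_le w ζ
            linarith
        _ = (2 * ρ) ^ ∑ ζ ∈ S, n ζ := Finset.prod_pow_eq_pow_sum _ _ _
        _ ≤ (2 * ρ) ^ N := pow_le_pow_right₀ (by linarith) hN
    · exact mul_le_mul (inv_anti₀ hδ hd) (hH w (hΩ w hwΩ)) (norm_nonneg _) (by positivity)
  have hgz : ‖g z‖ ≤ (2 * ρ) ^ N * (δ⁻¹ * H) := by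
    refine Complex.norm_le_of_forall_mem_frontier_norm_le (U := Metric.ball c r)
      Metric.isBounded_ball (hg.differentiableOn.diffContOnCl_ball hball) ?_ (subset_closure hz)
    rw [frontier_ball c hr.ne']
    exact hsphere
  rw [heq z hzΩ hzR, norm_smul] at hgz
  have hP0 : P z ≠ 0 := Finset.prod_ne_zero_iff.2 fun ζ hζ => pow_ne_zero _ (sub_ne_zero.2 (by
    rintro rfl
    exact hzR (hfin.mem_toFinset.1 hζ).1))
  have hprod : ∏ᶠ ζ ∈ G.Res ℓ ∩ Ω, (‖z - ζ‖⁻¹) ^ (G.resMultiplicity ℓ ζ).toNat = ‖P z‖⁻¹ := by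
    rw [finprod_mem_eq_finite_toFinset_prod _ hfin, hP, norm_prod, ← Finset.prod_inv_distrib]
    refine Finset.prod_congr rfl fun ζ _ => ?_
    rw [norm_pow, inv_pow]
  rw [hprod, ← div_eq_mul_inv, le_div_iff₀ (norm_pos_iff.2 hP0), mul_comm]
  exact hgz

/-- By compactness of the set of pairs `(z, ℓ)` a local bound near `(c, ℓ₀)` suffices. The zeros of
the denominator for `ℓ₀` are isolated, so some circle around `c` avoids them, and by continuity half
of the lower bound on that circle persists for nearby lengths. The zeros inside may move or split;
the argument never follows them. -/
theorem exists_norm_cutoffResolvent_le (hK : 0 < K) (G : OpenGraph J K M) {𝓛 : Set ℝ}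
    (h𝓛 : IsCompact 𝓛) (h𝓛_pos : 𝓛 ⊆ Set.Ioi 0) {Ω Q : Set ℂ} (hΩ : IsOpen Ω)
    (hΩb : Bornology.IsBounded Ω) (hQ : IsCompact Q) (hQΩ : Q ⊆ Ω) (hR : 0 < R) :
    ∃ C : ℝ, 0 < C ∧ ∀ ℓ : Fin M → ℝ, (∀ m, ℓ m ∈ 𝓛) → ∀ z ∈ Q, z ∉ G.Res ℓ →
      ‖G.cutoffResolvent ℓ R z‖ ≤
        C * ∏ᶠ ζ ∈ G.Res ℓ ∩ Ω, (‖z - ζ‖⁻¹) ^ (G.resMultiplicity ℓ ζ).toNat := by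
  obtain ⟨N, hN⟩ := G.exists_sum_resMultiplicity_le h𝓛 h𝓛_pos hΩb
  obtain ⟨ρ, hρ, hΩρ⟩ := hΩb.subset_closedBall_lt 1 0
  obtain ⟨H, hH0, hH⟩ := G.exists_norm_numerator_le h𝓛 R ρ
  have hnonneg : ∀ (ℓ : Fin M → ℝ) (z : ℂ), 0 ≤ ∏ᶠ ζ ∈ G.Res ℓ ∩ Ω,
      (‖z - ζ‖⁻¹) ^ (G.resMultiplicity ℓ ζ).toNat := fun ℓ z =>
    finprod_nonneg fun ζ => finprod_nonneg fun _ => by positivity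
  have key : ∃ C : ℝ, 0 < C ∧ ∀ p ∈ Q ×ˢ {ℓ : Fin M → ℝ | ∀ m, ℓ m ∈ 𝓛}, (∀ m, p.2 m ∈ 𝓛) →
      p.1 ∉ G.Res p.2 → ‖G.cutoffResolvent p.2 R p.1‖ ≤
        C * ∏ᶠ ζ ∈ G.Res p.2 ∩ Ω, (‖p.1 - ζ‖⁻¹) ^ (G.resMultiplicity p.2 ζ).toNat := by
    refine (hQ.prod (isCompact_lengths M h𝓛)).induction_on
      (p := fun s => ∃ C : ℝ, 0 < C ∧ ∀ p ∈ s, (∀ m, p.2 m ∈ 𝓛) →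
      p.1 ∉ G.Res p.2 → ‖G.cutoffResolvent p.2 R p.1‖ ≤
        C * ∏ᶠ ζ ∈ G.Res p.2 ∩ Ω, (‖p.1 - ζ‖⁻¹) ^ (G.resMultiplicity p.2 ζ).toNat) ?_ ?_ ?_ ?_
    · exact ⟨1, one_pos, by simp⟩
    · rintro s t hst ⟨C, hC, h⟩
      exact ⟨C, hC, fun p hp => h p (hst hp)⟩
    · rintro s t ⟨C, hC, h⟩ ⟨C', hC', h'⟩
      refine ⟨max C C', lt_max_of_lt_left hC, fun p hp hp1 hp2 => ?_⟩
      rcases hp with hp | hp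
      · exact (h p hp hp1 hp2).trans (mul_le_mul_of_nonneg_right (le_max_left _ _) (hnonneg _ _))
      · exact (h' p hp hp1 hp2).trans (mul_le_mul_of_nonneg_right (le_max_right _ _) (hnonneg _ _))
    · rintro ⟨c, ℓ₀⟩ ⟨hc, hℓ₀⟩
      have hpos : ∀ m, 0 < ℓ₀ m := fun m => h𝓛_pos (hℓ₀ m)
      obtain ⟨r₁, hr₁, hball⟩ := Metric.isOpen_iff.1 hΩ c (hQΩ hc)
      have hne : ∀ᶠ z in 𝓝[≠] c, G.denominator ℓ₀ z ≠ 0 :=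
        ((differentiable_denominator.analyticAt c).eventually_eq_zero_or_eventually_ne_zero).resolve_left
          fun h => analyticOrderAt_ne_top_of_ne_zero differentiable_denominator
            (denominator_ne_zero (z := Complex.I) (by simp) hpos) c (analyticOrderAt_eq_top.2 h)
      obtain ⟨r₂, hr₂, hden⟩ := Metric.mem_nhdsWithin_iff.1 hne
      set r := min r₁ r₂ / 2 with hr
      have hr0 : 0 < r := by positivity
      have hrr₁ : r < r₁ := by have := min_le_left r₁ r₂; linarith
      have hrr₂ : r < r₂ := by have := min_le_right r₁ r₂; linarith
      obtain ⟨δ, hδ, hδ'⟩ := (isCompact_sphere c r).exists_forall_le' (a := 0)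
        (f := fun z => ‖G.denominator ℓ₀ z‖) differentiable_denominator.continuous.norm.continuousOn
        fun z hz => norm_pos_iff.2 (hden ⟨by
          rw [Metric.mem_ball, Metric.mem_sphere.1 hz]; exact hrr₂, by
          rintro rfl
          rw [Metric.mem_sphere, dist_self] at hz
          exact hr0.ne hz⟩)
      have hev : ∀ᶠ ℓ in 𝓝 ℓ₀, ∀ z ∈ Metric.sphere c r, δ / 2 < ‖G.denominator ℓ z‖ := by
        refine (isCompact_sphere c r).eventually_forall_of_forall_eventually fun z hz => ?_
        have h1 : Continuous fun p : (Fin M → ℝ) × ℂ => ‖G.denominator p.1 p.2‖ :=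
          (G.continuous_denominator.comp continuous_swap).norm
        exact h1.continuousAt.eventually_const_lt ((half_lt_self hδ).trans_le (hδ' z hz))
      refine ⟨Metric.ball c r ×ˢ {ℓ | ∀ z ∈ Metric.sphere c r, δ / 2 < ‖G.denominator ℓ z‖},
        mem_nhdsWithin_of_mem_nhds (prod_mem_nhds (Metric.ball_mem_nhds c hr0) hev),
        -- `H + 1` replaces `H`, which may be zero, to keep the constant positive.
        (2 * ρ) ^ N * ((δ / 2)⁻¹ * (H + 1)), by positivity, ?_⟩
      rintro ⟨z, ℓ⟩ ⟨hz, hℓ⟩ hmem hzR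
      obtain ⟨hfin, hsum⟩ := hN ℓ hmem
      refine norm_cutoffResolvent_le_of_sphere hK (fun m => h𝓛_pos (hmem m)) hR hr0 hρ.le
        (half_pos hδ) ((Metric.closedBall_subset_ball hrr₁).trans hball)
        (fun w hw => by simpa using hΩρ hw) hfin ?_ (fun w hw => (hℓ w hw).le)
        (fun w hw => (hH ℓ hmem w hw).trans (by linarith)) hz hzR
      have h1 := hsum hfin.toFinset fun ζ hζ => (hfin.mem_toFinset.1 hζ).2
      have h2 : ∀ ζ, G.resMultiplicity ℓ ζ = ((G.resMultiplicity ℓ ζ).toNat : ℕ∞) := fun ζ =>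
        (ENat.natCast_toNat (ne_top_of_le_ne_top (ENat.natCast_ne_top _)
          (resMultiplicity_le (fun m => h𝓛_pos (hmem m)) ζ))).symm
      rw [Finset.sum_congr rfl fun ζ _ => h2 ζ, ← Nat.cast_sum] at h1
      exact_mod_cast h1
  obtain ⟨C, hC, h⟩ := key
  exact ⟨C, hC, fun ℓ hℓ z hz hzR => h (z, ℓ) ⟨hz, hℓ⟩ hℓ hzR⟩

end OpenGraph

end

theorem proposition4 {J K M : ℕ} (hK : 0 < K) (G : OpenGraph J K M)
    (𝓛 : Set ℝ) (h𝓛 : IsCompact 𝓛) (h𝓛_pos : 𝓛 ⊆ Set.Ioi 0)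
    (Ω₂ : Set ℂ) (hΩ₂ : IsOpen Ω₂) (hΩ₂_cpt : IsCompact (closure Ω₂)) :
    -- the cut-off resolvents continue meromorphically, so that resonances are defined
    (∀ ℓ : Fin M → ℝ, (∀ m, ℓ m ∈ 𝓛) →
      ∀ R : ℝ, 0 < R → G.IsCutoffResolvent ℓ R (G.cutoffResolvent ℓ R)) ∧
    -- the number of resonances in `Ω₂`
    (∃ C₁ : ℕ, ∀ ℓ : Fin M → ℝ, (∀ m, ℓ m ∈ 𝓛) →
      (G.Res ℓ ∩ Ω₂).Finite ∧
      ∑ᶠ ζ ∈ G.Res ℓ ∩ Ω₂, G.resMultiplicity ℓ ζ ≤ (C₁ : ℕ∞)) ∧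
    -- the bound on the cut-off resolvent
    (∀ Ω₁ : Set ℂ, IsOpen Ω₁ → closure Ω₁ ⊆ Ω₂ → ∀ R : ℝ, 0 < R →
      ∃ C₂ : ℝ, 0 < C₂ ∧ ∀ ℓ : Fin M → ℝ, (∀ m, ℓ m ∈ 𝓛) →
        ∀ z ∈ Ω₁, z ∉ G.Res ℓ →
          ‖G.cutoffResolvent ℓ R z‖ ≤
            C₂ * ∏ᶠ ζ ∈ G.Res ℓ ∩ Ω₂, (‖z - ζ‖⁻¹) ^ (G.resMultiplicity ℓ ζ).toNat) := by
  have hb : Bornology.IsBounded Ω₂ := hΩ₂_cpt.isBounded.subset subset_closure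
  refine ⟨fun ℓ hℓ R _ => OpenGraph.isCutoffResolvent_cutoffResolvent
    (fun m => h𝓛_pos (hℓ m)) R, ?_, fun Ω₁ _ hΩ₁₂ R hR => ?_⟩
  · obtain ⟨C, hC⟩ := G.exists_sum_resMultiplicity_le h𝓛 h𝓛_pos hb
    refine ⟨C, fun ℓ hℓ => ?_⟩
    obtain ⟨hfin, hsum⟩ := hC ℓ hℓ
    refine ⟨hfin, ?_⟩
    rw [finsum_mem_eq_finite_toFinset_sum _ hfin]
    exact hsum _ fun ζ hζ => (hfin.mem_toFinset.1 hζ).2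
  · obtain ⟨C, hC0, hC⟩ := OpenGraph.exists_norm_cutoffResolvent_le hK G h𝓛 h𝓛_pos hΩ₂ hb
      (hΩ₂_cpt.of_isClosed_subset isClosed_closure (hΩ₁₂.trans subset_closure)) hΩ₁₂ hR
    exact ⟨C, hC0, fun ℓ hℓ z hz => hC ℓ hℓ z (subset_closure hz)⟩
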